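/- **Braided Jacobi identity for $H_D$-quantum vertex algebras.** Let $V$ be a complex vector space, $D\colon V\to V$ linear (an action of $H_D=\mathbb C[D]$), and let $t$ be a formal variable. An *$H_D$-quantum vertex algebra* structure on $(V,D)$ consists of a vacuum vector $1\in V$ and linear maps $$X_{z_1,z_2}\colon V^{\otimes 2}\to V[[z_1,z_2]][z_1^{-1},(z_1-z_2)^{-1}][[t]],$$ $$S^{(\tau)}_{z_1,z_2}\colon V^{\otimes 2}\to V^{\otimes2}[z_1^{\pm1},z_2^{\pm1},(z_1-z_2)^{-1}][[t]],$$ $$S^{(\gamma)}_{z_1,z_2}\colon V^{\otimes 2}\to V^{\otimes 2}[z_1^{\pm1},z_2,(z_1-z_2)^{-1},(z_1+\gamma)^{\pm1},z_2+\gamma][[t]]$$ (all maps are extended $t$-linearly and $t$-adically continuously when composed). In the following axioms $i_{z_1;z_2}$ denotes expansion in the region $|z_1|>|z_2|$, upper indices on $S$ are the tensor factors on which it acts, and $Y(a,z)b=Y_z(a\otimes b)=X_{z,0}(a\otimes b)$. * Vacuum: $X_{z_1,z_2}(a\otimes1)=e^{z_1D}a$, $X_{z_1,z_2}(1\otimes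 a)=e^{z_2D}a$, $S^{(\tau)}(a\otimes 1)=a\otimes 1$, $S^{(\tau)}(1\otimes a)=1\otimes a$. * $H_D$-covariance: $X_{z_1,z_2}(a\otimes Db)=\partial_{z_2}X_{z_1,z_2}(a\otimes b)$. * Braided commutativity: $X_{z_1,z_2}(a\otimes b)=X_{z_2,z_1}\circ S^{(\tau)}_{z_2,z_1}(b\otimes a)$. * Broken translation covariance: $e^{\gamma D}X_{z_1,z_2}\circ S^{(\gamma)}_{z_1,z_2}(a\otimes b)=X_{z_1+\gamma,z_2+\gamma}(a\otimes b)$. * Yang–Baxter, for $S=S^{(\tau)}$: $S^{12}_{z_1,z_2}S^{13}_{z_1,z_3}S^{23}_{z_2,z_3}=S^{23}_{z_2,z_3}S^{13}_{z_1,z_3}S^{12}_{z_1,z_2}$. * Hexagons, for $S=S^{(\tau)}$, expanded in $|z_1|>|z_2|>|w_1|>|w_2|$: $$S_{z_1,z_2}(1\otimes X_{w_1,w_2})=(1\otimes X_{w_1,w_2})S^{12}_{z_1,z_2+w_1}S^{13}_{z_1,z_2+w_2},$$ $$S_{z_1,z_2}(X_{w_1,w_2}\otimes1)=(X_{w_1,w_2}\otimes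 1)S^{23}_{z_1+w_2,z_2}S^{13}_{z_1+w_1,z_2}.$$ * Locality: for all $a,b\in V$ and $K\ge0$ there is $N\ge 0$ such that for all $c\in V$ $$(z_1-z_2)^NY(a,z_1)Y(b,z_2)c\equiv(z_1-z_2)^N\,Y_{z_2}(1\otimes Y_{z_1})\,i_{z_2;z_1}S^{(\tau),12}_{z_2,z_1}(b\otimes a\otimes c)\pmod{t^K}.$$ Let $\delta(z,w)=\sum_{n\in\mathbb Z}z^{n}w^{-n-1}=\sum_{n\in\mathbb Z}z^{-n-1}w^{n}$. Then in every $H_D$-quantum vertex algebra, for all $a,b,c\in V$, $$i_{z_1;z_2}\delta(z_1-z_2,z_3)\,Y(a,z_1)Y(b,z_2)c\;-\;i_{z_2;z_1}\delta(z_1-z_2,z_3)\,Y_{z_2}(1\otimes Y_{z_1})\,S^{(\tau),12}_{z_2,z_1}(b\otimes a\otimes c)$$ $$=\;i_{z_2;z_3}\delta(z_1,z_2+z_3)\,Y_{z_2}(Y_{z_3}\otimes1)\,S^{(z_2),12}_{z_3,0}(a\otimes b\otimes c)$$ as formal distributions in $V[[z_1^{\pm1},z_2^{\pm1},z_3^{\pm1}]][[t]]$.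 Here the expansions $i_{z_2;z_1}$ and $i_{z_2;z_3}$ apply also to the braiding and translation maps, and in the first expression $i_{z_1;z_2}\delta(z_1-z_2,z_3)=\sum_n z_3^{-n-1}\,i_{z_1;z_2}(z_1-z_2)^n$ (similarly for the others). -/

import Mathlib

open scoped TensorProduct

noncomputable section

set_option linter.unusedSectionVars false

namespace HDQ

/-! ## Formal Laurent series with coefficients in a vector space -/

/-- `L((y))`, the field of formal Laurent series in a variable `y` over a field `L ⊇ ℂ`. -/
def LF (L : Type*) [Field L] : Type _ := LaurentSeries L

section LF

variable (L : Type*) [Field L] [Algebra ℂ L]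

instance : Field (LF L) := inferInstanceAs (Field (HahnSeries ℤ L))

instance : Algebra ℂ (LF L) := (HahnSeries.instAlgebra : Algebra ℂ (HahnSeries ℤ L))

variable {L}

/-- The inclusion of constants, `L → L((y))`. -/
def LF.C : L →+* LF L := (HahnSeries.C : L →+* HahnSeries ℤ L)

variable (L) in
/-- The variable `y` of `L((y))`. -/
def LF.var : LF L := (HahnSeries.single 1 1 : HahnSeries ℤ L)

end LF

/-- `M((y))`, the formal Laurent series in a variable `y` with coefficients in `M`, regarded as
a module over `L((y))`, where `L` is a field of scalars acting on `M`.  Iterating,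
`LSer L₁ (LSer ℂ V)` is `V((x))((y))`: the *outer* variable `y` is the *small* one, that is, this
is the space in which expansions in the region `|x| > |y|` live. -/
def LSer (L M : Type*) [Field L] [AddCommGroup M] [Module L M] : Type _ := HahnModule ℤ L M

section LSer

variable (L : Type*) [Field L] [Algebra ℂ L]
variable (M : Type*) [AddCommGroup M] [Module ℂ M] [Module L M] [IsScalarTower ℂ L M]

instance : AddCommGroup (LSer L M) := inferInstanceAs (AddCommGroup (HahnModule ℤ L M))

instance : Module (LF L) (LSer L M) :=
  inferInstanceAs (Module (HahnSeries ℤ L) (HahnModule ℤ L M))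

instance : Module ℂ (LSer L M) := Module.compHom _ (algebraMap ℂ (LF L))

instance : IsScalarTower ℂ (LF L) (LSer L M) :=
  IsScalarTower.of_algebraMap_smul fun _ _ => rfl

variable {L M}

/-- The series with a given family of coefficients. -/
def LSer.mk (f : HahnSeries ℤ M) : LSer L M := HahnModule.of L f

/-- The coefficient of the `n`-th power of the (outer) variable. -/
def LSer.coeff (f : LSer L M) (n : ℤ) : M := ((HahnModule.of L).symm f).coeff n

theorem LSer.ext {f g : LSer L M} (h : ∀ n, f.coeff n = g.coeff n) : f = g :=
  HahnModule.ext f g (funext h)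

@[simp] theorem LSer.coeff_mk (f : HahnSeries ℤ M) (n : ℤ) :
    (LSer.mk f : LSer L M).coeff n = f.coeff n := rfl

@[simp] theorem LSer.coeff_add (f g : LSer L M) (n : ℤ) :
    (f + g).coeff n = f.coeff n + g.coeff n := rfl

@[simp] theorem LSer.coeff_smul (r : ℂ) (f : LSer L M) (n : ℤ) :
    (r • f).coeff n = r • f.coeff n := by
  have e : (HahnSeries.instAlgebra : Algebra ℂ (HahnSeries ℤ L)).algebraMap r =
      HahnSeries.single 0 (algebraMap ℂ L r) := HahnSeries.algebraMap_apply
  let g : HahnModule ℤ L M := f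
  change ((HahnModule.of L).symm
    ((HahnSeries.instAlgebra : Algebra ℂ (HahnSeries ℤ L)).algebraMap r • g)).coeff n = _
  rw [e]
  exact (HahnModule.coeff_single_zero_smul (Γ := ℤ)).trans (algebraMap_smul L r _)

/-- Coefficient extraction as a linear map. -/
def LSer.coeffL (n : ℤ) : LSer L M →ₗ[ℂ] M where
  toFun f := f.coeff n
  map_add' f g := by simp
  map_smul' r f := by simp

/-- A vector, as a series which is constant in the variable. -/
def LSer.const : M →ₗ[ℂ] LSer L M where
  toFun v := LSer.mk (HahnSeries.single 0 v)
  map_add' v w := by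
    apply LSer.ext; intro n
    simp only [LSer.coeff_mk, LSer.coeff_add, ← HahnSeries.coeff_add, ← HahnSeries.single_add]
  map_smul' r v := by apply LSer.ext; intro n; simp [HahnSeries.coeff_single]

/-- Formal differentiation with respect to the (outer) variable. -/
def LSer.deriv : LSer L M →ₗ[ℂ] LSer L M where
  toFun f := LSer.mk (LaurentSeries.derivative ℂ ((HahnModule.of L).symm f))
  map_add' f g := by
    apply LSer.ext; intro n
    have h := LSer.coeff_add f g (n + 1)
    simp only [LSer.coeff] at h
    simp [LaurentSeries.derivative_apply, h]
  map_smul' r f := by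
    apply LSer.ext; intro n
    have h := LSer.coeff_smul r f (n + 1)
    simp only [LSer.coeff] at h
    simp [LaurentSeries.derivative_apply, h]
    rw [smul_comm]

/-- For a linear operator `T`, the exponential `e^{yT} v = ∑ₙ yⁿ Tⁿ v / n!`, with `y` a new
(small) variable.  For `T = ∂ₓ` this is the expansion of `v(x + y)` in the region `|x| > |y|`. -/
def LSer.exp (T : M →ₗ[ℂ] M) : M →ₗ[ℂ] LSer L M where
  toFun v := LSer.mk (HahnSeries.ofSuppBddBelow
    (fun n : ℤ => if 0 ≤ n then ((n.toNat.factorial : ℂ)⁻¹) • (T ^ n.toNat) v else 0)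
    ⟨0, fun n hn => by
      by_contra h
      exact hn (if_neg (by simpa using h))⟩)
  map_add' v w := by
    apply LSer.ext; intro n
    simp only [LSer.coeff_mk, LSer.coeff_add, HahnSeries.ofSuppBddBelow]
    split_ifs <;> simp
  map_smul' r v := by
    apply LSer.ext; intro n
    simp only [LSer.coeff_mk, LSer.coeff_smul, HahnSeries.ofSuppBddBelow, RingHom.id_apply]
    split_ifs
    · rw [map_smul, smul_comm]
    · simp

variable {L' : Type*} [Field L'] [Algebra ℂ L']
variable {M' : Type*} [AddCommGroup M'] [Module ℂ M'] [Module L' M'] [IsScalarTower ℂ L' M']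

/-- Application of a linear map to every coefficient: `M((y)) → M'((y))`. -/
def LSer.map : (M →ₗ[ℂ] M') →ₗ[ℂ] (LSer L M →ₗ[ℂ] LSer L' M') where
  toFun φ :=
    { toFun := fun f => LSer.mk (((HahnModule.of L).symm f).map φ)
      map_add' := fun f g => by apply LSer.ext; intro n; rw [LSer.coeff_add]; exact map_add φ _ _
      map_smul' := fun r f => by
        apply LSer.ext; intro n
        have h := LSer.coeff_smul r f n
        simp only [LSer.coeff] at h
        simp [h] }
  map_add' φ ψ := by ext f; apply LSer.ext; intro n; simp
  map_smul' r φ := by ext f; apply LSer.ext; intro n; simp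

@[simp] theorem LSer.coeff_map (φ : M →ₗ[ℂ] M') (f : LSer L M) (n : ℤ) :
    (LSer.map φ f : LSer L' M').coeff n = φ (f.coeff n) := rfl

end LSer

/-! ## Iterated Laurent series in up to four variables -/

abbrev L1 := LF ℂ
abbrev L2 := LF L1
abbrev L3 := LF L2
abbrev L4 := LF L3

section Spaces

variable (W : Type*) [AddCommGroup W] [Module ℂ W]

/-- `W((x))` -/
abbrev V1 := LSer ℂ W
/-- `W((x₁))((x₂))` -/
abbrev V2 := LSer L1 (V1 W)
/-- `W((x₁))((x₂))((x₃))` -/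
abbrev V3 := LSer L2 (V2 W)
/-- `W((x₁))((x₂))((x₃))((x₄))` -/
abbrev V4 := LSer L3 (V3 W)

variable {W}

/-- The coefficient of `x₁ᵖ x₂^q` in an element of `W((x₁))((x₂))`. -/
def cf (f : V2 W) (p q : ℤ) : W := (f.coeff q).coeff p

/-- Vectors as constants in `W((x₁))((x₂))`. -/
def const₂ : W →ₗ[ℂ] V2 W := LSer.const ∘ₗ LSer.const

end Spaces

/-- The variables of `L2 = ℂ((x))((y))`. -/
def x : L2 := LF.C (LF.var ℂ)
def y : L2 := LF.var L1

/-- The variables of `L3 = ℂ((z₁))((z₂))((z₃))`. -/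
def z₁ : L3 := LF.C x
def z₂ : L3 := LF.C y
def z₃ : L3 := LF.var L2

/-- The variables of `L4 = ℂ((u₁))((u₂))((w₁))((w₂))`. -/
def u₁ : L4 := LF.C z₁
def u₂ : L4 := LF.C z₂
def w₁ : L4 := LF.C z₃
def w₂ : L4 := LF.var L3

/-! ## The coefficient algebras of the braiding and translation maps -/

/-- `ℂ[z₁^{±1}, z₂^{±1}, (z₁ - z₂)⁻¹]` -/
abbrev Aτ := Localization.Away
  (MvPolynomial.X 0 * MvPolynomial.X 1 * (MvPolynomial.X 0 - MvPolynomial.X 1) :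
    MvPolynomial (Fin 2) ℂ)

/-- `ℂ[z₁^{±1}, z₂, (z₁ - z₂)⁻¹, (z₁ + γ)^{±1}, z₂ + γ]`, the three polynomial variables being
`z₁, z₂, γ`. -/
abbrev Aγ := Localization.Away
  (MvPolynomial.X 0 * (MvPolynomial.X 0 - MvPolynomial.X 1) *
    (MvPolynomial.X 0 + MvPolynomial.X 2) : MvPolynomial (Fin 3) ℂ)

section Eval

variable {L : Type*} [Field L] [Algebra ℂ L]

/-- Substitution `z₁ ↦ p`, `z₂ ↦ q` in `ℂ[z₁^{±1}, z₂^{±1}, (z₁ - z₂)⁻¹]`.  Taking for `L` a field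
of iterated Laurent series gives the corresponding expansion. -/
def evτ (p q : L) (h : p * q * (p - q) ≠ 0) : Aτ →ₐ[ℂ] L :=
  IsLocalization.liftAlgHom (M := Submonoid.powers
    (MvPolynomial.X 0 * MvPolynomial.X 1 * (MvPolynomial.X 0 - MvPolynomial.X 1) :
      MvPolynomial (Fin 2) ℂ)) (f := MvPolynomial.aeval ![p, q]) (by
    rintro ⟨_, n, rfl⟩
    simpa using (IsUnit.mk0 _ h).pow n)

/-- Substitution `z₁ ↦ p`, `z₂ ↦ q`, `γ ↦ g` in the coefficient algebra of the translation
map. -/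
def evγ (p q g : L) (h : p * (p - q) * (p + g) ≠ 0) : Aγ →ₐ[ℂ] L :=
  IsLocalization.liftAlgHom (M := Submonoid.powers
    (MvPolynomial.X 0 * (MvPolynomial.X 0 - MvPolynomial.X 1) *
      (MvPolynomial.X 0 + MvPolynomial.X 2) : MvPolynomial (Fin 3) ℂ))
    (f := MvPolynomial.aeval ![p, q, g]) (by
    rintro ⟨_, n, rfl⟩
    simpa using (IsUnit.mk0 _ h).pow n)

theorem C_ne {a : L} (h : a ≠ 0) : LF.C a ≠ 0 := (map_ne_zero LF.C).2 h

theorem var_ne : LF.var L ≠ 0 := by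
  intro e
  have h1 := congrArg (fun f : HahnSeries ℤ L => f.coeff 1) e
  change (HahnSeries.single 1 1 : HahnSeries ℤ L).coeff 1 = (0 : HahnSeries ℤ L).coeff 1 at h1
  simp at h1

theorem C_add_var_ne (a : L) : LF.C a + LF.var L ≠ 0 := by
  intro e
  have h : (HahnSeries.C a : HahnSeries ℤ L) + HahnSeries.single 1 1 = 0 := e
  have h1 := congrArg (fun f : HahnSeries ℤ L => f.coeff 1) h
  simp [HahnSeries.C_apply, HahnSeries.coeff_single_of_ne] at h1

theorem C_sub_var_ne (a : L) : LF.C a - LF.var L ≠ 0 := by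
  intro e
  have h : (HahnSeries.C a : HahnSeries ℤ L) - HahnSeries.single 1 1 = 0 := e
  have h1 := congrArg (fun f : HahnSeries ℤ L => f.coeff 1) h
  simp [HahnSeries.C_apply, HahnSeries.coeff_single_of_ne] at h1

end Eval

theorem x_ne : x ≠ 0 := C_ne var_ne
theorem y_ne : y ≠ 0 := var_ne
theorem x_sub_y_ne : x - y ≠ 0 := C_sub_var_ne _
theorem x_add_y_ne : x + y ≠ 0 := C_add_var_ne _
theorem z₁_ne : z₁ ≠ 0 := C_ne x_ne
theorem z₂_ne : z₂ ≠ 0 := C_ne y_ne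
theorem z₃_ne : z₃ ≠ 0 := var_ne
theorem z₁_sub_z₂_ne : z₁ - z₂ ≠ 0 := by
  have h := C_ne x_sub_y_ne
  rwa [map_sub] at h
theorem u₁_ne : u₁ ≠ 0 := C_ne z₁_ne
theorem u₂_ne : u₂ ≠ 0 := C_ne z₂_ne

/-- Expansion `i_{x;y}` of functions of `(x, y)`, in the region `|x| > |y|`. -/
def ι : Aτ →ₐ[ℂ] L2 := evτ x y (mul_ne_zero (mul_ne_zero x_ne y_ne) x_sub_y_ne)

def ι₁₂ : Aτ →ₐ[ℂ] L3 := evτ z₁ z₂ (mul_ne_zero (mul_ne_zero z₁_ne z₂_ne) z₁_sub_z₂_ne)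
def ι₁₃ : Aτ →ₐ[ℂ] L3 :=
  evτ z₁ z₃ (mul_ne_zero (mul_ne_zero z₁_ne z₃_ne) (C_sub_var_ne _))
def ι₂₃ : Aτ →ₐ[ℂ] L3 :=
  evτ z₂ z₃ (mul_ne_zero (mul_ne_zero z₂_ne z₃_ne) (C_sub_var_ne _))

/-- Substitution of `(u₁, u₂ + w₁)`, expanded in the region `|u₁| > |u₂| > |w₁|`. -/
def ιr₁ : Aτ →ₐ[ℂ] L4 := evτ u₁ (u₂ + w₁) (by
  refine mul_ne_zero (mul_ne_zero u₁_ne ?_) ?_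
  · have h := C_ne (C_add_var_ne y)
    rwa [map_add] at h
  · have h := C_ne (C_sub_var_ne (x - y))
    rw [map_sub, map_sub, map_sub] at h
    rwa [← sub_sub])

/-- Substitution of `(u₁, u₂ + w₂)`, expanded in the region `|u₁| > |u₂| > |w₂|`. -/
def ιr₂ : Aτ →ₐ[ℂ] L4 := evτ u₁ (u₂ + w₂) (by
  refine mul_ne_zero (mul_ne_zero u₁_ne (C_add_var_ne _)) ?_
  have h := C_sub_var_ne (z₁ - z₂)
  rw [map_sub] at h
  rwa [← sub_sub])

/-- Substitution of `(u₁ + w₁, u₂)`, expanded in the region `|u₁| > |u₂| > |w₁|`. -/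
def ιl₁ : Aτ →ₐ[ℂ] L4 := evτ (u₁ + w₁) u₂ (by
  refine mul_ne_zero (mul_ne_zero ?_ u₂_ne) ?_
  · have h := C_ne (C_add_var_ne x)
    rwa [map_add] at h
  · have h := C_ne (C_add_var_ne (x - y))
    rw [map_add, map_sub, map_sub] at h
    rwa [add_sub_right_comm])

/-- Substitution of `(u₁ + w₂, u₂)`, expanded in the region `|u₁| > |u₂| > |w₂|`. -/
def ιl₂ : Aτ →ₐ[ℂ] L4 := evτ (u₁ + w₂) u₂ (by
  refine mul_ne_zero (mul_ne_zero (C_add_var_ne _) u₂_ne) ?_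
  have h := C_add_var_ne (z₁ - z₂)
  rw [map_sub] at h
  rwa [add_sub_right_comm])

/-- Expansion of functions of `(z₁, z₂, γ)` in the region `|z₁| > |z₂| > |γ|`; here `γ` is the
third variable of `L3`. -/
def ιγ : Aγ →ₐ[ℂ] L3 :=
  evγ z₁ z₂ z₃ (mul_ne_zero (mul_ne_zero z₁_ne z₁_sub_z₂_ne) (C_add_var_ne _))

/-- Substitution of `(z₁, z₂, γ) = (y, 0, x)`, expanded in the region `|x| > |y|`. -/
def ιγ₀ : Aγ →ₐ[ℂ] L2 := evγ y 0 x (by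
  refine mul_ne_zero (mul_ne_zero y_ne (by simpa using y_ne)) ?_
  rw [add_comm]; exact x_add_y_ne)

/-! ## Composition with the braiding and translation maps

Maps with values in series in the quantum variable `t` are given by the sequence of their
`t`-coefficients; composition of such maps is `t`-linear and `t`-adically continuous, that is, it
is given by the Cauchy product. -/

section Compose

variable {U W : Type*} [AddCommGroup U] [Module ℂ U] [AddCommGroup W] [Module ℂ W]
variable {A : Type*} [CommRing A] [Algebra ℂ A]
variable {L : Type*} [Field L] [Algebra ℂ L]
variable {M : Type*} [AddCommGroup M] [Module ℂ M] [Module L M] [IsScalarTower ℂ L M]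

/-- The map `A ⊗ W → L ⊗ W` given by an evaluation `A → L`. -/
def expand (ev : A →ₐ[ℂ] L) : A ⊗[ℂ] W →ₗ[ℂ] L ⊗[ℂ] W := ev.toLinearMap.rTensor W

/-- The `tᵏ`-coefficient of `φ ∘ S`, where `S : U → (A ⊗ W)[[t]]` is expanded by `A → L` and
`φ : W → M[[t]]` is extended `L`-linearly and `t`-linearly. -/
def comp (φ : ℕ → W →ₗ[ℂ] M) (ev : A →ₐ[ℂ] L) (S : ℕ → U →ₗ[ℂ] A ⊗[ℂ] W) (k : ℕ) :
    U →ₗ[ℂ] M :=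
  ∑ ij ∈ Finset.HasAntidiagonal.antidiagonal k,
    ((LinearMap.liftBaseChange L (φ ij.1)).restrictScalars ℂ) ∘ₗ expand ev ∘ₗ S ij.2

end Compose

section ThreeFold

variable {V : Type*} [AddCommGroup V] [Module ℂ V]
variable {A : Type*} [CommRing A] [Algebra ℂ A]
variable {L : Type*} [Field L] [Algebra ℂ L]

/-- The action of `s` on the second and third factors of `V ⊗ V ⊗ V`. -/
def leg23 (s : V ⊗[ℂ] V →ₗ[ℂ] L ⊗[ℂ] (V ⊗[ℂ] V)) :
    V ⊗[ℂ] (V ⊗[ℂ] V) →ₗ[ℂ] L ⊗[ℂ] (V ⊗[ℂ] (V ⊗[ℂ] V)) :=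
  (TensorProduct.leftComm ℂ V L (V ⊗[ℂ] V)).toLinearMap ∘ₗ s.lTensor V

/-- The action of `s` on the first and second factors of `V ⊗ V ⊗ V`. -/
def leg12 (s : V ⊗[ℂ] V →ₗ[ℂ] L ⊗[ℂ] (V ⊗[ℂ] V)) :
    V ⊗[ℂ] (V ⊗[ℂ] V) →ₗ[ℂ] L ⊗[ℂ] (V ⊗[ℂ] (V ⊗[ℂ] V)) :=
  (TensorProduct.assoc ℂ V V V).toLinearMap.lTensor L ∘ₗ
    (TensorProduct.assoc ℂ L (V ⊗[ℂ] V) V).toLinearMap ∘ₗ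
    s.rTensor V ∘ₗ (TensorProduct.assoc ℂ V V V).symm.toLinearMap

/-- The action of `s` on the first and third factors of `V ⊗ V ⊗ V`. -/
def leg13 (s : V ⊗[ℂ] V →ₗ[ℂ] L ⊗[ℂ] (V ⊗[ℂ] V)) :
    V ⊗[ℂ] (V ⊗[ℂ] V) →ₗ[ℂ] L ⊗[ℂ] (V ⊗[ℂ] (V ⊗[ℂ] V)) :=
  ((TensorProduct.comm ℂ V V).toLinearMap.lTensor V).lTensor L ∘ₗ
    leg12 s ∘ₗ (TensorProduct.comm ℂ V V).toLinearMap.lTensor V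

/-- `L`-linear operators on `L ⊗ V^{⊗3}`, as formal power series in `t`. -/
abbrev Op3 (V L : Type*) [AddCommGroup V] [Module ℂ V] [Field L] [Algebra ℂ L] :=
  PowerSeries (Module.End L (L ⊗[ℂ] (V ⊗[ℂ] (V ⊗[ℂ] V))))

def op12 (ev : A →ₐ[ℂ] L) (S : ℕ → V ⊗[ℂ] V →ₗ[ℂ] A ⊗[ℂ] (V ⊗[ℂ] V)) : Op3 V L :=
  PowerSeries.mk fun k => LinearMap.liftBaseChange L (leg12 (expand ev ∘ₗ S k))

def op13 (ev : A →ₐ[ℂ] L) (S : ℕ → V ⊗[ℂ] V →ₗ[ℂ] A ⊗[ℂ] (V ⊗[ℂ] V)) : Op3 V L :=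
  PowerSeries.mk fun k => LinearMap.liftBaseChange L (leg13 (expand ev ∘ₗ S k))

def op23 (ev : A →ₐ[ℂ] L) (S : ℕ → V ⊗[ℂ] V →ₗ[ℂ] A ⊗[ℂ] (V ⊗[ℂ] V)) : Op3 V L :=
  PowerSeries.mk fun k => LinearMap.liftBaseChange L (leg23 (expand ev ∘ₗ S k))

end ThreeFold

section Multiplication

variable {V : Type*} [AddCommGroup V] [Module ℂ V]

/-- The vertex operator `Y(a, z) b = X_{z,0}(a ⊗ b)`. -/
def vertexOp (X : ℕ → V ⊗[ℂ] V →ₗ[ℂ] V2 V) (k : ℕ) : V →ₗ[ℂ] V →ₗ[ℂ] V1 V :=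
  TensorProduct.curry (LSer.coeffL 0 ∘ₗ X k)

/-- `a ⊗ b ↦ Y(a, x) Y(b, y) c`, in `V((x))((y))[[t]]`. -/
def prodOp (X : ℕ → V ⊗[ℂ] V →ₗ[ℂ] V2 V) (c : V) (k : ℕ) : V ⊗[ℂ] V →ₗ[ℂ] V2 V :=
  ∑ ij ∈ Finset.HasAntidiagonal.antidiagonal k, TensorProduct.lift
    ((LSer.map ∘ₗ vertexOp X ij.1).compl₂ ((vertexOp X ij.2).flip c))

/-- `a ⊗ b ↦ Y(Y(a, y) b, x) c`, in `V((x))((y))[[t]]`. -/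
def iterOp (X : ℕ → V ⊗[ℂ] V →ₗ[ℂ] V2 V) (c : V) (k : ℕ) : V ⊗[ℂ] V →ₗ[ℂ] V2 V :=
  ∑ ij ∈ Finset.HasAntidiagonal.antidiagonal k,
    LSer.map ((vertexOp X ij.1).flip c) ∘ₗ TensorProduct.lift (vertexOp X ij.2)

/-- For a linear map `f : V → W((u₁))((u₂))`, its application to the coefficients of an element
of `V((w₁))((w₂))`. -/
def map₂ {W : Type*} [AddCommGroup W] [Module ℂ W] :
    (V →ₗ[ℂ] V2 W) →ₗ[ℂ] (V2 V →ₗ[ℂ] V4 W) :=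
  LSer.map ∘ₗ LSer.map

/-- `1 ⊗ X_{w₁,w₂}` on `V ⊗ V ⊗ V`. -/
def oneX (X : ℕ → V ⊗[ℂ] V →ₗ[ℂ] V2 V) (k : ℕ) :
    V ⊗[ℂ] (V ⊗[ℂ] V) →ₗ[ℂ] V4 (V ⊗[ℂ] V) :=
  TensorProduct.lift
    ((map₂ ∘ₗ LinearMap.llcomp ℂ V (V ⊗[ℂ] V) (V2 (V ⊗[ℂ] V)) const₂ ∘ₗ
      TensorProduct.mk ℂ V V).compl₂ (X k))

/-- `X_{w₁,w₂} ⊗ 1` on `V ⊗ V ⊗ V`. -/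
def Xone (X : ℕ → V ⊗[ℂ] V →ₗ[ℂ] V2 V) (k : ℕ) :
    V ⊗[ℂ] (V ⊗[ℂ] V) →ₗ[ℂ] V4 (V ⊗[ℂ] V) :=
  TensorProduct.lift
    ((map₂ ∘ₗ LinearMap.llcomp ℂ V (V ⊗[ℂ] V) (V2 (V ⊗[ℂ] V)) const₂ ∘ₗ
      (TensorProduct.mk ℂ V V).flip).compl₂ (X k)) ∘ₗ
    (TensorProduct.comm ℂ (V ⊗[ℂ] V) V).toLinearMap ∘ₗ
    (TensorProduct.assoc ℂ V V V).symm.toLinearMap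

/-- `S_{u₁,u₂}(p ⊗ q)`, expanded in `(V ⊗ V)((u₁))((u₂))`. -/
def braid (S : ℕ → V ⊗[ℂ] V →ₗ[ℂ] Aτ ⊗[ℂ] (V ⊗[ℂ] V)) (k : ℕ) :
    V →ₗ[ℂ] V →ₗ[ℂ] V2 (V ⊗[ℂ] V) :=
  TensorProduct.curry
    ((LinearMap.liftBaseChange L2 const₂).restrictScalars ℂ ∘ₗ expand ι ∘ₗ S k)

end Multiplication

/-! ## Quantum vertex algebras -/

/-- An `H_D`-quantum vertex algebra structure on a complex vector space `V`. -/
structure QuantumVertexAlgebra (V : Type*) [AddCommGroup V] [Module ℂ V] where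
  /-- the infinitesimal translation, giving the action of `H_D = ℂ[D]` -/
  D : V →ₗ[ℂ] V
  /-- the vacuum -/
  one : V
  /-- the `t`-coefficients of the singular multiplication, through the expansions
  `i_{z₁;z₂} X_{z₁,z₂}(a ⊗ b) ∈ V((z₁))((z₂))[[t]]` -/
  X : ℕ → V ⊗[ℂ] V →ₗ[ℂ] V2 V
  /-- the `t`-coefficients of the braiding map `S^{(τ)}_{z₁,z₂}` -/
  Sτ : ℕ → V ⊗[ℂ] V →ₗ[ℂ] Aτ ⊗[ℂ] (V ⊗[ℂ] V)
  /-- the `t`-coefficients of the translation map `S^{(γ)}_{z₁,z₂}` -/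
  Sγ : ℕ → V ⊗[ℂ] V →ₗ[ℂ] Aγ ⊗[ℂ] (V ⊗[ℂ] V)
  /-- `X_{z₁,z₂}(a ⊗ b) ∈ V[[z₁,z₂]][z₁⁻¹,(z₁-z₂)⁻¹][[t]]` -/
  singular : ∀ k a b, ∃ N : ℕ, ∀ p q : ℤ, p < 0 ∨ q < 0 →
    cf ((x * (x - y)) ^ N • X k (a ⊗ₜ b)) p q = 0
  /-- `X_{z₁,z₂}(a ⊗ 1) = e^{z₁D} a` -/
  vacuum_right : ∀ k a, X k (a ⊗ₜ one) = if k = 0 then LSer.const (LSer.exp D a) else 0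
  /-- `X_{z₁,z₂}(1 ⊗ a) = e^{z₂D} a` -/
  vacuum_left : ∀ k a, X k (one ⊗ₜ a) =
    if k = 0 then LSer.exp (LSer.map D) (LSer.const a) else 0
  /-- `S^{(τ)}(a ⊗ 1) = a ⊗ 1` -/
  braid_vacuum_right : ∀ k a, Sτ k (a ⊗ₜ one) = if k = 0 then 1 ⊗ₜ (a ⊗ₜ one) else 0
  /-- `S^{(τ)}(1 ⊗ a) = 1 ⊗ a` -/
  braid_vacuum_left : ∀ k a, Sτ k (one ⊗ₜ a) = if k = 0 then 1 ⊗ₜ (one ⊗ₜ a) else 0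
  /-- `X_{z₁,z₂}(a ⊗ Db) = ∂_{z₂} X_{z₁,z₂}(a ⊗ b)` -/
  covariance : ∀ k a b, X k (a ⊗ₜ D b) = LSer.deriv (X k (a ⊗ₜ b))
  /-- Braided commutativity, `X_{z₁,z₂}(a ⊗ b) = X_{z₂,z₁} ∘ S^{(τ)}_{z₂,z₁}(b ⊗ a)`.  The left
  side is expanded in `V((z₁))((z₂))`, the right side in `V((z₂))((z₁))`, so that the equality
  reads: they agree after multiplication by a power of `z₁ - z₂`. -/
  braided_comm : ∀ k a b, ∃ N : ℕ, ∀ p q : ℤ,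
    cf ((x - y) ^ N • X k (a ⊗ₜ b)) p q = cf ((y - x) ^ N • comp X ι Sτ k (b ⊗ₜ a)) q p
  /-- Broken translation covariance,
  `e^{γD} X_{z₁,z₂} ∘ S^{(γ)}_{z₁,z₂}(a ⊗ b) = X_{z₁+γ,z₂+γ}(a ⊗ b)`, in
  `V((z₁))((z₂))((γ))`, where `X_{z₁+γ,z₂+γ} = e^{γ(∂_{z₁}+∂_{z₂})} X_{z₁,z₂}`. -/
  translation : ∀ k a b,
    comp (fun i => LSer.exp (LSer.map (LSer.map D)) ∘ₗ X i) ιγ Sγ k (a ⊗ₜ b) =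
      (LSer.exp (LSer.map LSer.deriv + LSer.deriv) (X k (a ⊗ₜ b)) : V3 V)
  /-- Yang–Baxter:
  `S^{12}_{z₁,z₂} S^{13}_{z₁,z₃} S^{23}_{z₂,z₃} = S^{23}_{z₂,z₃} S^{13}_{z₁,z₃} S^{12}_{z₁,z₂}`
  for `S = S^{(τ)}` -/
  yang_baxter : op12 ι₁₂ Sτ * op13 ι₁₃ Sτ * op23 ι₂₃ Sτ = op23 ι₂₃ Sτ * op13 ι₁₃ Sτ * op12 ι₁₂ Sτ
  /-- Hexagon: `S_{u₁,u₂} (1 ⊗ X_{w₁,w₂}) = (1 ⊗ X_{w₁,w₂}) S^{12}_{u₁,u₂+w₁} S^{13}_{u₁,u₂+w₂}`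
  for `S = S^{(τ)}` -/
  hexagon_right : ∀ k a b c,
    ∑ ij ∈ Finset.HasAntidiagonal.antidiagonal k, map₂ (braid Sτ ij.1 a) (X ij.2 (b ⊗ₜ c)) =
      ∑ ij ∈ Finset.HasAntidiagonal.antidiagonal k, LinearMap.liftBaseChange L4 (oneX X ij.1)
        (PowerSeries.coeff ij.2 (op12 ιr₁ Sτ * op13 ιr₂ Sτ) (1 ⊗ₜ (a ⊗ₜ (b ⊗ₜ c))))
  /-- Hexagon: `S_{u₁,u₂} (X_{w₁,w₂} ⊗ 1) = (X_{w₁,w₂} ⊗ 1) S^{23}_{u₁+w₂,u₂} S^{13}_{u₁+w₁,u₂}`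
  for `S = S^{(τ)}` -/
  hexagon_left : ∀ k a b c,
    ∑ ij ∈ Finset.HasAntidiagonal.antidiagonal k, map₂ ((braid Sτ ij.1).flip c) (X ij.2 (a ⊗ₜ b)) =
      ∑ ij ∈ Finset.HasAntidiagonal.antidiagonal k, LinearMap.liftBaseChange L4 (Xone X ij.1)
        (PowerSeries.coeff ij.2 (op23 ιl₂ Sτ * op13 ιl₁ Sτ) (1 ⊗ₜ (a ⊗ₜ (b ⊗ₜ c))))
  /-- Locality: for all `a`, `b` and `K` there is `N` such that for all `c`, modulo `t^K`,
  `(z₁-z₂)^N Y(a,z₁) Y(b,z₂) c ≡ (z₁-z₂)^N Y_{z₂}(1 ⊗ Y_{z₁}) S^{(τ),12}_{z₂,z₁}(b ⊗ a ⊗ c)`. -/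
  locality : ∀ a b (K : ℕ), ∃ N : ℕ, ∀ c, ∀ k < K, ∀ p q : ℤ,
    cf ((x - y) ^ N • prodOp X c k (a ⊗ₜ b)) p q =
      cf ((y - x) ^ N • comp (prodOp X c) ι Sτ k (b ⊗ₜ a)) q p

/-! ## The terms of the Jacobi identity

Formal distributions in `z₁, z₂, z₃` with coefficients in `V` are functions `ℤ → ℤ → ℤ → V`,
`F l m n` being the coefficient of `z₁ˡ z₂ᵐ z₃ⁿ`. The delta distribution is
`δ(z, w) = ∑ⱼ zʲ w^{-j-1} = ∑ⱼ z^{-j-1} wʲ`. -/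

namespace QuantumVertexAlgebra

variable {V : Type*} [AddCommGroup V] [Module ℂ V] (Q : QuantumVertexAlgebra V)

/-- The `tᵏ`-coefficient of `i_{z₁;z₂} δ(z₁ - z₂, z₃) Y(a, z₁) Y(b, z₂) c`.  Here `x = z₁`,
`y = z₂`. -/
def productTerm (a b c : V) (k : ℕ) : ℤ → ℤ → ℤ → V := fun l m n =>
  cf ((x - y) ^ (-n - 1) • prodOp Q.X c k (a ⊗ₜ b)) l m

/-- The `tᵏ`-coefficient of
`i_{z₂;z₁} δ(z₁ - z₂, z₃) Y_{z₂}(1 ⊗ Y_{z₁}) S^{(τ),12}_{z₂,z₁}(b ⊗ a ⊗ c)`.  Here `x = z₂`,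
`y = z₁`. -/
def reversedTerm (a b c : V) (k : ℕ) : ℤ → ℤ → ℤ → V := fun l m n =>
  cf ((y - x) ^ (-n - 1) • comp (prodOp Q.X c) ι Q.Sτ k (b ⊗ₜ a)) m l

/-- The `tᵏ`-coefficient of
`i_{z₂;z₃} δ(z₁, z₂ + z₃) Y_{z₂}(Y_{z₃} ⊗ 1) S^{(z₂),12}_{z₃,0}(a ⊗ b ⊗ c)`.  Here `x = z₂`,
`y = z₃`. -/
def iterateTerm (a b c : V) (k : ℕ) : ℤ → ℤ → ℤ → V := fun l m n =>
  cf ((x + y) ^ (-l - 1) • comp (iterOp Q.X c) ιγ₀ Q.Sγ k (a ⊗ₜ b)) m n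

end QuantumVertexAlgebra

end HDQ

end

noncomputable section

set_option linter.unusedSectionVars false

namespace HDQ

/-! The identity splits into a formal part and an associativity statement. By locality, (z₁-z₂)^N
Y(a,z₁)Y(b,z₂)c and its reversed, braided counterpart are one and the same distribution. It lies
both in V((z₁))((z₂)) and in V((z₂))((z₁)), so its exponents are bounded below in each variable, and
z₁ = z₂ + z₃ may be substituted in it. `QuantumVertexAlgebra.associativity` says that the result is
z₃^N times the iterate. What remains, `jacobi_of_bdd`, is the classical delta function identity for
a distribution bounded below.

Associativity is the substance. Replace c by e^{wD}c with an auxiliary variable w: by covariance,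
X_{z,w}(v ⊗ c) = Y(v,z)e^{wD}c (`coeff_X`). In Y(a,z₁)X_{z₂,w}(b ⊗ c), braided commutativity moves c
past b and locality moves it past a (`sum_prodX_X`). The outcome is Y(c,w)X_{z₁,z₂} applied to
S¹²_{w,z₁}S¹³_{w,z₂}(c ⊗ a ⊗ b). Now z₁ and z₂ enter through a single X, where the substitution is
understood: X_{z₂+z₃,z₂} = e^{z₂D}G, with G the value at z₂ = 0 of e^{γ(∂₁+∂₂-D)}X, evaluated at
first variable z₃ and γ = z₂ (`diag_X`, `YX_rel`). As Y(c,w)e^{z₂D} is again X_{w,z₂}(c ⊗ ·), the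
hexagon relation absorbs both braidings into one S_{w,z₂}(c ⊗ G), and braided commutativity brings c
back to the right (`sum_XX_e`). This leaves Y(G,z₂)e^{wD}c. Broken translation covariance identifies
G with X_{z₃,0}S^{(γ)}_{z₃,0} (`G_den`, `iterate_eq`), and the coefficient of w⁰ is the claim.

The hexagon relation concerns X, not G. It is carried over by the operator ∂_{w₁}+∂_{w₂}-∂_{u₂}-1⊗D,
which commutes with the functions of u₁, u₂+w₁, u₂+w₂ occurring in the hexagon. That it passes
through S as required is `dlt_braid`, a consequence of the hexagon relation with a vacuum factor.

These steps equate series expanded in different regions, so they are carried out with distributions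
modulo torsion: `D2K` in (z₂,w), and `D3K` in (z₁,z₂,w), where only those denominators are inverted
that survive z₁ = z₂ + z₃. The substitution is defined only on bounded distributions, hence is
treated as a relation, `substRel`, which is closed under scalars and single-valued. At the end
V((z₂))((w)) embeds in `D2K`, which restores honest equality. Finally, a factor (z₁+γ)^M makes G a
finite sum of powers of γ, so that it can be read in the region |γ| > |z₁|; M and the finite set of
exponents depend on the vectors, which is why many statements hold only eventually. -/

open Finset.HasAntidiagonal (antidiagonal mem_antidiagonal)

/-! ## Coefficients of formal Laurent series -/

section LSerBasics

variable {L : Type*} [Field L] [Algebra ℂ L]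
variable {M : Type*} [AddCommGroup M] [Module ℂ M] [Module L M] [IsScalarTower ℂ L M]
variable {L' : Type*} [Field L'] [Algebra ℂ L']
variable {M' : Type*} [AddCommGroup M'] [Module ℂ M'] [Module L' M'] [IsScalarTower ℂ L' M']
variable {L'' : Type*} [Field L''] [Algebra ℂ L'']
variable {M'' : Type*} [AddCommGroup M''] [Module ℂ M''] [Module L'' M'']
  [IsScalarTower ℂ L'' M'']

/-- The coefficient of the `n`-th power of the variable in a formal Laurent series. -/
def LF.coeff (f : LF L) (n : ℤ) : L := HahnSeries.coeff (f : HahnSeries ℤ L) n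

@[simp] theorem LSer.coeffL_apply (n : ℤ) (f : LSer L M) : LSer.coeffL n f = f.coeff n := rfl

@[simp] theorem LSer.coeff_zero (n : ℤ) : (0 : LSer L M).coeff n = 0 :=
  map_zero (LSer.coeffL n : LSer L M →ₗ[ℂ] M)

@[simp] theorem LSer.coeff_neg (f : LSer L M) (n : ℤ) : (-f).coeff n = -f.coeff n :=
  map_neg (LSer.coeffL n) f

@[simp] theorem LSer.coeff_sub (f g : LSer L M) (n : ℤ) :
    (f - g).coeff n = f.coeff n - g.coeff n := map_sub (LSer.coeffL n) f g

@[simp] theorem LSer.coeff_sum {ι : Type*} (s : Finset ι) (f : ι → LSer L M) (n : ℤ) :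
    (∑ i ∈ s, f i).coeff n = ∑ i ∈ s, (f i).coeff n := map_sum (LSer.coeffL n) f s

theorem LSer.exists_bound (f : LSer L M) : ∃ B : ℤ, ∀ n < B, f.coeff n = 0 := by
  refine ⟨((HahnModule.of L).symm f).order, fun n hn => ?_⟩
  exact HahnSeries.coeff_eq_zero_of_lt_order hn

@[simp] theorem LSer.coeff_C_smul (a : L) (f : LSer L M) (n : ℤ) :
    (LF.C a • f).coeff n = a • f.coeff n :=
  HahnModule.coeff_single_zero_smul (Γ := ℤ) (R := L) (V := M) (r := a) (x := f)

theorem LSer.coeff_single_smul (a : L) (k : ℤ) (f : LSer L M) (n : ℤ) :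
    ((show LF L from (HahnSeries.single k a : HahnSeries ℤ L)) • f).coeff n =
      a • f.coeff (n - k) := by
  have h := HahnModule.coeff_single_smul_vadd (R := L) (V := M) (r := a)
    (x := (f : HahnModule ℤ L M)) (a := n - k) (b := k)
  rw [vadd_eq_add, add_sub_cancel] at h
  exact h

@[simp] theorem LSer.coeff_var_smul (f : LSer L M) (n : ℤ) :
    (LF.var L • f).coeff n = f.coeff (n - 1) :=
  (LSer.coeff_single_smul 1 1 f n).trans (one_smul _ _)

@[simp] theorem LSer.coeff_var_pow_smul (f : LSer L M) (k : ℕ) (n : ℤ) :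
    (LF.var L ^ k • f).coeff n = f.coeff (n - k) := by
  induction k generalizing n with
  | zero => simp
  | succ k ih => rw [pow_succ', mul_smul, LSer.coeff_var_smul, ih]; congr 1; push_cast; ring

@[simp] theorem LSer.coeff_var_zpow_smul (f : LSer L M) (k n : ℤ) :
    (LF.var L ^ k • f).coeff n = f.coeff (n - k) := by
  obtain ⟨k, rfl | rfl⟩ := k.eq_nat_or_neg
  · rw [zpow_natCast]; exact LSer.coeff_var_pow_smul f k n
  · have h : f = LF.var L ^ k • (LF.var L ^ (-(k : ℤ)) • f) := by
      rw [smul_smul, ← zpow_natCast, ← zpow_add₀ var_ne, add_neg_cancel, zpow_zero, one_smul]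
    conv_rhs => rw [h, LSer.coeff_var_pow_smul]
    congr 1; ring

/-- The series with given coefficients, bounded below by `B`. -/
def LSer.ofFun (f : ℤ → M) (B : ℤ) (h : ∀ n < B, f n = 0) : LSer L M :=
  LSer.mk (HahnSeries.ofSuppBddBelow f ⟨B, fun n hn => by
    by_contra hlt
    exact hn (h n (not_le.1 hlt))⟩)

@[simp] theorem LSer.coeff_ofFun (f : ℤ → M) (B : ℤ) (h : ∀ n < B, f n = 0) (n : ℤ) :
    (LSer.ofFun f B h : LSer L M).coeff n = f n := rfl

@[simp] theorem LSer.coeff_const (v : M) (n : ℤ) :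
    (LSer.const v : LSer L M).coeff n = if n = 0 then v else 0 := by
  change (HahnSeries.single 0 v : HahnSeries ℤ M).coeff n = _
  rw [HahnSeries.coeff_single]
  congr

theorem LSer.coeff_deriv (f : LSer L M) (n : ℤ) :
    (LSer.deriv f).coeff n = ((n : ℂ) + 1) • f.coeff (n + 1) := by
  change (LaurentSeries.derivative ℂ ((HahnModule.of L).symm f)).coeff n = _
  rw [LaurentSeries.derivative_apply, LaurentSeries.hasseDeriv_coeff]
  simp [LSer.coeff, ← Int.cast_smul_eq_zsmul ℂ]

theorem LSer.coeff_exp (T : M →ₗ[ℂ] M) (v : M) (n : ℤ) :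
    (LSer.exp T v : LSer L M).coeff n =
      if 0 ≤ n then ((n.toNat.factorial : ℂ)⁻¹) • (T ^ n.toNat) v else 0 := rfl

theorem LSer.map_var_smul (φ : M →ₗ[ℂ] M') (f : LSer L M) :
    (LSer.map φ (LF.var L • f) : LSer L' M') = LF.var L' • LSer.map φ f :=
  LSer.ext fun n => by simp

theorem LSer.map_C_smul (φ : M →ₗ[ℂ] M') (a : L) (b : L') (h : ∀ v, φ (a • v) = b • φ v)
    (f : LSer L M) : (LSer.map φ (LF.C a • f) : LSer L' M') = LF.C b • LSer.map φ f :=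
  LSer.ext fun n => by simp [h]

theorem LSer.map_map (ψ : M' →ₗ[ℂ] M'') (φ : M →ₗ[ℂ] M') (f : LSer L M) :
    (LSer.map ψ (LSer.map φ f : LSer L' M') : LSer L'' M'') = LSer.map (ψ ∘ₗ φ) f := rfl

/-- Product of two series without negative powers. -/
theorem LSer.coeff_smul_of_nonneg {a : LF L} {f : LSer L M} (ha : ∀ n < 0, a.coeff n = 0)
    (hf : ∀ n < 0, f.coeff n = 0) :
    (∀ n < 0, (a • f).coeff n = 0) ∧ (a • f).coeff 0 = a.coeff 0 • f.coeff 0 := by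
  have key : ∀ n : ℤ, ∃ s : Finset (ℤ × ℤ),
      (∀ ij, ij ∈ s ↔ a.coeff ij.1 ≠ 0 ∧ f.coeff ij.2 ≠ 0 ∧ ij.1 + ij.2 = n) ∧
      (a • f).coeff n = ∑ ij ∈ s, a.coeff ij.1 • f.coeff ij.2 := fun n =>
    ⟨_, fun ij => Finset.mem_vaddAntidiagonal n _,
      HahnModule.coeff_smul (R := L) (V := M) (a : HahnSeries ℤ L) (f : HahnModule ℤ L M) n⟩
  constructor
  · intro n hn
    obtain ⟨s, hs, e⟩ := key n
    rw [e]
    refine Finset.sum_eq_zero fun ij hij => ?_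
    obtain ⟨-, -, h3⟩ := (hs ij).1 hij
    by_cases h : ij.1 < 0
    · rw [ha _ h, zero_smul]
    · rw [hf _ (by omega), smul_zero]
  · obtain ⟨s, hs, e⟩ := key 0
    rw [e]
    refine Finset.sum_eq_single (0, 0) (fun ij hij hne => ?_) (fun h => ?_)
    · obtain ⟨-, -, h3⟩ := (hs ij).1 hij
      by_cases h : ij.1 < 0
      · rw [ha _ h, zero_smul]
      · by_cases h' : ij.2 < 0
        · rw [hf _ h', smul_zero]
        · exact absurd (Prod.ext (by simp; omega) (by simp; omega)) hne
    · rw [hs, not_and_or, not_and_or, not_not, not_not] at h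
      rcases h with h | h | h
      · rw [h, zero_smul]
      · rw [h, smul_zero]
      · exact absurd (add_zero (0 : ℤ)) h

end LSerBasics

/-! ### Coefficients of double Laurent series. -/

section TwoVariables

variable {W : Type*} [AddCommGroup W] [Module ℂ W]

theorem V2.ext {f g : V2 W} (h : ∀ p q, cf f p q = cf g p q) : f = g :=
  LSer.ext fun q => LSer.ext fun p => h p q

/-- `cf` as a linear map. -/
def cfL (p q : ℤ) : V2 W →ₗ[ℂ] W := LSer.coeffL p ∘ₗ LSer.coeffL q

@[simp] theorem cfL_apply (p q : ℤ) (f : V2 W) : cfL p q f = cf f p q := rfl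

@[simp] theorem cf_add (f g : V2 W) (p q : ℤ) : cf (f + g) p q = cf f p q + cf g p q :=
  map_add (cfL p q) f g

@[simp] theorem cf_sub (f g : V2 W) (p q : ℤ) : cf (f - g) p q = cf f p q - cf g p q :=
  map_sub (cfL p q) f g

@[simp] theorem cf_zero (p q : ℤ) : cf (0 : V2 W) p q = 0 := rfl

@[simp] theorem cf_smul (r : ℂ) (f : V2 W) (p q : ℤ) : cf (r • f) p q = r • cf f p q :=
  map_smul (cfL p q) r f

@[simp] theorem cf_sum {ι : Type*} (s : Finset ι) (f : ι → V2 W) (p q : ℤ) :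
    cf (∑ i ∈ s, f i) p q = ∑ i ∈ s, cf (f i) p q := map_sum (cfL p q) f s

@[simp] theorem cf_x_smul (f : V2 W) (p q : ℤ) : cf (x • f) p q = cf f (p - 1) q := by
  simp [cf, x]

@[simp] theorem cf_y_smul (f : V2 W) (p q : ℤ) : cf (y • f) p q = cf f p (q - 1) := by
  simp [cf, y]

theorem x_zpow (k : ℤ) : x ^ k = LF.C (LF.var ℂ ^ k) := (map_zpow₀ LF.C _ k).symm

@[simp] theorem cf_x_zpow_smul (f : V2 W) (k p q : ℤ) :
    cf (x ^ k • f) p q = cf f (p - k) q := by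
  rw [x_zpow, cf, LSer.coeff_C_smul, LSer.coeff_var_zpow_smul, cf]

@[simp] theorem cf_y_zpow_smul (f : V2 W) (k p q : ℤ) :
    cf (y ^ k • f) p q = cf f p (q - k) := by
  simp [cf, y]

@[simp] theorem cf_x_pow_smul (f : V2 W) (k : ℕ) (p q : ℤ) :
    cf (x ^ k • f) p q = cf f (p - k) q := by
  rw [← zpow_natCast, cf_x_zpow_smul]

@[simp] theorem cf_y_pow_smul (f : V2 W) (k : ℕ) (p q : ℤ) :
    cf (y ^ k • f) p q = cf f p (q - k) := by
  rw [← zpow_natCast, cf_y_zpow_smul]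

@[simp] theorem cf_const₂ (v : W) (p q : ℤ) :
    cf (const₂ v) p q = if q = 0 ∧ p = 0 then v else 0 := by
  simp only [cf, const₂, LinearMap.comp_apply, LSer.coeff_const]
  split_ifs <;> simp_all

end TwoVariables

/-! ## Extension of scalars along evaluations of the coefficient algebras -/

/-- Associativity of the Cauchy product in t; it regroups every triple composition of t-series
below. -/
theorem sum_antidiagonal_assoc {N : Type*} [AddCommMonoid N] (F : ℕ → ℕ → ℕ → N) (k : ℕ) :
    ∑ sq ∈ antidiagonal k, ∑ ip ∈ antidiagonal sq.1, F ip.1 ip.2 sq.2 =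
      ∑ ij ∈ antidiagonal k, ∑ pq ∈ antidiagonal ij.2, F ij.1 pq.1 pq.2 := by
  rw [Finset.sum_sigma', Finset.sum_sigma']
  refine Finset.sum_nbij' (fun t => ⟨(t.2.1, t.2.2 + t.1.2), (t.2.2, t.1.2)⟩)
    (fun t => ⟨(t.1.1 + t.2.1, t.2.2), (t.1.1, t.2.1)⟩) ?_ ?_ ?_ ?_ ?_
  · rintro ⟨⟨s, q⟩, ⟨i, p⟩⟩ h
    simp only [Finset.mem_sigma, mem_antidiagonal] at h ⊢
    obtain ⟨h1, h2⟩ := h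
    exact ⟨by omega, trivial⟩
  · rintro ⟨⟨i, j⟩, ⟨p, q⟩⟩ h
    simp only [Finset.mem_sigma, mem_antidiagonal] at h ⊢
    obtain ⟨h1, h2⟩ := h
    exact ⟨by omega, trivial⟩
  · rintro ⟨⟨s, q⟩, ⟨i, p⟩⟩ h
    simp only [Finset.mem_sigma, mem_antidiagonal] at h
    obtain ⟨h1, h2⟩ := h
    subst h2
    rfl
  · rintro ⟨⟨i, j⟩, ⟨p, q⟩⟩ h
    simp only [Finset.mem_sigma, mem_antidiagonal] at h
    obtain ⟨h1, h2⟩ := h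
    subst h2
    rfl
  · rintro ⟨⟨s, q⟩, ⟨i, p⟩⟩ _
    rfl

section EvLift

variable {U W : Type*} [AddCommGroup U] [Module ℂ U] [AddCommGroup W] [Module ℂ W]
variable {A : Type*} [CommRing A] [Algebra ℂ A]
variable {B : Type*} [CommRing B] [Algebra ℂ B]
variable {N : Type*} [AddCommGroup N] [Module ℂ N] [Module B N] [IsScalarTower ℂ B N]
variable {B' : Type*} [CommRing B'] [Algebra ℂ B']
variable {N' : Type*} [AddCommGroup N'] [Module ℂ N'] [Module B' N'] [IsScalarTower ℂ B' N']

/-- The map `A ⊗ W → N`, `f ⊗ w ↦ ev f • Φ w`. -/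
def evLift (ev : A →ₐ[ℂ] B) (Φ : W →ₗ[ℂ] N) : A ⊗[ℂ] W →ₗ[ℂ] N :=
  (LinearMap.liftBaseChange B Φ).restrictScalars ℂ ∘ₗ ev.toLinearMap.rTensor W

@[simp] theorem evLift_tmul (ev : A →ₐ[ℂ] B) (Φ : W →ₗ[ℂ] N) (f : A) (w : W) :
    evLift ev Φ (f ⊗ₜ w) = ev f • Φ w := by
  simp [evLift]

theorem evLift_smul (ev : A →ₐ[ℂ] B) (Φ : W →ₗ[ℂ] N) (f : A) (s : A ⊗[ℂ] W) :
    evLift ev Φ (f • s) = ev f • evLift ev Φ s := by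
  induction s with
  | zero => simp
  | tmul g w => simp [TensorProduct.smul_tmul', mul_smul]
  | add s t hs ht => simp only [smul_add, map_add, hs, ht]

theorem evLift_sum {ι : Type*} (t : Finset ι) (ev : A →ₐ[ℂ] B) (Φ : ι → W →ₗ[ℂ] N)
    (s : A ⊗[ℂ] W) : evLift ev (∑ i ∈ t, Φ i) s = ∑ i ∈ t, evLift ev (Φ i) s := by
  induction s with
  | zero => simp
  | tmul g w => simp [Finset.smul_sum]
  | add s t hs ht => simp only [map_add, hs, ht, Finset.sum_add_distrib]

theorem evLift_lTensor (ev : A →ₐ[ℂ] B) (Φ : W →ₗ[ℂ] N) (T : U →ₗ[ℂ] W) (s : A ⊗[ℂ] U) :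
    evLift ev Φ (T.lTensor A s) = evLift ev (Φ ∘ₗ T) s := by
  induction s with
  | zero => simp
  | tmul g w => simp
  | add s t hs ht => simp only [map_add, hs, ht]

/-- A linear map which intertwines two evaluations commutes with `evLift`. -/
theorem map_evLift {ev : A →ₐ[ℂ] B} {ev' : A →ₐ[ℂ] B'} (j : N →ₗ[ℂ] N')
    (h : ∀ f v, j (ev f • v) = ev' f • j v) (Φ : W →ₗ[ℂ] N) (s : A ⊗[ℂ] W) :
    j (evLift ev Φ s) = evLift ev' (j ∘ₗ Φ) s := by
  induction s with
  | zero => simp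
  | tmul g w => simp [h]
  | add s t hs ht => simp only [map_add, hs, ht]

/-- A relation stable under two evaluations is stable under `evLift`. -/
theorem evLift_mem {ev : A →ₐ[ℂ] B} {ev' : A →ₐ[ℂ] B'} (T : AddSubgroup (N × N'))
    (h : ∀ f v, v ∈ T → (ev f • v.1, ev' f • v.2) ∈ T) (Φ : W →ₗ[ℂ] N) (Φ' : W →ₗ[ℂ] N')
    (hΦ : ∀ w, (Φ w, Φ' w) ∈ T) (s : A ⊗[ℂ] W) : (evLift ev Φ s, evLift ev' Φ' s) ∈ T := by
  induction s with
  | zero => simp only [map_zero]; exact T.zero_mem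
  | tmul g w => simpa using h g _ (hΦ w)
  | add s t hs ht => simpa using T.add_mem hs ht

end EvLift

/-! ### Evaluations of the coefficient algebra of the braiding. -/

section CoefficientAlgebras

/-- The coordinates of `Aτ`. -/
def τ₁ : Aτ := algebraMap (MvPolynomial (Fin 2) ℂ) Aτ (MvPolynomial.X 0)
def τ₂ : Aτ := algebraMap (MvPolynomial (Fin 2) ℂ) Aτ (MvPolynomial.X 1)

/-- `Aτ` is generated by its coordinates and by the inverse of `τ₁ τ₂ (τ₁ - τ₂)`. -/
theorem Aτ.induction {P : Aτ → Prop} (hC : ∀ r : ℂ, P (algebraMap ℂ Aτ r)) (h₁ : P τ₁)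
    (h₂ : P τ₂) (hadd : ∀ f g, P f → P g → P (f + g)) (hmul : ∀ f g, P f → P g → P (f * g))
    (hunit : ∀ f g, P f → f * g = 1 → P g) (f : Aτ) : P f := by
  have hpoly : ∀ p : MvPolynomial (Fin 2) ℂ, P (algebraMap _ Aτ p) := by
    intro p
    induction p using MvPolynomial.induction_on with
    | C r => exact hC r
    | add p q hp hq => rw [map_add]; exact hadd _ _ hp hq
    | mul_X p i hp =>
      rw [map_mul]
      refine hmul _ _ hp ?_
      fin_cases i
      · exact h₁
      · exact h₂
  obtain ⟨⟨p, s⟩, hs⟩ := IsLocalization.surj (Submonoid.powers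
    (MvPolynomial.X 0 * MvPolynomial.X 1 * (MvPolynomial.X 0 - MvPolynomial.X 1) :
      MvPolynomial (Fin 2) ℂ)) f
  obtain ⟨g, hg⟩ := (IsLocalization.map_units Aτ s).exists_right_inv
  have : f = algebraMap _ Aτ p * g := by
    rw [← hs, mul_assoc, hg, mul_one]
  rw [this]
  exact hmul _ _ (hpoly _) (hunit _ _ (hpoly _) hg)

variable {B : Type*} [CommRing B] [Algebra ℂ B]
variable {N : Type*} [AddCommGroup N] [Module ℂ N] [Module B N] [IsScalarTower ℂ B N]
variable {B' : Type*} [CommRing B'] [Algebra ℂ B']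
variable {N' : Type*} [AddCommGroup N'] [Module ℂ N'] [Module B' N'] [IsScalarTower ℂ B' N']

/-- A linear map which intertwines the coordinates intertwines the evaluations. -/
theorem Aτ.map_smul {ev : Aτ →ₐ[ℂ] B} {ev' : Aτ →ₐ[ℂ] B'} (j : N →ₗ[ℂ] N')
    (h₁ : ∀ v, j (ev τ₁ • v) = ev' τ₁ • j v) (h₂ : ∀ v, j (ev τ₂ • v) = ev' τ₂ • j v)
    (f : Aτ) : ∀ v, j (ev f • v) = ev' f • j v := by
  induction f using Aτ.induction with
  | hC r => intro v; simp
  | h₁ => exact h₁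
  | h₂ => exact h₂
  | hadd f g hf hg => intro v; simp [add_smul, hf, hg]
  | hmul f g hf hg => intro v; simp [mul_smul, hf, hg]
  | hunit f g hf hfg =>
    intro v
    have h := hf (ev g • v)
    rw [smul_smul, ← map_mul, hfg, map_one, one_smul] at h
    rw [h, smul_smul, ← map_mul, mul_comm g f, hfg, map_one, one_smul]

/-- Substitution of two elements of a commutative algebra. -/
def evτ' (p q : B) (h : IsUnit (p * q * (p - q))) : Aτ →ₐ[ℂ] B :=
  IsLocalization.liftAlgHom (M := Submonoid.powers
    (MvPolynomial.X 0 * MvPolynomial.X 1 * (MvPolynomial.X 0 - MvPolynomial.X 1) :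
      MvPolynomial (Fin 2) ℂ)) (f := MvPolynomial.aeval ![p, q]) (by
    rintro ⟨_, n, rfl⟩
    simpa using h.pow n)

@[simp] theorem evτ'_τ₁ (p q : B) (h : IsUnit (p * q * (p - q))) : evτ' p q h τ₁ = p := by
  simp [evτ', τ₁]

@[simp] theorem evτ'_τ₂ (p q : B) (h : IsUnit (p * q * (p - q))) : evτ' p q h τ₂ = q := by
  simp [evτ', τ₂]

@[simp] theorem evτ_τ₁ {L : Type*} [Field L] [Algebra ℂ L] (p q : L) (h : p * q * (p - q) ≠ 0) :
    evτ p q h τ₁ = p := by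
  simp [evτ, τ₁]

@[simp] theorem evτ_τ₂ {L : Type*} [Field L] [Algebra ℂ L] (p q : L) (h : p * q * (p - q) ≠ 0) :
    evτ p q h τ₂ = q := by
  simp [evτ, τ₂]

end CoefficientAlgebras

/-! ### Braidings on three tensor factors over an arbitrary coefficient ring. -/

section Legs

variable {V : Type*} [AddCommGroup V] [Module ℂ V]
variable {A : Type*} [CommRing A] [Algebra ℂ A]

/-- `c ⊗ a ↦ c ⊗ a ⊗ b`. -/
def ins₁₂ (b : V) : V ⊗[ℂ] V →ₗ[ℂ] V ⊗[ℂ] (V ⊗[ℂ] V) :=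
  ((TensorProduct.mk ℂ V V).flip b).lTensor V

/-- `c ⊗ b ↦ c ⊗ a ⊗ b`. -/
def ins₁₃ (a : V) : V ⊗[ℂ] V →ₗ[ℂ] V ⊗[ℂ] (V ⊗[ℂ] V) :=
  (TensorProduct.mk ℂ V V a).lTensor V

@[simp] theorem ins₁₂_tmul (a b c : V) : ins₁₂ b (c ⊗ₜ a) = c ⊗ₜ (a ⊗ₜ b) := rfl
@[simp] theorem ins₁₃_tmul (a b c : V) : ins₁₃ a (c ⊗ₜ b) = c ⊗ₜ (a ⊗ₜ b) := rfl

/-- The action of `s` on the first and second factors, over any coefficient algebra. -/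
def braid₁₂ (s : V ⊗[ℂ] V →ₗ[ℂ] A ⊗[ℂ] (V ⊗[ℂ] V)) :
    V ⊗[ℂ] (V ⊗[ℂ] V) →ₗ[ℂ] A ⊗[ℂ] (V ⊗[ℂ] (V ⊗[ℂ] V)) :=
  (TensorProduct.assoc ℂ V V V).toLinearMap.lTensor A ∘ₗ
    (TensorProduct.assoc ℂ A (V ⊗[ℂ] V) V).toLinearMap ∘ₗ
    s.rTensor V ∘ₗ (TensorProduct.assoc ℂ V V V).symm.toLinearMap

/-- The action of `s` on the first and third factors, over any coefficient algebra. -/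
def braid₁₃ (s : V ⊗[ℂ] V →ₗ[ℂ] A ⊗[ℂ] (V ⊗[ℂ] V)) :
    V ⊗[ℂ] (V ⊗[ℂ] V) →ₗ[ℂ] A ⊗[ℂ] (V ⊗[ℂ] (V ⊗[ℂ] V)) :=
  ((TensorProduct.comm ℂ V V).toLinearMap.lTensor V).lTensor A ∘ₗ
    braid₁₂ s ∘ₗ (TensorProduct.comm ℂ V V).toLinearMap.lTensor V

/-- The third factor is a spectator: it can be inserted after `s` has acted. This turns a braiding
on three factors into an `evLift` along `ins₁₂`. -/
theorem braid₁₂_tmul (s : V ⊗[ℂ] V →ₗ[ℂ] A ⊗[ℂ] (V ⊗[ℂ] V)) (a b c : V) :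
    braid₁₂ s (c ⊗ₜ (a ⊗ₜ b)) = (ins₁₂ b).lTensor A (s (c ⊗ₜ a)) := by
  have : ∀ t : A ⊗[ℂ] (V ⊗[ℂ] V), (TensorProduct.assoc ℂ V V V).toLinearMap.lTensor A
      (TensorProduct.assoc ℂ A (V ⊗[ℂ] V) V (t ⊗ₜ b)) = (ins₁₂ b).lTensor A t := by
    intro t
    induction t with
    | zero => simp
    | tmul f w =>
      induction w with
      | zero => simp
      | tmul v w => simp
      | add w w' h h' => simp only [TensorProduct.tmul_add, TensorProduct.add_tmul, map_add, h, h']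
    | add w w' h h' => simp only [TensorProduct.add_tmul, map_add, h, h']
  simpa [braid₁₂] using this _

theorem braid₁₃_tmul (s : V ⊗[ℂ] V →ₗ[ℂ] A ⊗[ℂ] (V ⊗[ℂ] V)) (a b c : V) :
    braid₁₃ s (c ⊗ₜ (a ⊗ₜ b)) = (ins₁₃ a).lTensor A (s (c ⊗ₜ b)) := by
  have h : braid₁₃ s (c ⊗ₜ (a ⊗ₜ b)) =
    ((TensorProduct.comm ℂ V V).toLinearMap.lTensor V).lTensor A
      (braid₁₂ s (c ⊗ₜ (b ⊗ₜ a))) := rfl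
  rw [h, braid₁₂_tmul, ← LinearMap.comp_apply, ← LinearMap.lTensor_comp]
  congr 2
  ext v w
  rfl

theorem leg12_expand {L : Type*} [Field L] [Algebra ℂ L] (ev : A →ₐ[ℂ] L)
    (s : V ⊗[ℂ] V →ₗ[ℂ] A ⊗[ℂ] (V ⊗[ℂ] V)) :
    leg12 (expand ev ∘ₗ s) = expand ev ∘ₗ braid₁₂ s := by
  ext c a b
  change braid₁₂ (expand ev ∘ₗ s) (c ⊗ₜ (a ⊗ₜ b)) = expand ev (braid₁₂ s (c ⊗ₜ (a ⊗ₜ b)))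
  rw [braid₁₂_tmul, braid₁₂_tmul, expand, expand, LinearMap.comp_apply, ← LinearMap.comp_apply,
    LinearMap.lTensor_comp_rTensor, ← LinearMap.rTensor_comp_lTensor, LinearMap.comp_apply]

theorem leg13_expand {L : Type*} [Field L] [Algebra ℂ L] (ev : A →ₐ[ℂ] L)
    (s : V ⊗[ℂ] V →ₗ[ℂ] A ⊗[ℂ] (V ⊗[ℂ] V)) :
    leg13 (expand ev ∘ₗ s) = expand ev ∘ₗ braid₁₃ s := by
  ext c a b
  change braid₁₃ (expand ev ∘ₗ s) (c ⊗ₜ (a ⊗ₜ b)) = expand ev (braid₁₃ s (c ⊗ₜ (a ⊗ₜ b)))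
  rw [braid₁₃_tmul, braid₁₃_tmul, expand, expand, LinearMap.comp_apply, ← LinearMap.comp_apply,
    LinearMap.lTensor_comp_rTensor, ← LinearMap.rTensor_comp_lTensor, LinearMap.comp_apply]

variable {B : Type*} [CommRing B] [Algebra ℂ B]
variable {N : Type*} [AddCommGroup N] [Module ℂ N] [Module B N] [IsScalarTower ℂ B N]

/-- The `tᵏ`-coefficient of `Φ ∘ S¹² ∘ S¹³`, with coefficients evaluated by `ev₁`, `ev₂`. -/
def nest (S : ℕ → V ⊗[ℂ] V →ₗ[ℂ] A ⊗[ℂ] (V ⊗[ℂ] V)) (ev₁ ev₂ : A →ₐ[ℂ] B)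
    (Φ : ℕ → V ⊗[ℂ] (V ⊗[ℂ] V) →ₗ[ℂ] N) (k : ℕ) : V ⊗[ℂ] (V ⊗[ℂ] V) →ₗ[ℂ] N :=
  ∑ ij ∈ antidiagonal k, ∑ pq ∈ antidiagonal ij.2,
    evLift ev₂ (evLift ev₁ (Φ ij.1) ∘ₗ braid₁₂ (S pq.1)) ∘ₗ braid₁₃ (S pq.2)

theorem nest_apply (S : ℕ → V ⊗[ℂ] V →ₗ[ℂ] A ⊗[ℂ] (V ⊗[ℂ] V)) (ev₁ ev₂ : A →ₐ[ℂ] B)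
    (Φ : ℕ → V ⊗[ℂ] (V ⊗[ℂ] V) →ₗ[ℂ] N) (k : ℕ) (u : V ⊗[ℂ] (V ⊗[ℂ] V)) :
    nest S ev₁ ev₂ Φ k u = ∑ ij ∈ antidiagonal k, ∑ pq ∈ antidiagonal ij.2,
      evLift ev₂ (evLift ev₁ (Φ ij.1) ∘ₗ braid₁₂ (S pq.1)) (braid₁₃ (S pq.2) u) := by
  simp [nest, LinearMap.sum_apply]

/-- Rewrites the right side of the hexagon axiom as a `nest`. The latter makes sense over any
commutative coefficient ring and any target module, so linear maps and relations can be pushed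
through it. -/
theorem sum_op_mul_op {L : Type*} [Field L] [Algebra ℂ L] {N : Type*} [AddCommGroup N]
    [Module ℂ N] [Module L N] [IsScalarTower ℂ L N]
    (S : ℕ → V ⊗[ℂ] V →ₗ[ℂ] A ⊗[ℂ] (V ⊗[ℂ] V)) (ev₁ ev₂ : A →ₐ[ℂ] L)
    (Φ : ℕ → V ⊗[ℂ] (V ⊗[ℂ] V) →ₗ[ℂ] N) (k : ℕ) (u : V ⊗[ℂ] (V ⊗[ℂ] V)) :
    ∑ ij ∈ antidiagonal k, LinearMap.liftBaseChange L (Φ ij.1)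
      (PowerSeries.coeff ij.2 (op12 ev₁ S * op13 ev₂ S) (1 ⊗ₜ u)) =
      nest S ev₁ ev₂ Φ k u := by
  rw [nest_apply]
  refine Finset.sum_congr rfl fun ij _ => ?_
  rw [PowerSeries.coeff_mul, LinearMap.sum_apply, map_sum]
  refine Finset.sum_congr rfl fun pq _ => ?_
  rw [op12, op13, PowerSeries.coeff_mk, PowerSeries.coeff_mk, Module.End.mul_apply,
    LinearMap.liftBaseChange_tmul, one_smul, leg12_expand, leg13_expand, LinearMap.comp_apply]
  generalize braid₁₃ (S pq.2) u = s
  induction s with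
  | zero => simp
  | tmul f w => simp [expand, evLift]
  | add s t hs ht => simp only [map_add, hs, ht]

end Legs

/-! ## Formal distributions and their localizations -/

/-- Formal distributions with exponents in `G` and coefficients in `V`. -/
abbrev Dist (G V : Type*) : Type _ := G → V

section Dist

variable {G : Type*} [AddCommGroup G] {V : Type*} [AddCommGroup V] [Module ℂ V]

theorem Dist.ext {f g : Dist G V} (h : ∀ a, f a = g a) : f = g := funext h

/-- The action of Laurent monomials on distributions. -/
def Dist.shift : Multiplicative G →* Module.End ℂ (Dist G V) where
  toFun g :=
    { toFun := fun f a => f (a - g.toAdd)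
      map_add' := fun _ _ => rfl
      map_smul' := fun _ _ => rfl }
  map_one' := LinearMap.ext fun f => Dist.ext fun a => congrArg f (sub_zero a)
  map_mul' g h := LinearMap.ext fun f => Dist.ext fun a => congrArg f (by
    rw [toAdd_mul]; abel)

/-- The action of Laurent polynomials on distributions. -/
def Dist.action : AddMonoidAlgebra ℂ G →ₐ[ℂ] Module.End ℂ (Dist G V) :=
  AddMonoidAlgebra.lift ℂ (Module.End ℂ (Dist G V)) G Dist.shift

instance Dist.instModule : Module (AddMonoidAlgebra ℂ G) (Dist G V) :=
  Module.compHom _ (Dist.action (G := G) (V := V)).toRingHom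

theorem Dist.smul_def (r : AddMonoidAlgebra ℂ G) (f : Dist G V) : r • f = Dist.action r f := rfl

instance : IsScalarTower ℂ (AddMonoidAlgebra ℂ G) (Dist G V) :=
  IsScalarTower.of_algebraMap_smul fun r f => by
    rw [Dist.smul_def, AlgHom.commutes]; rfl

/-- The Laurent monomial with exponent `g`. -/
def mono (g : G) : AddMonoidAlgebra ℂ G := AddMonoidAlgebra.of ℂ G (Multiplicative.ofAdd g)

theorem mono_add (g h : G) : mono (g + h) = mono g * mono h := by
  simp [mono, ofAdd_add]

@[simp] theorem mono_zero : mono (0 : G) = 1 := map_one (AddMonoidAlgebra.of ℂ G)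

@[simp] theorem Dist.mono_smul_apply (g : G) (f : Dist G V) (a : G) :
    (mono g • f) a = f (a - g) := by
  rw [Dist.smul_def, mono, Dist.action, AddMonoidAlgebra.of_apply, AddMonoidAlgebra.lift_single,
    one_smul]
  rfl

theorem Dist.smul_apply' (r : AddMonoidAlgebra ℂ G) (f : Dist G V) (a : G) :
    (r • f) a = r.coeff.sum fun g c => c • f (a - g) := by
  rw [Dist.smul_def, Dist.action, AddMonoidAlgebra.lift_apply, Finsupp.sum, LinearMap.sum_apply]
  exact Finset.sum_apply a _ _

open Classical in
/-- The distribution `1`. -/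
def Dist.delta : Dist G ℂ := fun b => if b = 0 then 1 else 0

/-- Laurent polynomials act faithfully: the action on the unit distribution. -/
theorem Dist.smul_delta (r : AddMonoidAlgebra ℂ G) (a : G) :
    (r • (Dist.delta : Dist G ℂ)) a = r.coeff a := by
  classical
  rw [Dist.smul_apply', Finsupp.sum, Finset.sum_eq_single a]
  · simp [Dist.delta]
  · intro b _ hb
    simp [Dist.delta, sub_eq_zero, hb.symm]
  · intro h
    simp [Finsupp.notMem_support_iff.1 h]

/-- A linear map which intertwines monomials is linear over Laurent polynomials. -/
theorem map_laurent_smul {N N' : Type*} [AddCommGroup N] [Module ℂ N] [AddCommGroup N']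
    [Module ℂ N'] {B B' : Type*} [CommRing B] [Algebra ℂ B] [CommRing B'] [Algebra ℂ B']
    [Module B N] [IsScalarTower ℂ B N] [Module B' N'] [IsScalarTower ℂ B' N']
    (ev : AddMonoidAlgebra ℂ G →ₐ[ℂ] B) (ev' : AddMonoidAlgebra ℂ G →ₐ[ℂ] B') (j : N →ₗ[ℂ] N')
    (h : ∀ g v, j (ev (mono g) • v) = ev' (mono g) • j v) (r : AddMonoidAlgebra ℂ G) :
    ∀ v, j (ev r • v) = ev' r • j v := by
  induction r using AddMonoidAlgebra.induction_on with
  | of g => exact h g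
  | add p q hp hq => intro v; simp only [map_add, add_smul, hp, hq]
  | smul c p hp => intro v; simp only [map_smul, smul_assoc, hp]

end Dist

/-! ### Distributions in (z₂, w) modulo torsion. -/

section TwoVariables

/-- Laurent polynomials in `(z₂, w)`. -/
abbrev R2 := AddMonoidAlgebra ℂ (ℤ × ℤ)

/-- Rational functions of `(z₂, w)`. -/
abbrev K2 := FractionRing R2

/-- The variables of `K2`. -/
def kz : K2 := algebraMap R2 K2 (mono (1, 0))
def kw : K2 := algebraMap R2 K2 (mono (0, 1))

variable (V : Type*) [AddCommGroup V] [Module ℂ V]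

/-- Distributions in `(z₂, w)` modulo torsion, localized at all nonzero Laurent polynomials. -/
def D2K : Type _ := LocalizedModule (nonZeroDivisors R2) (Dist (ℤ × ℤ) V)

instance : AddCommGroup (D2K V) :=
  inferInstanceAs (AddCommGroup (LocalizedModule (nonZeroDivisors R2) (Dist (ℤ × ℤ) V)))
instance : Module K2 (D2K V) :=
  inferInstanceAs (Module (Localization (nonZeroDivisors R2))
    (LocalizedModule (nonZeroDivisors R2) (Dist (ℤ × ℤ) V)))
instance : Module ℂ (D2K V) := Module.compHom _ (algebraMap ℂ K2)
instance : IsScalarTower ℂ K2 (D2K V) := IsScalarTower.of_algebraMap_smul fun _ _ => rfl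

variable {V}

theorem algebraMap_smul_mk (r : R2) (f : Dist (ℤ × ℤ) V) :
    (algebraMap R2 K2 r • (LocalizedModule.mk f 1 : LocalizedModule (nonZeroDivisors R2) _) :
      LocalizedModule (nonZeroDivisors R2) (Dist (ℤ × ℤ) V)) = LocalizedModule.mk (r • f) 1 := by
  rw [algebraMap_smul, LocalizedModule.smul'_mk]

/-- The class of a distribution. -/
def emb₂ : Dist (ℤ × ℤ) V →ₗ[ℂ] D2K V where
  toFun f := (LocalizedModule.mk f 1 : LocalizedModule (nonZeroDivisors R2) _)
  map_add' f g := (LocalizedModule.mkLinearMap (nonZeroDivisors R2) (Dist (ℤ × ℤ) V)).map_add f g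
  map_smul' r f := by
    have := algebraMap_smul_mk (algebraMap ℂ R2 r) f
    rw [← IsScalarTower.algebraMap_apply ℂ R2 K2,
      algebraMap_smul (AddMonoidAlgebra ℂ (ℤ × ℤ)) r f] at this
    exact this.symm

theorem emb₂_smul (r : R2) (f : Dist (ℤ × ℤ) V) :
    emb₂ (r • f) = algebraMap R2 K2 r • emb₂ f := (algebraMap_smul_mk r f).symm

/-- Different expansions of one rational function differ by torsion, since clearing the denominator
makes them agree; they become equal in `D2K`. -/
theorem emb₂_eq_zero {f : Dist (ℤ × ℤ) V} : emb₂ f = 0 ↔ ∃ r : R2, r ≠ 0 ∧ r • f = 0 := by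
  have h := IsLocalizedModule.eq_zero_iff (nonZeroDivisors R2)
    (LocalizedModule.mkLinearMap (nonZeroDivisors R2) (Dist (ℤ × ℤ) V)) (m := f)
  refine Iff.trans h ⟨?_, ?_⟩
  · rintro ⟨s, hs⟩
    exact ⟨s, nonZeroDivisors.ne_zero s.2, hs⟩
  · rintro ⟨r, hr, h⟩
    exact ⟨⟨r, mem_nonZeroDivisors_of_ne_zero hr⟩, h⟩

/-- `V((z₂))((w))` as distributions in `(z₂, w)`. -/
def distX : V2 V →ₗ[ℂ] Dist (ℤ × ℤ) V where
  toFun f := fun a => cf f a.1 a.2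
  map_add' f g := Dist.ext fun _ => cf_add f g _ _
  map_smul' r f := Dist.ext fun _ => cf_smul r f _ _

/-- `V((w))((z₂))` as distributions in `(z₂, w)`. -/
def distY : V2 V →ₗ[ℂ] Dist (ℤ × ℤ) V where
  toFun f := fun a => cf f a.2 a.1
  map_add' f g := Dist.ext fun _ => cf_add f g _ _
  map_smul' r f := Dist.ext fun _ => cf_smul r f _ _

@[simp] theorem distX_apply (f : V2 V) (a : ℤ × ℤ) : distX f a = cf f a.1 a.2 := rfl
@[simp] theorem distY_apply (f : V2 V) (a : ℤ × ℤ) : distY f a = cf f a.2 a.1 := rfl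

theorem distX_injective : Function.Injective (distX (V := V)) := fun _ _ h =>
  V2.ext fun p q => congrFun h (p, q)

/-- Expansion of Laurent polynomials with values `p`, `q` of the variables `(z₂, w)`. -/
def evR2 {L : Type*} [Field L] [Algebra ℂ L] (p q : L) (hp : p ≠ 0) (hq : q ≠ 0) :
    R2 →ₐ[ℂ] L :=
  AddMonoidAlgebra.lift ℂ L (ℤ × ℤ)
    { toFun := fun g => p ^ g.toAdd.1 * q ^ g.toAdd.2
      map_one' := by simp
      map_mul' := fun g h => by
        simp only [toAdd_mul, Prod.fst_add, Prod.snd_add, zpow_add₀ hp, zpow_add₀ hq]; ring }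

@[simp] theorem evR2_mono {L : Type*} [Field L] [Algebra ℂ L] (p q : L) (hp : p ≠ 0)
    (hq : q ≠ 0) (g : ℤ × ℤ) : evR2 p q hp hq (mono g) = p ^ g.1 * q ^ g.2 := by
  simp [evR2, mono]

theorem distX_smul (r : R2) (f : V2 V) :
    distX (evR2 x y x_ne y_ne r • f) = r • distX f :=
  map_laurent_smul (evR2 x y x_ne y_ne) (AlgHom.id ℂ R2) distX (fun g v => Dist.ext fun a => by
    rw [evR2_mono, AlgHom.id_apply, Dist.mono_smul_apply, mul_smul]; simp) r f

theorem distY_smul (r : R2) (f : V2 V) :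
    distY (evR2 y x y_ne x_ne r • f) = r • distY f :=
  map_laurent_smul (evR2 y x y_ne x_ne) (AlgHom.id ℂ R2) distY (fun g v => Dist.ext fun a => by
    rw [evR2_mono, AlgHom.id_apply, Dist.mono_smul_apply, mul_smul]; simp) r f

theorem R2.eq_zero_of_smul_delta {r : R2}
    (h : r • (Dist.delta : Dist (ℤ × ℤ) ℂ) = 0) : r = 0 := by
  have : r.coeff = 0 := Finsupp.ext fun a => by
    rw [← Dist.smul_delta, h]; rfl
  exact AddMonoidAlgebra.coeff_injective this

/-- Acting on the constant 1, a Laurent polynomial reproduces its own coefficients. -/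
theorem evR2_xy_injective : Function.Injective (evR2 x y x_ne y_ne) := by
  refine (injective_iff_map_eq_zero _).2 fun r hr => R2.eq_zero_of_smul_delta ?_
  have h := distX_smul r (const₂ (1 : ℂ))
  rw [hr, zero_smul, map_zero] at h
  rw [h]
  congr 1
  refine Dist.ext fun a => ?_
  simp [Dist.delta, Prod.ext_iff, and_comm]

theorem evR2_yx_injective : Function.Injective (evR2 y x y_ne x_ne) := by
  refine (injective_iff_map_eq_zero _).2 fun r hr => R2.eq_zero_of_smul_delta ?_
  have h := distY_smul r (const₂ (1 : ℂ))
  rw [hr, zero_smul, map_zero] at h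
  rw [h]
  congr 1
  refine Dist.ext fun a => ?_
  simp [Dist.delta, Prod.ext_iff]

/-- V((z₂))((w)) is a vector space over the field of iterated Laurent series, in which nonzero
Laurent polynomials are invertible; it therefore has no torsion. Working modulo torsion loses
nothing as long as the final comparison takes place inside one region. -/
theorem emb₂_distX_injective : Function.Injective fun f : V2 V => emb₂ (distX f) := by
  refine (injective_iff_map_eq_zero (emb₂ ∘ₗ distX)).2 fun f hf => ?_
  obtain ⟨r, hr, h⟩ := emb₂_eq_zero.1 hf
  rw [← distX_smul, ← map_zero (distX (V := V))] at h
  exact (smul_eq_zero.1 (distX_injective h)).resolve_left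
    ((map_ne_zero_iff _ evR2_xy_injective).2 hr)

theorem kz_ne : kz ≠ 0 := by
  refine (map_ne_zero_iff _ (IsFractionRing.injective R2 K2)).2 fun h => ?_
  have := evR2_mono y x y_ne x_ne (1, 0)
  rw [h, map_zero] at this
  simp at this
  exact y_ne this.symm

theorem kw_ne : kw ≠ 0 := by
  refine (map_ne_zero_iff _ (IsFractionRing.injective R2 K2)).2 fun h => ?_
  have := evR2_mono y x y_ne x_ne (0, 1)
  rw [h, map_zero] at this
  simp at this
  exact x_ne this.symm

/-- Expansion of rational functions of `(z₂, w)` in the region `|w| > |z₂|`. -/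
def expK : K2 →ₐ[ℂ] L2 :=
  IsFractionRing.liftAlgHom (g := evR2 y x y_ne x_ne) evR2_yx_injective

@[simp] theorem expK_kz : expK kz = y := by simp [expK, kz]
@[simp] theorem expK_kw : expK kw = x := by simp [expK, kw]

theorem kw_sub_kz_ne : kw - kz ≠ 0 := by
  intro h
  have := congrArg expK h
  rw [map_sub, expK_kz, expK_kw, map_zero] at this
  exact x_sub_y_ne this

theorem mono_kz_kw (g : ℤ × ℤ) : algebraMap R2 K2 (mono g) = kz ^ g.1 * kw ^ g.2 := by
  refine expK.toRingHom.injective ?_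
  change expK _ = expK _
  rw [map_mul, map_zpow₀, map_zpow₀, expK_kz, expK_kw]
  simp [expK]

/-- The evaluation `(τ₁, τ₂) = (w, z₂)`. -/
def evK : Aτ →ₐ[ℂ] K2 := evτ kw kz (mul_ne_zero (mul_ne_zero kw_ne kz_ne) kw_sub_kz_ne)

/-- Modulo torsion the expansion of a coefficient function becomes the rational function itself;
this need only be checked on the two coordinates. -/
theorem emb₂_distY_smul (f : Aτ) (v : V2 V) :
    emb₂ (distY (ι f • v)) = evK f • emb₂ (distY v) :=
  Aτ.map_smul (ev := ι) (ev' := evK) (emb₂ ∘ₗ distY)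
    (fun v => by
      have h := distY_smul (mono (0, 1)) v
      rw [evR2_mono] at h
      simp only [zpow_zero, zpow_one, one_mul] at h
      simp only [ι, evK, evτ_τ₁, LinearMap.comp_apply, h, emb₂_smul]; rfl)
    (fun v => by
      have h := distY_smul (mono (1, 0)) v
      rw [evR2_mono] at h
      simp only [zpow_zero, zpow_one, mul_one] at h
      simp only [ι, evK, evτ_τ₂, LinearMap.comp_apply, h, emb₂_smul]; rfl) f v

end TwoVariables

/-! ## The substitution `z₁ = z₂ + z₃` -/

section Subst

variable {V : Type*} [AddCommGroup V] [Module ℂ V]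
variable {W : Type*} [AddCommGroup W] [Module ℂ W]

/-- Distributions in two variables with exponents bounded below. -/
def IsBdd (g : ℤ → ℤ → V) : Prop := ∃ B : ℤ, ∀ p q, (p < B ∨ q < B) → g p q = 0

/-- The coefficient of `z₂ᵐ z₃ⁿ` in the expansion of `g(z₂ + z₃, z₂)` in powers of `z₃`. -/
def subst (g : ℤ → ℤ → V) (m n : ℤ) : V :=
  if 0 ≤ n then ∑ᶠ p : ℤ, Ring.choose p n.toNat • g p (m + n - p) else 0

theorem subst_of_neg (g : ℤ → ℤ → V) (m : ℤ) {n : ℤ} (hn : n < 0) : subst g m n = 0 :=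
  if_neg (by omega)

theorem subst_eq_sum {g : ℤ → ℤ → V} {B : ℤ} (hg : ∀ p q, (p < B ∨ q < B) → g p q = 0)
    (m : ℤ) {n : ℤ} (hn : 0 ≤ n) {s : Finset ℤ} (hs : ∀ p, B ≤ p → p ≤ m + n - B → p ∈ s) :
    subst g m n = ∑ p ∈ s, Ring.choose p n.toNat • g p (m + n - p) := by
  rw [subst, if_pos hn]
  refine finsum_eq_sum_of_support_subset _ fun p hp => ?_
  by_contra h
  refine hp ?_
  have : p < B ∨ m + n - p < B := by
    by_contra! h'
    exact h (hs p h'.1 (by omega))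
  simp only [hg _ _ this, smul_zero]

theorem subst_add {g h : ℤ → ℤ → V} (hg : IsBdd g) (hh : IsBdd h) (m n : ℤ) :
    subst (fun p q => g p q + h p q) m n = subst g m n + subst h m n := by
  obtain ⟨B, hB⟩ := hg
  obtain ⟨B', hB'⟩ := hh
  by_cases hn : 0 ≤ n
  · have hs : ∀ p, min B B' ≤ p → p ≤ m + n - min B B' →
        p ∈ Finset.Icc (min B B') (m + n - min B B') := fun p h h' => Finset.mem_Icc.2 ⟨h, h'⟩
    rw [subst_eq_sum (B := min B B') (fun p q h => hB p q (by omega)) m hn hs,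
      subst_eq_sum (B := min B B') (fun p q h => hB' p q (by omega)) m hn hs,
      subst_eq_sum (B := min B B')
        (fun p q h => by simp [hB p q (by omega), hB' p q (by omega)]) m hn hs,
      ← Finset.sum_add_distrib]
    simp
  · simp [subst, hn]

theorem subst_map {g : ℤ → ℤ → V} (hg : IsBdd g) (φ : V →ₗ[ℂ] W) (m n : ℤ) :
    subst (fun p q => φ (g p q)) m n = φ (subst g m n) := by
  obtain ⟨B, hB⟩ := hg
  by_cases hn : 0 ≤ n
  · have hs : ∀ p, B ≤ p → p ≤ m + n - B → p ∈ Finset.Icc B (m + n - B) :=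
      fun p h h' => Finset.mem_Icc.2 ⟨h, h'⟩
    rw [subst_eq_sum hB m hn hs, subst_eq_sum (fun p q h => by simp [hB p q h]) m hn hs, map_sum]
    simp
  · simp [subst, hn]

theorem subst_shift_right {g : ℤ → ℤ → V} (m n k : ℤ) :
    subst (fun p q => g p (q - k)) m n = subst g (m - k) n := by
  unfold subst
  split_ifs
  · refine finsum_congr fun p => ?_
    congr 2
    ring_nf
  · rfl

/-- Pascal's rule: multiplication by z₁ turns into multiplication by z₂ + z₃. Together with
`subst_shift_right` it makes `subst` a ring-compatible substitution. -/
theorem subst_shift_left {g : ℤ → ℤ → V} (hg : IsBdd g) (m n : ℤ) :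
    subst (fun p q => g (p - 1) q) m n = subst g (m - 1) n + subst g m (n - 1) := by
  obtain ⟨B, hB⟩ := hg
  have hB' : ∀ p q, (p < B ∨ q < B) → g (p - 1) q = 0 := fun p q h => hB _ _ (by omega)
  rcases lt_trichotomy n 0 with hn | rfl | hn
  · rw [subst_of_neg _ _ hn, subst_of_neg _ _ hn, subst_of_neg _ _ (by omega), add_zero]
  -- For n = 0 all binomial coefficients equal 1 and the second summand vanishes, so this is just a
  -- shift of the summation index.
  · rw [subst_of_neg _ m (show (0 : ℤ) - 1 < 0 by omega), add_zero]
    simp only [subst, le_refl, if_true, Int.toNat_zero, Ring.choose_zero_right, one_smul]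
    rw [← finsum_comp_equiv (Equiv.addRight (1 : ℤ))]
    refine finsum_congr fun p => ?_
    simp only [Equiv.coe_addRight, add_sub_cancel_right]
    rw [show m + 0 - (p + 1) = m - 1 + 0 - p by ring]
  · have hs : ∀ p, B - 1 ≤ p → p ≤ m + n - (B - 1) →
        p ∈ Finset.Icc (B - 1) (m + n - (B - 1)) :=
      fun p h h' => Finset.mem_Icc.2 ⟨h, h'⟩
    have hC : ∀ p q, (p < B - 1 ∨ q < B - 1) → g p q = 0 := fun p q h => hB _ _ (by omega)
    rw [subst_eq_sum hC (m - 1) hn.le (s := Finset.Icc (B - 1) (m + n - (B - 1)))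
        (fun p h h' => Finset.mem_Icc.2 ⟨h, by omega⟩),
      subst_eq_sum hC m (show 0 ≤ n - 1 by omega) (s := Finset.Icc (B - 1) (m + n - (B - 1)))
        (fun p h h' => Finset.mem_Icc.2 ⟨h, by omega⟩), ← Finset.sum_add_distrib]
    rw [subst_eq_sum hB' m hn.le
      (s := (Finset.Icc (B - 1) (m + n - (B - 1))).map (Equiv.addRight (1 : ℤ)).toEmbedding)
      (fun p h h' => by
        rw [Finset.mem_map]
        exact ⟨p - 1, Finset.mem_Icc.2 ⟨by omega, by omega⟩, by simp⟩), Finset.sum_map]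
    refine Finset.sum_congr rfl fun p _ => ?_
    obtain ⟨k, rfl⟩ : ∃ k : ℕ, n = k + 1 := ⟨(n - 1).toNat, by omega⟩
    have e1 : ((k : ℤ) + 1).toNat = k + 1 := by omega
    have e2 : ((k : ℤ) + 1 - 1).toNat = k := by omega
    simp only [Equiv.coe_toEmbedding, Equiv.coe_addRight, add_sub_cancel_right, e1]
    rw [Ring.choose_succ_succ, add_smul, add_comm, show m + (k + 1) - (p + 1) = m + k - p by ring,
      show m - 1 + (k + 1) - p = m + k - p by ring, Int.toNat_natCast]

end Subst

/-! ### Distributions in (z₁, z₂, w) and the substitution as a relation. -/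

section ThreeVariables

/-- Laurent polynomials in `(z₁, z₂, w)`. -/
abbrev R3 := AddMonoidAlgebra ℂ (ℤ × ℤ × ℤ)

/-- The value `z₂ + z₃` of `z₁`. -/
def shiftVar : LF K2 := LF.C kz + LF.var K2

theorem shiftVar_ne : shiftVar ≠ 0 := C_add_var_ne kz

/-- The substitution `z₁ = z₂ + z₃` on Laurent polynomials. -/
def substR : R3 →ₐ[ℂ] LF K2 :=
  AddMonoidAlgebra.lift ℂ (LF K2) (ℤ × ℤ × ℤ)
    { toFun := fun g => shiftVar ^ g.toAdd.1 * (LF.C kz ^ g.toAdd.2.1 * LF.C kw ^ g.toAdd.2.2)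
      map_one' := by simp
      map_mul' := fun g h => by
        simp only [toAdd_mul, Prod.fst_add, Prod.snd_add, zpow_add₀ shiftVar_ne,
          zpow_add₀ (C_ne kz_ne), zpow_add₀ (C_ne kw_ne)]
        ring }

theorem substR_mono (g : ℤ × ℤ × ℤ) :
    substR (mono g) = shiftVar ^ g.1 * (LF.C kz ^ g.2.1 * LF.C kw ^ g.2.2) := by
  simp [substR, mono]

/-- The denominators which remain invertible after the substitution `z₁ = z₂ + z₃`. -/
def S3 : Submonoid R3 := (nonZeroDivisors (LF K2)).comap substR

theorem mem_S3 {r : R3} : r ∈ S3 ↔ substR r ≠ 0 := mem_nonZeroDivisors_iff_ne_zero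

abbrev A3 := Localization S3

/-- The variables of `R3`. -/
def r₁ : R3 := mono (1, 0, 0)
def r₂ : R3 := mono (0, 1, 0)
def rw' : R3 := mono (0, 0, 1)

@[simp] theorem substR_r₁ : substR r₁ = shiftVar := by simp [r₁, substR_mono]
@[simp] theorem substR_r₂ : substR r₂ = LF.C kz := by simp [r₂, substR_mono]
@[simp] theorem substR_rw : substR rw' = LF.C kw := by simp [rw', substR_mono]

variable (V : Type*) [AddCommGroup V] [Module ℂ V]

/-- Distributions in `(z₁, z₂, w)`, localized at `S3`. -/
def D3K : Type _ := LocalizedModule S3 (Dist (ℤ × ℤ × ℤ) V)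

instance : AddCommGroup (D3K V) :=
  inferInstanceAs (AddCommGroup (LocalizedModule S3 (Dist (ℤ × ℤ × ℤ) V)))
instance : Module A3 (D3K V) :=
  inferInstanceAs (Module (Localization S3) (LocalizedModule S3 (Dist (ℤ × ℤ × ℤ) V)))
instance : Module ℂ (D3K V) := Module.compHom _ (algebraMap ℂ A3)
instance : IsScalarTower ℂ A3 (D3K V) := IsScalarTower.of_algebraMap_smul fun _ _ => rfl

variable {V}

theorem algebraMap_smul_mk₃ (r : R3) (f : Dist (ℤ × ℤ × ℤ) V) :
    (algebraMap R3 A3 r • (LocalizedModule.mk f 1 : LocalizedModule S3 _) :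
      LocalizedModule S3 (Dist (ℤ × ℤ × ℤ) V)) = LocalizedModule.mk (r • f) 1 := by
  rw [algebraMap_smul, LocalizedModule.smul'_mk]

/-- The class of a distribution. -/
def emb₃ : Dist (ℤ × ℤ × ℤ) V →ₗ[ℂ] D3K V where
  toFun f := (LocalizedModule.mk f 1 : LocalizedModule S3 _)
  map_add' f g := (LocalizedModule.mkLinearMap S3 (Dist (ℤ × ℤ × ℤ) V)).map_add f g
  map_smul' r f := by
    have := algebraMap_smul_mk₃ (algebraMap ℂ R3 r) f
    rw [← IsScalarTower.algebraMap_apply ℂ R3 A3,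
      algebraMap_smul (AddMonoidAlgebra ℂ (ℤ × ℤ × ℤ)) r f] at this
    exact this.symm

theorem emb₃_smul (r : R3) (f : Dist (ℤ × ℤ × ℤ) V) :
    emb₃ (r • f) = algebraMap R3 A3 r • emb₃ f := (algebraMap_smul_mk₃ r f).symm

theorem emb₃_eq_zero {f : Dist (ℤ × ℤ × ℤ) V} : emb₃ f = 0 ↔ ∃ r ∈ S3, r • f = 0 := by
  have h := IsLocalizedModule.eq_zero_iff S3
    (LocalizedModule.mkLinearMap S3 (Dist (ℤ × ℤ × ℤ) V)) (m := f)
  refine Iff.trans h ⟨?_, ?_⟩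
  · rintro ⟨s, hs⟩
    exact ⟨s, s.2, hs⟩
  · rintro ⟨r, hr, h⟩
    exact ⟨⟨r, hr⟩, h⟩

/-- Distributions whose exponents of `z₁`, `z₂` are bounded below, for every exponent of `w`. -/
def bddDist : Submodule R3 (Dist (ℤ × ℤ × ℤ) V) where
  carrier := {f | ∀ r, IsBdd fun p q => f (p, q, r)}
  zero_mem' := fun r => ⟨0, fun p q _ => rfl⟩
  add_mem' := fun {f g} hf hg r => by
    obtain ⟨B, hB⟩ := hf r
    obtain ⟨B', hB'⟩ := hg r
    refine ⟨min B B', fun p q h => ?_⟩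
    exact (congrArg₂ (· + ·) (hB p q (by omega)) (hB' p q (by omega))).trans (add_zero 0)
  smul_mem' := fun s f hf => by
    induction s using AddMonoidAlgebra.induction_on with
    | of g =>
      intro r
      obtain ⟨B, hB⟩ := hf (r - g.2.2)
      refine ⟨B + min g.1 g.2.1, fun p q h => ?_⟩
      change (mono g • f) _ = 0
      rw [Dist.mono_smul_apply]
      refine hB (p - g.1) (q - g.2.1) ?_
      have := le_max_right g.1 g.2.1
      have := min_le_left g.1 g.2.1
      omega
    | add s t hs ht =>
      intro r
      obtain ⟨B, hB⟩ := hs r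
      obtain ⟨B', hB'⟩ := ht r
      refine ⟨min B B', fun p q h => ?_⟩
      rw [add_smul]
      exact (congrArg₂ (· + ·) (hB p q (by omega)) (hB' p q (by omega))).trans (add_zero 0)
    | smul c s hs =>
      intro r
      obtain ⟨B, hB⟩ := hs r
      refine ⟨B, fun p q h => ?_⟩
      rw [smul_assoc]
      exact (congrArg _ (hB p q h)).trans (smul_zero c)

/-- The result of the substitution `z₁ = z₂ + z₃`, as a series in `z₃`. -/
def substD (f : Dist (ℤ × ℤ × ℤ) V) : LSer K2 (D2K V) :=
  LSer.ofFun (fun n => emb₂ fun a => subst (fun p q => f (p, q, a.2)) a.1 n) 0 fun _ hn =>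
    (congrArg emb₂ (Dist.ext fun _ => subst_of_neg _ _ hn)).trans (map_zero emb₂)

@[simp] theorem coeff_substD (f : Dist (ℤ × ℤ × ℤ) V) (n : ℤ) :
    (substD f).coeff n = emb₂ fun a => subst (fun p q => f (p, q, a.2)) a.1 n := rfl

theorem substD_add {f g : Dist (ℤ × ℤ × ℤ) V} (hf : f ∈ bddDist) (hg : g ∈ bddDist) :
    substD (f + g) = substD f + substD g := by
  refine LSer.ext fun n => ?_
  rw [LSer.coeff_add, coeff_substD, coeff_substD, coeff_substD, ← map_add]
  exact congrArg emb₂ (Dist.ext fun a => subst_add (hf a.2) (hg a.2) a.1 n)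

theorem substD_smul_complex {f : Dist (ℤ × ℤ × ℤ) V} (hf : f ∈ bddDist) (c : ℂ) :
    substD (c • f) = c • substD f := by
  refine LSer.ext fun n => ?_
  rw [LSer.coeff_smul, coeff_substD, coeff_substD, ← map_smul]
  exact congrArg emb₂ (Dist.ext fun a => subst_map (hf a.2) (c • LinearMap.id) a.1 n)

theorem kz_smul_emb₂ (f : Dist (ℤ × ℤ) V) :
    kz • emb₂ f = emb₂ fun a => f (a.1 - 1, a.2) := by
  rw [kz, ← emb₂_smul]
  refine congrArg emb₂ (Dist.ext fun a => ?_)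
  rw [Dist.mono_smul_apply]
  exact congrArg f (Prod.ext rfl (sub_zero _))

theorem kw_smul_emb₂ (f : Dist (ℤ × ℤ) V) :
    kw • emb₂ f = emb₂ fun a => f (a.1, a.2 - 1) := by
  rw [kw, ← emb₂_smul]
  refine congrArg emb₂ (Dist.ext fun a => ?_)
  rw [Dist.mono_smul_apply]
  exact congrArg f (Prod.ext (sub_zero _) rfl)

/-- It suffices to treat monomials. Those that pass through the substitution form a group of
exponents, and the three generators are the two shift rules of `subst` and a shift of the spectator
w. -/
theorem substD_smul {f : Dist (ℤ × ℤ × ℤ) V} (hf : f ∈ bddDist) (r : R3) :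
    substD (r • f) = substR r • substD f := by
  -- Inverses come for free: apply the rule for g to the bounded distribution obtained by
  -- multiplying with the monomial of exponent -g.
  have inv : ∀ g : ℤ × ℤ × ℤ,
      (∀ f ∈ bddDist (V := V), substD (mono g • f) = substR (mono g) • substD f) →
      (∀ f ∈ bddDist (V := V), substD (mono (-g) • f) = substR (mono (-g)) • substD f) := by
    intro g hg f hf
    have h := hg _ (bddDist.smul_mem (mono (-g)) hf)
    rw [smul_smul, ← mono_add, add_neg_cancel, mono_zero, one_smul] at h
    rw [h, smul_smul, ← map_mul, ← mono_add, neg_add_cancel, mono_zero, map_one, one_smul]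
  let T : AddSubgroup (ℤ × ℤ × ℤ) :=
    { carrier := {g | ∀ f ∈ bddDist (V := V), substD (mono g • f) = substR (mono g) • substD f}
      zero_mem' := fun f _ => by simp
      add_mem' := fun {g h} hg hh f hf => by
        rw [mono_add, mul_smul, hg _ (bddDist.smul_mem _ hf), hh _ hf, map_mul, mul_smul]
      neg_mem' := fun {g} hg => inv g hg }
  have h1 : ((1, 0, 0) : ℤ × ℤ × ℤ) ∈ T := fun f hf => by
    change _ = substR r₁ • _
    rw [substR_r₁, shiftVar, add_smul]
    refine LSer.ext fun n => ?_
    rw [LSer.coeff_add, LSer.coeff_C_smul, LSer.coeff_var_smul, coeff_substD, coeff_substD,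
      coeff_substD, kz_smul_emb₂, ← map_add]
    refine congrArg emb₂ (Dist.ext fun a => ?_)
    rw [Pi.add_apply, ← subst_shift_left (hf a.2)]
    congr 1
    funext p q
    rw [Dist.mono_smul_apply]
    simp
  have h2 : ((0, 1, 0) : ℤ × ℤ × ℤ) ∈ T := fun f hf => by
    change _ = substR r₂ • _
    rw [substR_r₂]
    refine LSer.ext fun n => ?_
    rw [LSer.coeff_C_smul, coeff_substD, coeff_substD, kz_smul_emb₂]
    refine congrArg emb₂ (Dist.ext fun a => ?_)
    rw [← subst_shift_right]
    congr 1
    funext p q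
    rw [Dist.mono_smul_apply]
    simp
  have h3 : ((0, 0, 1) : ℤ × ℤ × ℤ) ∈ T := fun f hf => by
    change _ = substR rw' • _
    rw [substR_rw]
    refine LSer.ext fun n => ?_
    rw [LSer.coeff_C_smul, coeff_substD, coeff_substD, kw_smul_emb₂]
    refine congrArg emb₂ (Dist.ext fun a => ?_)
    congr 1
    funext p q
    rw [Dist.mono_smul_apply]
    simp
  have hT : ∀ g, g ∈ T := fun g => by
    have : g = g.1 • (1, 0, 0) + (g.2.1 • (0, 1, 0) + g.2.2 • (0, 0, 1)) := by
      ext <;> simp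
    rw [this]
    exact T.add_mem (T.zsmul_mem h1 _) (T.add_mem (T.zsmul_mem h2 _) (T.zsmul_mem h3 _))
  induction r using AddMonoidAlgebra.induction_on with
  | of g => exact hT g f hf
  | add s t hs ht =>
    rw [add_smul, substD_add (bddDist.smul_mem _ hf) (bddDist.smul_mem _ hf), hs, ht, map_add,
      add_smul]
  | smul c s hs =>
    rw [smul_assoc, substD_smul_complex (bddDist.smul_mem _ hf), hs, map_smul, smul_assoc]

/-- The graph of the substitution `z₁ = z₂ + z₃`, on the localization of `bddDist`. -/
def substRel : AddSubgroup (D3K V × LSer K2 (D2K V)) where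
  carrier := {v | ∃ g ∈ bddDist (V := V), ∃ s ∈ S3,
    algebraMap R3 A3 s • v.1 = emb₃ g ∧ substR s • v.2 = substD g}
  zero_mem' := ⟨0, bddDist.zero_mem, 1, S3.one_mem, by simp, by
    have h := substD_smul (V := V) bddDist.zero_mem 0
    rw [smul_zero, map_zero, zero_smul] at h
    simp [h]⟩
  add_mem' := by
    rintro ⟨d, ν⟩ ⟨d', ν'⟩ ⟨g, hg, s, hs, h1, h2⟩ ⟨g', hg', s', hs', h1', h2'⟩
    refine ⟨s' • g + s • g', bddDist.add_mem (bddDist.smul_mem _ hg) (bddDist.smul_mem _ hg'),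
      s * s', S3.mul_mem hs hs', ?_, ?_⟩
    · simp only [Prod.mk_add_mk, map_mul, map_add, emb₃_smul, ← h1, ← h1', smul_add, smul_smul,
        mul_comm]
    · rw [substD_add (bddDist.smul_mem _ hg) (bddDist.smul_mem _ hg'), substD_smul hg,
        substD_smul hg', ← h2, ← h2']
      simp only [Prod.mk_add_mk, map_mul, smul_add, smul_smul, mul_comm]
  neg_mem' := by
    rintro ⟨d, ν⟩ ⟨g, hg, s, hs, h1, h2⟩
    refine ⟨(-1 : R3) • g, bddDist.smul_mem _ hg, s, hs, ?_, ?_⟩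
    · rw [emb₃_smul, ← h1]; simp
    · rw [substD_smul hg, ← h2]; simp

theorem substRel_smul {d : D3K V} {ν : LSer K2 (D2K V)} (h : (d, ν) ∈ substRel) (r : R3) :
    (algebraMap R3 A3 r • d, substR r • ν) ∈ substRel := by
  obtain ⟨g, hg, s, hs, h1, h2⟩ := h
  refine ⟨r • g, bddDist.smul_mem _ hg, s, hs, ?_, ?_⟩
  · rw [emb₃_smul, ← h1, smul_comm]
  · rw [substD_smul hg, ← h2, smul_comm]

/-- Denominators in `S3` may be cancelled, as the definition of the relation already allows for one.
-/
theorem substRel_of_smul {d : D3K V} {ν : LSer K2 (D2K V)} {s : R3} (hs : s ∈ S3)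
    (h : (algebraMap R3 A3 s • d, substR s • ν) ∈ substRel) : (d, ν) ∈ substRel := by
  obtain ⟨g, hg, t, ht, h1, h2⟩ := h
  refine ⟨g, hg, t * s, S3.mul_mem ht hs, ?_, ?_⟩
  · rw [map_mul, mul_smul]; exact h1
  · rw [map_mul, mul_smul]; exact h2

theorem substRel_mk {g : Dist (ℤ × ℤ × ℤ) V} (hg : g ∈ bddDist) :
    (emb₃ g, substD g) ∈ substRel :=
  ⟨g, hg, 1, S3.one_mem, by simp, by simp⟩

/-- By linearity the first component may be taken to be zero. Then a bounded representative g is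
annihilated by some r in `S3`; its substitution is annihilated by the nonzero scalar `substR r`,
hence vanishes in a vector space over `LF K2`. -/
theorem substRel_functional {d : D3K V} {ν ν' : LSer K2 (D2K V)} (h : (d, ν) ∈ substRel)
    (h' : (d, ν') ∈ substRel) : ν = ν' := by
  have h0 := substRel.sub_mem h h'
  obtain ⟨g, hg, s, hs, h1, h2⟩ := h0
  simp only [Prod.mk_sub_mk, sub_self, smul_zero] at h1 h2
  obtain ⟨r, hr, h⟩ := emb₃_eq_zero.1 h1.symm
  have h3 := substD_smul hg r
  rw [h, ← h2] at h3
  have h4 := substD_smul (V := V) bddDist.zero_mem 0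
  rw [smul_zero, map_zero, zero_smul] at h4
  rw [h4, smul_smul] at h3
  have := (smul_eq_zero.1 h3.symm).resolve_left (mul_ne_zero (mem_S3.1 hr) (mem_S3.1 hs))
  exact sub_eq_zero.1 this

end ThreeVariables

/-! ## Divided powers and regular series -/

section DividedPowers

variable {M : Type*} [AddCommGroup M] [Module ℂ M]

/-- The divided power `Tⁿ / n!`, zero for negative `n`. -/
def divPow (T : M →ₗ[ℂ] M) (n : ℤ) : M →ₗ[ℂ] M :=
  if 0 ≤ n then ((n.toNat.factorial : ℂ)⁻¹) • T ^ n.toNat else 0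

theorem divPow_of_neg (T : M →ₗ[ℂ] M) {n : ℤ} (hn : n < 0) : divPow T n = 0 :=
  if_neg (by omega)

theorem divPow_natCast (T : M →ₗ[ℂ] M) (n : ℕ) :
    divPow T n = ((n.factorial : ℂ)⁻¹) • T ^ n := by
  simp [divPow]

@[simp] theorem divPow_zero (T : M →ₗ[ℂ] M) : divPow T 0 = LinearMap.id := by
  have h : divPow T 0 = ((Nat.factorial 0 : ℂ)⁻¹) • T ^ 0 := divPow_natCast T 0
  rw [h]
  simp only [Nat.factorial_zero, Nat.cast_one, inv_one, one_smul, pow_zero]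
  rfl

variable {L : Type*} [Field L] [Algebra ℂ L] [Module L M] [IsScalarTower ℂ L M]

theorem LSer.coeff_exp_eq (T : M →ₗ[ℂ] M) (v : M) (n : ℤ) :
    (LSer.exp T v : LSer L M).coeff n = divPow T n v := by
  rw [LSer.coeff_exp, divPow]
  split_ifs <;> rfl

end DividedPowers

section Regular

variable {L : Type*} [Field L] [Algebra ℂ L]
variable {M : Type*} [AddCommGroup M] [Module ℂ M] [Module L M] [IsScalarTower ℂ L M]

@[simp] theorem LF.coeff_C (a : L) (n : ℤ) : (LF.C a).coeff n = if n = 0 then a else 0 := by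
  change (HahnSeries.single 0 a : HahnSeries ℤ L).coeff n = _
  rw [HahnSeries.coeff_single]
  congr

@[simp] theorem LF.coeff_var (n : ℤ) : (LF.var L).coeff n = if n = 1 then 1 else 0 := by
  change (HahnSeries.single 1 1 : HahnSeries ℤ L).coeff n = _
  rw [HahnSeries.coeff_single]
  congr

@[simp] theorem LF.coeff_add (f g : LF L) (n : ℤ) : (f + g).coeff n = f.coeff n + g.coeff n :=
  rfl

@[simp] theorem LF.coeff_sub (f g : LF L) (n : ℤ) : (f - g).coeff n = f.coeff n - g.coeff n :=
  rfl

/-- A series without negative powers. -/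
def LSer.IsReg (f : LSer L M) : Prop := ∀ n < 0, f.coeff n = 0

/-- The lowest coefficient of the product is that of f multiplied by the constant term of a, which
is nonzero. -/
theorem LSer.IsReg.of_smul {a : LF L} {f : LSer L M} (ha : ∀ n < 0, a.coeff n = 0)
    (h0 : a.coeff 0 ≠ 0) (h : (a • f).IsReg) : f.IsReg := by
  by_contra hf
  unfold LSer.IsReg at hf
  push Not at hf
  obtain ⟨n, hn, hfn⟩ := hf
  obtain ⟨B, hB⟩ := f.exists_bound
  obtain ⟨v, hv, hmin⟩ := Int.exists_least_of_bdd (P := fun n => f.coeff n ≠ 0)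
    ⟨B, fun z hz => by by_contra hlt; exact hz (hB z (not_le.1 hlt))⟩ ⟨n, hfn⟩
  have hreg : (LF.var L ^ (-v) • f).IsReg := fun n hn => by
    rw [LSer.coeff_var_zpow_smul]
    by_contra hne
    have := hmin _ hne
    omega
  have h1 := (LSer.coeff_smul_of_nonneg ha hreg).2
  rw [smul_comm, LSer.coeff_var_zpow_smul, LSer.coeff_var_zpow_smul, zero_sub, neg_neg,
    h v (by have := hmin _ hfn; omega)] at h1
  exact (smul_ne_zero h0 hv) h1.symm

theorem LSer.IsReg.smul {a : LF L} {f : LSer L M} (ha : ∀ n < 0, a.coeff n = 0)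
    (h : f.IsReg) : (a • f).IsReg := (LSer.coeff_smul_of_nonneg ha h).1

end Regular

/-! ### Taylor expansion of X and braided commutativity modulo torsion. -/

section Basic

variable {V : Type*} [AddCommGroup V] [Module ℂ V] (Q : QuantumVertexAlgebra V)

namespace QuantumVertexAlgebra

/-- X has poles only along z₁ = 0 and z₁ = z₂, and both z₁ and z₁ - z₂ have an invertible constant
term as series in z₂. -/
theorem isReg_X (k : ℕ) (u : V ⊗[ℂ] V) : (Q.X k u).IsReg := by
  induction u with
  | zero => intro n _; simp
  | add u v hu hv => intro n hn; simp [hu n hn, hv n hn]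
  | tmul a b =>
    obtain ⟨N, hN⟩ := Q.singular k a b
    have h : ((x * (x - y)) ^ N • Q.X k (a ⊗ₜ b)).IsReg := fun n hn =>
      LSer.ext fun p => hN p n (Or.inr hn)
    clear hN
    induction N with
    | zero => simpa using h
    | succ N ih =>
      refine ih ?_
      rw [pow_succ', mul_assoc, mul_smul, mul_smul] at h
      have h1 := LSer.IsReg.of_smul (fun n hn => by simp [x, hn.ne]) (by simp [x, var_ne]) h
      exact LSer.IsReg.of_smul
        (fun n hn => by simp [x, y, hn.ne, show n ≠ 1 by omega]) (by simp [x, y, var_ne]) h1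

/-- Taylor's formula in z₂. Covariance computes the z₂-derivatives of X by inserting D, so that
X_{z₁,z₂}(a ⊗ b) = Y(a,z₁)e^{z₂D}b; regularity in z₂ disposes of negative exponents. -/
theorem coeff_X (k : ℕ) (a b : V) (n : ℤ) :
    (Q.X k (a ⊗ₜ b)).coeff n = vertexOp Q.X k a (divPow Q.D n b) := by
  have h : ∀ (n : ℕ) (b : V) (m : ℕ), (Q.X k (a ⊗ₜ (Q.D ^ n) b)).coeff m =
      (((m + n).factorial : ℂ) / m.factorial) • (Q.X k (a ⊗ₜ b)).coeff (m + n : ℕ) := by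
    intro n
    induction n with
    | zero =>
      intro b m
      have : (m.factorial : ℂ) ≠ 0 := by exact_mod_cast m.factorial_ne_zero
      simp [this]
    | succ n ih =>
      intro b m
      have h1 : (m.factorial : ℂ) ≠ 0 := by exact_mod_cast m.factorial_ne_zero
      have h2 : ((m : ℂ) + 1) ≠ 0 := by exact_mod_cast m.succ_ne_zero
      rw [pow_succ', Module.End.mul_apply, Q.covariance, LSer.coeff_deriv]
      have := ih b (m + 1)
      push_cast at this ⊢
      rw [this, smul_smul, show m + 1 + n = m + (n + 1) by ring, Nat.factorial_succ m,
        show (m : ℤ) + 1 + n = m + (n + 1) by ring]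
      congr 1
      push_cast
      field_simp
  by_cases hn : 0 ≤ n
  · obtain ⟨n, rfl⟩ := Int.eq_ofNat_of_zero_le hn
    have h1 : (n.factorial : ℂ) ≠ 0 := by exact_mod_cast n.factorial_ne_zero
    have := h n b 0
    rw [divPow_natCast, LinearMap.smul_apply, map_smul]
    change _ = _ • (Q.X k (a ⊗ₜ (Q.D ^ n) b)).coeff (0 : ℕ)
    rw [this, smul_smul]
    simp [h1]
  · rw [divPow_of_neg _ (not_le.1 hn), Q.isReg_X k _ n (not_le.1 hn)]
    simp

theorem cf_X (k : ℕ) (a b : V) (p q : ℤ) :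
    cf (Q.X k (a ⊗ₜ b)) p q = (vertexOp Q.X k a (divPow Q.D q b)).coeff p := by
  rw [cf, coeff_X]

/-- `v ⊗ c ↦ X_{z₂,w}(v ⊗ c)` as a distribution modulo torsion. -/
def XX (k : ℕ) : V ⊗[ℂ] V →ₗ[ℂ] D2K V := emb₂ ∘ₗ distX ∘ₗ Q.X k

/-- `c ⊗ v ↦ X_{w,z₂}(c ⊗ v)` as a distribution modulo torsion. -/
def XY (k : ℕ) : V ⊗[ℂ] V →ₗ[ℂ] D2K V := emb₂ ∘ₗ distY ∘ₗ Q.X k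

theorem comp_apply {U W : Type*} [AddCommGroup U] [Module ℂ U] [AddCommGroup W] [Module ℂ W]
    {A : Type*} [CommRing A] [Algebra ℂ A] {L : Type*} [Field L] [Algebra ℂ L]
    {M : Type*} [AddCommGroup M] [Module ℂ M] [Module L M] [IsScalarTower ℂ L M]
    (φ : ℕ → W →ₗ[ℂ] M) (ev : A →ₐ[ℂ] L) (S : ℕ → U →ₗ[ℂ] A ⊗[ℂ] W) (k : ℕ) (u : U) :
    comp φ ev S k u = ∑ ij ∈ antidiagonal k, evLift ev (φ ij.1) (S ij.2 u) := by
  rw [comp, LinearMap.sum_apply]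
  rfl

/-- Braided commutativity modulo torsion. -/
theorem XX_eq (k : ℕ) (v c : V) :
    Q.XX k (v ⊗ₜ c) = ∑ ij ∈ antidiagonal k, evLift evK (Q.XY ij.1) (Q.Sτ ij.2 (c ⊗ₜ v)) := by
  have h1 : ∑ ij ∈ antidiagonal k, evLift evK (Q.XY ij.1) (Q.Sτ ij.2 (c ⊗ₜ v)) =
      emb₂ (distY (comp Q.X ι Q.Sτ k (c ⊗ₜ v))) := by
    rw [comp_apply, map_sum, map_sum]
    refine Finset.sum_congr rfl fun ij _ => ?_
    exact (map_evLift (ev := ι) (ev' := evK) (emb₂ ∘ₗ distY) emb₂_distY_smul _ _).symm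
  obtain ⟨N, hN⟩ := Q.braided_comm k v c
  rw [h1, XX, LinearMap.comp_apply, LinearMap.comp_apply, ← sub_eq_zero, ← map_sub,
    -- The axiom holds after multiplication by a power of z₂ - w, which is the required annihilator.
    emb₂_eq_zero]
  refine ⟨(mono (1, 0) - mono (0, 1)) ^ N, ?_, ?_⟩
  · intro h0
    have := congrArg (evR2 x y x_ne y_ne) h0
    rw [map_pow, map_sub, evR2_mono, evR2_mono, map_zero] at this
    simp only [zpow_one, zpow_zero, mul_one, one_mul] at this
    exact pow_ne_zero N x_sub_y_ne this
  · rw [smul_sub, ← distX_smul, ← distY_smul, sub_eq_zero, map_pow, map_sub, map_pow, map_sub]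
    simp only [evR2_mono, zpow_one, zpow_zero, mul_one, one_mul]
    exact Dist.ext fun a => hN a.1 a.2

end QuantumVertexAlgebra

end Basic

/-! ## The product `Y(a, z₁) X_{z₂,w}(b ⊗ c)` -/

theorem map_pow_smul {N N' : Type*} [AddCommGroup N] [AddCommGroup N'] {B B' : Type*}
    [CommRing B] [CommRing B'] [Module B N] [Module B' N'] (j : N → N') {b : B} {b' : B'}
    (h : ∀ v, j (b • v) = b' • j v) (n : ℕ) (v : N) : j (b ^ n • v) = b' ^ n • j v := by
  induction n with
  | zero => simp
  | succ n ih => rw [pow_succ', mul_smul, h, ih, pow_succ', mul_smul]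

theorem r₁_smul_apply {V : Type*} [AddCommGroup V] [Module ℂ V] (f : Dist (ℤ × ℤ × ℤ) V)
    (l m r : ℤ) : (r₁ • f) (l, m, r) = f (l - 1, m, r) := by
  rw [r₁, Dist.mono_smul_apply]; simp

theorem r₂_smul_apply {V : Type*} [AddCommGroup V] [Module ℂ V] (f : Dist (ℤ × ℤ × ℤ) V)
    (l m r : ℤ) : (r₂ • f) (l, m, r) = f (l, m - 1, r) := by
  rw [r₂, Dist.mono_smul_apply]; simp

theorem rw'_smul_apply {V : Type*} [AddCommGroup V] [Module ℂ V] (f : Dist (ℤ × ℤ × ℤ) V)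
    (l m r : ℤ) : (rw' • f) (l, m, r) = f (l, m, r - 1) := by
  rw [rw', Dist.mono_smul_apply]; simp

theorem emb₃_eq_of_smul {V : Type*} [AddCommGroup V] [Module ℂ V] {f g : Dist (ℤ × ℤ × ℤ) V}
    {r : R3} (hr : r ∈ S3) (h : r • f = r • g) : emb₃ f = emb₃ g := by
  rw [← sub_eq_zero, ← map_sub, emb₃_eq_zero]
  exact ⟨r, hr, by rw [smul_sub, h, sub_self]⟩

theorem r₁_mem : r₁ ∈ S3 := by
  rw [mem_S3, substR_r₁]; exact shiftVar_ne

theorem r₂_mem : r₂ ∈ S3 := by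
  rw [mem_S3, substR_r₂]; exact C_ne kz_ne

theorem rw'_mem : rw' ∈ S3 := by
  rw [mem_S3, substR_rw]; exact C_ne kw_ne

/-- The poles met when c is moved to the left, at z₂ = w and z₁ = w, stay nonzero under z₁ = z₂ +
z₃, so they are legitimate denominators in `A3`. -/
theorem r₂_sub_rw'_mem : r₂ - rw' ∈ S3 := by
  rw [mem_S3, map_sub, substR_r₂, substR_rw, ← map_sub]
  refine C_ne ?_
  rw [← neg_sub]
  exact neg_ne_zero.2 kw_sub_kz_ne

theorem r₁_sub_rw'_mem : r₁ - rw' ∈ S3 := by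
  rw [mem_S3, map_sub, substR_r₁, substR_rw, shiftVar, add_sub_right_comm, ← map_sub]
  exact C_add_var_ne _

theorem isUnit_A3 {r : R3} (hr : r ∈ S3) : IsUnit (algebraMap R3 A3 r) :=
  IsLocalization.map_units A3 (⟨r, hr⟩ : S3)

/-- The evaluation `(τ₁, τ₂) = (w, z₁)`. -/
def evA₁ : Aτ →ₐ[ℂ] A3 := evτ' (algebraMap R3 A3 rw') (algebraMap R3 A3 r₁) (by
  rw [← map_sub, ← neg_sub, map_neg]
  exact ((isUnit_A3 rw'_mem).mul (isUnit_A3 r₁_mem)).mul (isUnit_A3 r₁_sub_rw'_mem).neg)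

/-- The evaluation `(τ₁, τ₂) = (w, z₂)`. -/
def evA₂ : Aτ →ₐ[ℂ] A3 := evτ' (algebraMap R3 A3 rw') (algebraMap R3 A3 r₂) (by
  rw [← map_sub, ← neg_sub, map_neg]
  exact ((isUnit_A3 rw'_mem).mul (isUnit_A3 r₂_mem)).mul (isUnit_A3 r₂_sub_rw'_mem).neg)

section

variable {V : Type*} [AddCommGroup V] [Module ℂ V] (Q : QuantumVertexAlgebra V)

namespace QuantumVertexAlgebra

/-- `Y(a, z₁) f` for `f ∈ V((z₂))((w))`. -/
def prodX (i : ℕ) (a : V) : V2 V →ₗ[ℂ] Dist (ℤ × ℤ × ℤ) V where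
  toFun f := fun t => (vertexOp Q.X i a (cf f t.2.1 t.2.2)).coeff t.1
  map_add' f g := by ext t; simp
  map_smul' r f := by ext t; simp

/-- `Y(a, z₁) f` for `f ∈ V((w))((z₂))`. -/
def prodY (i : ℕ) (a : V) : V2 V →ₗ[ℂ] Dist (ℤ × ℤ × ℤ) V where
  toFun f := fun t => (vertexOp Q.X i a (cf f t.2.2 t.2.1)).coeff t.1
  map_add' f g := by ext t; simp
  map_smul' r f := by ext t; simp

/-- `Y(c, w) f` for `f ∈ V((z₁))((z₂))`. -/
def prodW (i : ℕ) : V →ₗ[ℂ] V2 V →ₗ[ℂ] Dist (ℤ × ℤ × ℤ) V :=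
  LinearMap.mk₂ ℂ (fun c f => fun t => (vertexOp Q.X i c (cf f t.1 t.2.1)).coeff t.2.2)
    (fun _ _ _ => by ext t; simp) (fun _ _ _ => by ext t; simp) (fun _ _ _ => by ext t; simp)
    (fun _ _ _ => by ext t; simp)

theorem prodX_apply (i : ℕ) (a : V) (f : V2 V) (l m r : ℤ) :
    Q.prodX i a f (l, m, r) = (vertexOp Q.X i a (cf f m r)).coeff l := rfl
theorem prodY_apply (i : ℕ) (a : V) (f : V2 V) (l m r : ℤ) :
    Q.prodY i a f (l, m, r) = (vertexOp Q.X i a (cf f r m)).coeff l := rfl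
theorem prodW_apply (i : ℕ) (c : V) (f : V2 V) (l m r : ℤ) :
    Q.prodW i c f (l, m, r) = (vertexOp Q.X i c (cf f l m)).coeff r := rfl

/-- `c ⊗ u ↦ Y(c, w) X_{z₁,z₂}(u)`. -/
def YX (k : ℕ) : V ⊗[ℂ] (V ⊗[ℂ] V) →ₗ[ℂ] D3K V :=
  ∑ ij ∈ antidiagonal k, emb₃ ∘ₗ TensorProduct.lift ((Q.prodW ij.1).compl₂ (Q.X ij.2))

theorem YX_tmul (k : ℕ) (c : V) (u : V ⊗[ℂ] V) :
    Q.YX k (c ⊗ₜ u) = ∑ ij ∈ antidiagonal k, emb₃ (Q.prodW ij.1 c (Q.X ij.2 u)) := by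
  simp [YX, LinearMap.sum_apply]

/-- Braided commutativity of b and c, applied coefficientwise under Y(a,z₁). The power of z₂ - w it
requires is invertible in `A3`. -/
theorem prodX_X (i j : ℕ) (a b c : V) :
    emb₃ (Q.prodX i a (Q.X j (b ⊗ₜ c))) =
      ∑ st ∈ antidiagonal j,
        evLift evA₂ (emb₃ ∘ₗ Q.prodY i a ∘ₗ Q.X st.1) (Q.Sτ st.2 (c ⊗ₜ b)) := by
  have hx : ∀ v, Q.prodX i a ((x - y) • v) = (r₂ - rw') • Q.prodX i a v := fun v => by
    ext ⟨l, m, r⟩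
    rw [sub_smul, map_sub, sub_smul, Pi.sub_apply, Pi.sub_apply, r₂_smul_apply, rw'_smul_apply]
    simp only [prodX_apply, cf_x_smul, cf_y_smul]
  have hy₁ : ∀ v, Q.prodY i a (x • v) = rw' • Q.prodY i a v := fun v => by
    ext ⟨l, m, r⟩
    rw [rw'_smul_apply]
    simp only [prodY_apply, cf_x_smul]
  have hy₂ : ∀ v, Q.prodY i a (y • v) = r₂ • Q.prodY i a v := fun v => by
    ext ⟨l, m, r⟩
    rw [r₂_smul_apply]
    simp only [prodY_apply, cf_y_smul]
  have hy : ∀ v, Q.prodY i a ((y - x) • v) = (r₂ - rw') • Q.prodY i a v := fun v => by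
    rw [sub_smul, map_sub, sub_smul, hy₁, hy₂]
  obtain ⟨N, hN⟩ := Q.braided_comm j b c
  have h1 : ∑ st ∈ antidiagonal j,
        evLift evA₂ (emb₃ ∘ₗ Q.prodY i a ∘ₗ Q.X st.1) (Q.Sτ st.2 (c ⊗ₜ b)) =
      emb₃ (Q.prodY i a (comp Q.X ι Q.Sτ j (c ⊗ₜ b))) := by
    rw [comp_apply, map_sum, map_sum]
    refine Finset.sum_congr rfl fun st _ => ?_
    refine (map_evLift (ev := ι) (ev' := evA₂) (emb₃ ∘ₗ Q.prodY i a) ?_ _ _).symm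
    refine Aτ.map_smul _ (fun v => ?_) fun v => ?_
    · simp only [ι, evA₂, evτ_τ₁, evτ'_τ₁, LinearMap.comp_apply, hy₁, emb₃_smul]
    · simp only [ι, evA₂, evτ_τ₂, evτ'_τ₂, LinearMap.comp_apply, hy₂, emb₃_smul]
  rw [h1]
  refine emb₃_eq_of_smul (S3.pow_mem r₂_sub_rw'_mem N) ?_
  rw [← map_pow_smul _ hx, ← map_pow_smul _ hy]
  ext ⟨l, m, r⟩
  rw [prodX_apply, prodY_apply, hN]

/-- `m ↦ Y(·, z) Y(·, w) Dᵐ b / m!`. -/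
def prodFam (b : V) (n : ℕ) : V ⊗[ℂ] V →ₗ[ℂ] (ℤ → V2 V) :=
  LinearMap.pi fun m => prodOp Q.X (divPow Q.D m b) n

theorem prodOp_apply (c a b : V) (k : ℕ) (p q : ℤ) :
    cf (prodOp Q.X c k (a ⊗ₜ b)) p q =
      ∑ ij ∈ antidiagonal k,
        (vertexOp Q.X ij.1 a ((vertexOp Q.X ij.2 b c).coeff q)).coeff p := by
  rw [prodOp, LinearMap.sum_apply, cf_sum]
  rfl

/-- Families in `V((z₁))((w))` indexed by the exponent of `z₂`, as distributions. -/
def famX : (ℤ → V2 V) →ₗ[ℂ] Dist (ℤ × ℤ × ℤ) V where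
  toFun f := fun t => cf (f t.2.1) t.1 t.2.2
  map_add' f g := by ext t; simp
  map_smul' r f := by ext t; simp

/-- Families in `V((w))((z₁))` indexed by the exponent of `z₂`, as distributions. -/
def famY : (ℤ → V2 V) →ₗ[ℂ] Dist (ℤ × ℤ × ℤ) V where
  toFun f := fun t => cf (f t.2.1) t.2.2 t.1
  map_add' f g := by ext t; simp
  map_smul' r f := by ext t; simp

theorem famX_apply (f : ℤ → V2 V) (l m r : ℤ) : famX f (l, m, r) = cf (f m) l r := rfl
theorem famY_apply (f : ℤ → V2 V) (l m r : ℤ) : famY f (l, m, r) = cf (f m) r l := rfl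

theorem famX_sub_smul (v : ℤ → V2 V) : famX ((x - y) • v) = (r₁ - rw') • famX v := by
  ext ⟨l, m, r⟩
  rw [sub_smul, map_sub, sub_smul, Pi.sub_apply, Pi.sub_apply, r₁_smul_apply, rw'_smul_apply]
  simp only [famX_apply, Pi.smul_apply, cf_x_smul, cf_y_smul]

theorem famY_x_smul (v : ℤ → V2 V) : famY (x • v) = rw' • famY v := by
  ext ⟨l, m, r⟩
  rw [rw'_smul_apply]
  simp only [famY_apply, Pi.smul_apply, cf_x_smul]

theorem famY_y_smul (v : ℤ → V2 V) : famY (y • v) = r₁ • famY v := by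
  ext ⟨l, m, r⟩
  rw [r₁_smul_apply]
  simp only [famY_apply, Pi.smul_apply, cf_y_smul]

theorem famY_sub_smul (v : ℤ → V2 V) : famY ((y - x) • v) = (r₁ - rw') • famY v := by
  rw [sub_smul, map_sub, sub_smul, famY_x_smul, famY_y_smul]

theorem emb₃_famY_smul (f : Aτ) (v : ℤ → V2 V) :
    emb₃ (famY (ι f • v)) = evA₁ f • emb₃ (famY v) :=
  Aτ.map_smul (ev := ι) (ev' := evA₁) (emb₃ ∘ₗ famY)
    (fun v => by
      simp only [ι, evA₁, evτ_τ₁, evτ'_τ₁, LinearMap.comp_apply, famY_x_smul, emb₃_smul])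
    (fun v => by
      simp only [ι, evA₁, evτ_τ₂, evτ'_τ₂, LinearMap.comp_apply, famY_y_smul, emb₃_smul]) f v

theorem sum_prodY_eq (n : ℕ) (a b c : V) :
    ∑ is ∈ antidiagonal n, Q.prodY is.1 a (Q.X is.2 (c ⊗ₜ b)) =
      famX (Q.prodFam b n (a ⊗ₜ c)) := by
  ext ⟨l, m, r⟩
  rw [Finset.sum_apply, famX_apply, prodFam, LinearMap.pi_apply, prodOp_apply]
  refine Finset.sum_congr rfl fun is _ => ?_
  rw [prodY_apply, cf_X]

theorem YX_eq_famY (n : ℕ) (a b c : V) :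
    Q.YX n (c ⊗ₜ (a ⊗ₜ b)) = emb₃ (famY (Q.prodFam b n (c ⊗ₜ a))) := by
  rw [YX_tmul, ← map_sum]
  refine congrArg emb₃ ?_
  ext ⟨l, m, r⟩
  rw [Finset.sum_apply, famY_apply, prodFam, LinearMap.pi_apply, prodOp_apply]
  refine Finset.sum_congr rfl fun is _ => ?_
  rw [prodW_apply, cf_X]

theorem evLift_YX (n : ℕ) (b : V) (s : Aτ ⊗[ℂ] (V ⊗[ℂ] V)) :
    evLift evA₁ (Q.YX n ∘ₗ ins₁₂ b) s = emb₃ (famY (evLift ι (Q.prodFam b n) s)) := by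
  have h : Q.YX n ∘ₗ ins₁₂ b = (emb₃ ∘ₗ famY) ∘ₗ Q.prodFam b n :=
    TensorProduct.ext' fun c a => Q.YX_eq_famY n a b c
  rw [h]
  exact (map_evLift (ev := ι) (ev' := evA₁) (emb₃ ∘ₗ famY) emb₃_famY_smul _ _).symm

theorem evLift_prodFam (n : ℕ) (b : V) (s : Aτ ⊗[ℂ] (V ⊗[ℂ] V)) (m : ℤ) :
    evLift ι (Q.prodFam b n) s m = evLift ι (prodOp Q.X (divPow Q.D m b) n) s := by
  induction s with
  | zero => simp
  | tmul f u => rw [evLift_tmul, evLift_tmul, Pi.smul_apply]; rfl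
  | add s t hs ht => rw [map_add, map_add, Pi.add_apply, hs, ht]

/-- Locality of a and c, applied to all vectors Dᵐb/m! simultaneously. This is possible because the
exponent in the locality axiom does not depend on the third vector, so one power of z₁ - w serves
for every exponent of z₂. -/
theorem sum_prodY_X (n : ℕ) (a b c : V) :
    ∑ is ∈ antidiagonal n, emb₃ (Q.prodY is.1 a (Q.X is.2 (c ⊗ₜ b))) =
      ∑ it ∈ antidiagonal n,
        evLift evA₁ (Q.YX it.1 ∘ₗ ins₁₂ b) (Q.Sτ it.2 (c ⊗ₜ a)) := by
  obtain ⟨N, hN⟩ := Q.locality a c (n + 1)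
  simp only [evLift_YX]
  rw [← map_sum, ← map_sum, ← map_sum, sum_prodY_eq]
  refine emb₃_eq_of_smul (S3.pow_mem r₁_sub_rw'_mem N) ?_
  refine (map_pow_smul (famX (V := V)) famX_sub_smul N _).symm.trans
    (Eq.trans ?_ (map_pow_smul (famY (V := V)) famY_sub_smul N _))
  ext ⟨l, m, r⟩
  have h : (∑ it ∈ antidiagonal n, evLift ι (Q.prodFam b it.1) (Q.Sτ it.2 (c ⊗ₜ a))) m =
      comp (prodOp Q.X (divPow Q.D m b)) ι Q.Sτ n (c ⊗ₜ a) := by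
    rw [Finset.sum_apply, comp_apply]
    exact Finset.sum_congr rfl fun it _ => Q.evLift_prodFam _ _ _ _
  have h' := hN (divPow Q.D m b) n (Nat.lt_succ_self n) l r
  rw [← h] at h'
  exact h'

/-- Moving `c` through the product by braided commutativity and locality. -/
theorem sum_prodX_X (k : ℕ) (a b c : V) :
    ∑ ij ∈ antidiagonal k, emb₃ (Q.prodX ij.1 a (Q.X ij.2 (b ⊗ₜ c))) =
      nest Q.Sτ evA₁ evA₂ Q.YX k (c ⊗ₜ (a ⊗ₜ b)) := by
  have h1 : ∀ n, ∑ is ∈ antidiagonal n, emb₃ ∘ₗ Q.prodY is.1 a ∘ₗ Q.X is.2 =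
      ∑ it ∈ antidiagonal n, (evLift evA₁ (Q.YX it.1) ∘ₗ braid₁₂ (Q.Sτ it.2)) ∘ₗ ins₁₃ a := by
    intro n
    ext c' b'
    simp only [LinearMap.sum_apply, TensorProduct.AlgebraTensorModule.curry_apply,
      TensorProduct.curry_apply, LinearMap.restrictScalars_apply, LinearMap.comp_apply,
      ins₁₃_tmul, braid₁₂_tmul, evLift_lTensor]
    exact Q.sum_prodY_X n a b' c'
  simp only [prodX_X]
  -- The t-degrees are regrouped so that the product with a and the inner X are summed together;
  -- only this combined sum is governed by locality.
  rw [← sum_antidiagonal_assoc (fun i s t =>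
    evLift evA₂ (emb₃ ∘ₗ Q.prodY i a ∘ₗ Q.X s) (Q.Sτ t (c ⊗ₜ b)))]
  simp only [← evLift_sum, h1]
  simp only [evLift_sum]
  rw [sum_antidiagonal_assoc (fun i s t =>
    evLift evA₂ ((evLift evA₁ (Q.YX i) ∘ₗ braid₁₂ (Q.Sτ s)) ∘ₗ ins₁₃ a) (Q.Sτ t (c ⊗ₜ b))),
    nest_apply]
  refine Finset.sum_congr rfl fun ij _ => Finset.sum_congr rfl fun pq _ => ?_
  rw [braid₁₃_tmul, evLift_lTensor]

end QuantumVertexAlgebra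

end

open Filter

/-! ## Exponentials acting on series -/

section Exponential

variable {M : Type*} [AddCommGroup M] [Module ℂ M]

theorem divPow_add {S T : M →ₗ[ℂ] M} (h : Commute S T) (n : ℕ) :
    divPow (S + T) n = ∑ j ∈ Finset.range (n + 1), divPow S j * divPow T ((n - j : ℕ) : ℤ) := by
  rw [divPow_natCast, h.add_pow, Finset.smul_sum]
  refine Finset.sum_congr rfl fun j hj => ?_
  have hj' : j ≤ n := Nat.lt_succ_iff.1 (Finset.mem_range.1 hj)
  rw [divPow_natCast, divPow_natCast, smul_mul_smul_comm, ← nsmul_eq_mul', ← Nat.cast_smul_eq_nsmul ℂ,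
    smul_smul]
  congr 1
  rw [Nat.cast_choose ℂ hj']
  have h1 : (n.factorial : ℂ) ≠ 0 := by exact_mod_cast n.factorial_ne_zero
  have h2 : (j.factorial : ℂ) ≠ 0 := by exact_mod_cast j.factorial_ne_zero
  have h3 : ((n - j).factorial : ℂ) ≠ 0 := by exact_mod_cast (n - j).factorial_ne_zero
  field_simp

theorem finsum_divPow {S T : M →ₗ[ℂ] M} (h : Commute S T) (n : ℤ) (v : M) :
    ∑ᶠ j : ℕ, divPow S j (divPow T (n - j) v) = divPow (S + T) n v := by
  by_cases hn : 0 ≤ n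
  · obtain ⟨n, rfl⟩ := Int.eq_ofNat_of_zero_le hn
    rw [divPow_add h, LinearMap.sum_apply,
      finsum_eq_sum_of_support_subset (s := Finset.range (n + 1))]
    · refine Finset.sum_congr rfl fun j hj => ?_
      rw [Nat.cast_sub (Nat.lt_succ_iff.1 (Finset.mem_range.1 hj))]
      rfl
    · intro j hj
      by_contra hlt
      simp only [Finset.coe_range, Set.mem_Iio, not_lt] at hlt
      exact hj (by
        change divPow S j (divPow T (n - j) v) = 0
        rw [divPow_of_neg T (show (n : ℤ) - j < 0 by omega)]; simp)
  · rw [divPow_of_neg _ (not_le.1 hn)]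
    refine (finsum_congr fun j => ?_).trans finsum_zero
    rw [divPow_of_neg T (show n - (j : ℤ) < 0 by omega)]; simp

theorem divPow_comp {N : Type*} [AddCommGroup N] [Module ℂ N] {S : M →ₗ[ℂ] M} {T : N →ₗ[ℂ] N}
    (φ : M → N) (hφ : ∀ (r : ℂ) v, φ (r • v) = r • φ v) (h0 : φ 0 = 0)
    (h : ∀ v, φ (S v) = T (φ v)) (n : ℤ) (v : M) :
    φ (divPow S n v) = divPow T n (φ v) := by
  unfold divPow
  split_ifs with hn
  · rw [LinearMap.smul_apply, LinearMap.smul_apply, hφ]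
    congr 1
    generalize n.toNat = m
    induction m generalizing v with
    | zero => rfl
    | succ m ih => rw [pow_succ, pow_succ, Module.End.mul_apply, Module.End.mul_apply, ih, h]
  · exact h0

theorem divPow_succ (T : M →ₗ[ℂ] M) (n : ℕ) (v : M) :
    divPow T ((n + 1 : ℕ) : ℤ) v = ((n : ℂ) + 1)⁻¹ • T (divPow T n v) := by
  rw [divPow_natCast, divPow_natCast, LinearMap.smul_apply, LinearMap.smul_apply, map_smul,
    smul_smul, pow_succ', Nat.factorial_succ]
  push_cast
  rw [mul_inv]
  rfl

/-- The commutation rule `e^{yT} ξ = (ξ + y) e^{yT}` when `[T, ξ] = 1`. -/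
theorem divPow_leibniz {T : M →ₗ[ℂ] M} (ξ : M → M) (hξ : ∀ (r : ℂ) v, ξ (r • v) = r • ξ v)
    (h : ∀ v, T (ξ v) = ξ (T v) + v) (n : ℤ) (v : M) :
    divPow T n (ξ v) = ξ (divPow T n v) + divPow T (n - 1) v := by
  by_cases hn : 0 ≤ n
  · obtain ⟨n, rfl⟩ := Int.eq_ofNat_of_zero_le hn
    clear hn
    induction n with
    | zero =>
      rw [divPow_of_neg T (show ((0 : ℕ) : ℤ) - 1 < 0 by simp), Nat.cast_zero, divPow_zero]
      simp
    | succ n ih =>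
      have h1 : ((n : ℂ) + 1) ≠ 0 := by exact_mod_cast n.succ_ne_zero
      rw [divPow_succ, ih, divPow_succ, hξ, map_add, h, add_assoc, smul_add]
      congr 1
      rw [Nat.cast_succ, add_sub_cancel_right]
      rcases n with _ | n
      · simp [divPow_of_neg]
      · have h2 : ((n : ℂ) + 1) ≠ 0 := by exact_mod_cast n.succ_ne_zero
        have h3 : T (divPow T (((n + 1 : ℕ) : ℤ) - 1) v) =
            ((n : ℂ) + 1) • divPow T ((n + 1 : ℕ) : ℤ) v := by
          rw [divPow_succ, smul_smul, mul_inv_cancel₀ h2, one_smul, Nat.cast_succ,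
            add_sub_cancel_right]
        rw [h3]
        nth_rewrite 1 [← one_smul ℂ (divPow T ((n + 1 : ℕ) : ℤ) v)]
        rw [← add_smul, smul_smul]
        push_cast at h1 ⊢
        rw [show (1 : ℂ) + (n + 1) = n + 1 + 1 by ring, inv_mul_cancel₀ h1, one_smul]
  · rw [divPow_of_neg _ (not_le.1 hn), divPow_of_neg _ (show n - 1 < 0 by omega)]
    have h0 : ξ 0 = 0 := by simpa using hξ 0 0
    simp [h0]

variable {L : Type*} [Field L] [Algebra ℂ L] [Module L M] [IsScalarTower ℂ L M]
variable {L' : Type*} [Field L'] [Algebra ℂ L']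
variable {M' : Type*} [AddCommGroup M'] [Module ℂ M'] [Module L' M'] [IsScalarTower ℂ L' M']

theorem LSer.finite_expExt (T : M →ₗ[ℂ] M) (f : LSer L M) (n : ℤ) :
    (Function.support fun j : ℕ => divPow T j (f.coeff (n - j))).Finite := by
  obtain ⟨B, hB⟩ := f.exists_bound
  refine (Set.finite_Iic (n - B).toNat).subset fun j hj => ?_
  by_contra hlt
  rw [Set.mem_Iic, not_le] at hlt
  exact hj (by
    change divPow T j (f.coeff (n - j)) = 0
    rw [hB _ (by omega), map_zero])

/-- The operator `e^{yT}` on `M((y))`. -/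
def LSer.expExt (T : M →ₗ[ℂ] M) : LSer L M →ₗ[ℂ] LSer L M where
  toFun f := LSer.ofFun (fun n => ∑ᶠ j : ℕ, divPow T j (f.coeff (n - j)))
    (Classical.choose f.exists_bound) fun n hn => by
      refine (finsum_congr fun j => ?_).trans finsum_zero
      rw [Classical.choose_spec f.exists_bound _ (by omega), map_zero]
  map_add' f g := by
    refine LSer.ext fun n => ?_
    simp only [LSer.coeff_ofFun, LSer.coeff_add, map_add]
    exact finsum_add_distrib (LSer.finite_expExt T f n) (LSer.finite_expExt T g n)
  map_smul' r f := by
    refine LSer.ext fun n => ?_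
    simp only [LSer.coeff_ofFun, LSer.coeff_smul, map_smul, RingHom.id_apply]
    exact (smul_finsum r _).symm

theorem LSer.coeff_expExt (T : M →ₗ[ℂ] M) (f : LSer L M) (n : ℤ) :
    (LSer.expExt T f).coeff n = ∑ᶠ j : ℕ, divPow T j (f.coeff (n - j)) := rfl

theorem LSer.expExt_exp {S T : M →ₗ[ℂ] M} (h : Commute S T) (v : M) :
    LSer.expExt S (LSer.exp T v : LSer L M) = LSer.exp (S + T) v := by
  refine LSer.ext fun n => ?_
  simp only [LSer.coeff_expExt, LSer.coeff_exp_eq]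
  exact finsum_divPow h n v

theorem LSer.expExt_const (T : M →ₗ[ℂ] M) (v : M) :
    LSer.expExt T (LSer.const v : LSer L M) = LSer.exp T v := by
  refine LSer.ext fun n => ?_
  rw [LSer.coeff_expExt, LSer.coeff_exp_eq]
  by_cases hn : 0 ≤ n
  · obtain ⟨n, rfl⟩ := Int.eq_ofNat_of_zero_le hn
    rw [finsum_eq_single _ n]
    · simp
    · intro j hj
      rw [LSer.coeff_const, if_neg (by omega), map_zero]
  · rw [divPow_of_neg _ (not_le.1 hn)]
    refine (finsum_congr fun j => ?_).trans finsum_zero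
    rw [LSer.coeff_const, if_neg (by omega), map_zero]

theorem LSer.expExt_var_smul (T : M →ₗ[ℂ] M) (f : LSer L M) :
    LSer.expExt T (LF.var L • f) = LF.var L • LSer.expExt T f := by
  refine LSer.ext fun n => ?_
  rw [LSer.coeff_var_smul, LSer.coeff_expExt, LSer.coeff_expExt]
  refine finsum_congr fun j => ?_
  rw [LSer.coeff_var_smul, sub_right_comm]

theorem LSer.map_expExt {S : M →ₗ[ℂ] M} {T : M' →ₗ[ℂ] M'} (φ : M →ₗ[ℂ] M')
    (h : ∀ v, φ (S v) = T (φ v)) (f : LSer L M) :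
    LSer.map φ (LSer.expExt S f) = LSer.expExt T (LSer.map φ f : LSer L' M') := by
  refine LSer.ext fun n => ?_
  rw [LSer.coeff_map, LSer.coeff_expExt, LSer.coeff_expExt,
    map_finsum φ (LSer.finite_expExt S f n)]
  exact finsum_congr fun j => divPow_comp φ (map_smul φ) (map_zero φ) h _ _

theorem LSer.expExt_C_smul {T : M →ₗ[ℂ] M} {a : L} (h : ∀ v, T (a • v) = a • T v)
    (f : LSer L M) : LSer.expExt T (LF.C a • f) = LF.C a • LSer.expExt T f := by
  refine LSer.ext fun n => ?_
  rw [LSer.coeff_C_smul, LSer.coeff_expExt, LSer.coeff_expExt,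
    smul_finsum' a (LSer.finite_expExt T f n)]
  refine finsum_congr fun j => ?_
  rw [LSer.coeff_C_smul]
  exact (divPow_comp (S := T) (T := T) (fun v => a • v) (fun r v => smul_comm _ _ _)
    (smul_zero a) (fun v => (h v).symm) _ _).symm

/-- e^{yT} is 1 plus terms of higher order in y, hence preserves the lowest coefficient of a series.
-/
theorem LSer.expExt_injective (T : M →ₗ[ℂ] M) :
    Function.Injective (LSer.expExt T : LSer L M →ₗ[ℂ] LSer L M) := by
  refine (injective_iff_map_eq_zero _).2 fun f hf => ?_
  by_contra hne
  obtain ⟨n, hn⟩ : ∃ n, f.coeff n ≠ 0 := by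
    by_contra! h
    exact hne (LSer.ext fun n => by rw [h n, LSer.coeff_zero])
  obtain ⟨B, hB⟩ := f.exists_bound
  obtain ⟨v, hv, hmin⟩ := Int.exists_least_of_bdd (P := fun n => f.coeff n ≠ 0)
    ⟨B, fun z hz => by by_contra hlt; exact hz (hB z (not_le.1 hlt))⟩ ⟨n, hn⟩
  refine hv ?_
  have h := congrArg (fun g => LSer.coeff g v) hf
  simp only [LSer.coeff_expExt, LSer.coeff_zero] at h
  rw [finsum_eq_single _ 0] at h
  · simpa using h
  · intro j hj
    have : f.coeff (v - j) = 0 := by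
      by_contra h'
      have := hmin _ h'
      omega
    rw [this, map_zero]

end Exponential

/-! ## Broken translation covariance -/

section Operators

variable {W : Type*} [AddCommGroup W] [Module ℂ W]

/-- The operator `∂₁ + ∂₂`. -/
abbrev tot : V2 W →ₗ[ℂ] V2 W := LSer.map LSer.deriv + LSer.deriv

/-- `D` acting on coefficients. -/
abbrev map₂D (D : W →ₗ[ℂ] W) : V2 W →ₗ[ℂ] V2 W := LSer.map (LSer.map D)

/-- The operator `∂₁ + ∂₂ - D`. -/
abbrev nab (D : W →ₗ[ℂ] W) : V2 W →ₗ[ℂ] V2 W := tot - map₂D D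

theorem cf_tot (f : V2 W) (p q : ℤ) :
    cf (tot f) p q = ((p : ℂ) + 1) • cf f (p + 1) q + ((q : ℂ) + 1) • cf f p (q + 1) := by
  simp only [cf, LinearMap.add_apply, LSer.coeff_add, LSer.coeff_map, LSer.coeff_deriv,
    LSer.coeff_smul]

theorem cf_map₂D (D : W →ₗ[ℂ] W) (f : V2 W) (p q : ℤ) :
    cf (map₂D D f) p q = D (cf f p q) := rfl

theorem commute_tot_map₂D (D : W →ₗ[ℂ] W) : Commute (map₂D D) tot := by
  refine LinearMap.ext fun f => V2.ext fun p q => ?_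
  rw [Module.End.mul_apply, Module.End.mul_apply, cf_map₂D, cf_tot, cf_tot, cf_map₂D, cf_map₂D]
  simp

/-- Gives e^{γD}e^{γ(∂₁+∂₂-D)} = e^{γ(∂₁+∂₂)}, the factorization that allows e^{γD} to be cancelled
in the translation axiom. -/
theorem commute_nab (D : W →ₗ[ℂ] W) : Commute (map₂D D) (nab D) :=
  (commute_tot_map₂D D).sub_right (Commute.refl _)

theorem map₂D_x_smul (D : W →ₗ[ℂ] W) (f : V2 W) : map₂D D (x • f) = x • map₂D D f :=
  V2.ext fun p q => by rw [cf_map₂D, cf_x_smul, cf_x_smul, cf_map₂D]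

theorem map₂D_y_smul (D : W →ₗ[ℂ] W) (f : V2 W) : map₂D D (y • f) = y • map₂D D f :=
  V2.ext fun p q => by rw [cf_map₂D, cf_y_smul, cf_y_smul, cf_map₂D]

theorem isReg_nab (D : W →ₗ[ℂ] W) {f : V2 W} (h : f.IsReg) : (nab D f).IsReg := by
  intro n hn
  simp only [LinearMap.sub_apply, LinearMap.add_apply, LSer.coeff_sub, LSer.coeff_add,
    LSer.coeff_map, LSer.coeff_deriv, h n hn, map_zero, sub_zero, zero_add]
  by_cases h1 : n + 1 < 0
  · rw [h _ h1, smul_zero]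
  -- Only the exponent -1 could receive a contribution from a regular series, and there the factor n
  -- + 1 is zero.
  · have : n = -1 := by omega
    subst this
    simp

theorem LSer.IsReg.divPow {L M : Type*} [Field L] [Algebra ℂ L] [AddCommGroup M] [Module ℂ M]
    [Module L M] [IsScalarTower ℂ L M] {T : LSer L M →ₗ[ℂ] LSer L M}
    (hT : ∀ f, f.IsReg → (T f).IsReg) {f : LSer L M} (h : f.IsReg) (n : ℤ) :
    (divPow T n f).IsReg := by
  unfold HDQ.divPow
  split_ifs
  · have : ∀ m : ℕ, ((T ^ m) f).IsReg := by
      intro m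
      induction m with
      | zero => exact h
      | succ m ih => rw [pow_succ', Module.End.mul_apply]; exact hT _ ih
    intro n hn
    rw [LinearMap.smul_apply, LSer.coeff_smul, this _ n hn, smul_zero]
  · intro n _
    simp

end Operators

/-! ### Denominators of the translation map. -/

section TranslationAlgebra

/-- Polynomials in `(z₁, z₂, γ)`. -/
abbrev P3 := MvPolynomial (Fin 3) ℂ

/-- The denominator `z₁ (z₁ - z₂) (z₁ + γ)`. -/
def den : P3 :=
  MvPolynomial.X 0 * (MvPolynomial.X 0 - MvPolynomial.X 1) * (MvPolynomial.X 0 + MvPolynomial.X 2)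

variable {W : Type*} [AddCommGroup W] [Module ℂ W]

instance : IsLocalization.Away den Aγ := Localization.isLocalization

/-- Powers of the denominator clear the denominators of a tensor. -/
theorem exists_clear_den (s : Aγ ⊗[ℂ] W) : ∃ M₀, ∀ M ≥ M₀, ∃ ρ : P3 ⊗[ℂ] W,
    (algebraMap P3 Aγ den) ^ M • s = (Algebra.algHom ℂ P3 Aγ).toLinearMap.rTensor W ρ := by
  induction s with
  | zero => exact ⟨0, fun M _ => ⟨0, by simp⟩⟩
  | add s t hs ht =>
    obtain ⟨M₀, h⟩ := hs
    obtain ⟨M₁, h'⟩ := ht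
    refine ⟨max M₀ M₁, fun M hM => ?_⟩
    obtain ⟨ρ, hρ⟩ := h M (le_trans (le_max_left _ _) hM)
    obtain ⟨ρ', hρ'⟩ := h' M (le_trans (le_max_right _ _) hM)
    exact ⟨ρ + ρ', by rw [smul_add, hρ, hρ', map_add]⟩
  | tmul f w =>
    obtain ⟨M₀, p, hp⟩ := IsLocalization.Away.surj (S := Aγ) den f
    refine ⟨M₀, fun M hM => ⟨(den ^ (M - M₀) * p) ⊗ₜ w, ?_⟩⟩
    rw [TensorProduct.smul_tmul', LinearMap.rTensor_tmul]
    congr 1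
    change _ = algebraMap P3 Aγ (den ^ (M - M₀) * p)
    rw [map_mul, ← hp, map_pow, smul_eq_mul, mul_comm f, ← mul_assoc, ← pow_add,
      Nat.sub_add_cancel hM]

theorem evLift_rTensor {A A' B : Type*} [CommRing A] [Algebra ℂ A] [CommRing A'] [Algebra ℂ A']
    [CommRing B] [Algebra ℂ B] {N : Type*} [AddCommGroup N] [Module ℂ N] [Module B N]
    [IsScalarTower ℂ B N] (ev : A' →ₐ[ℂ] B) (j : A →ₐ[ℂ] A') (Φ : W →ₗ[ℂ] N) (s : A ⊗[ℂ] W) :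
    evLift ev Φ (j.toLinearMap.rTensor W s) = evLift (ev.comp j) Φ s := by
  induction s with
  | zero => simp
  | tmul f w => simp
  | add s t hs ht => simp only [map_add, hs, ht]

/-- A relation stable under the variables is stable under polynomials. -/
theorem P3.smul_mem {B B' N N' : Type*} [CommRing B] [Algebra ℂ B] [CommRing B'] [Algebra ℂ B']
    [AddCommGroup N] [Module ℂ N] [Module B N] [IsScalarTower ℂ B N]
    [AddCommGroup N'] [Module ℂ N'] [Module B' N'] [IsScalarTower ℂ B' N']
    (ev : P3 →ₐ[ℂ] B) (ev' : P3 →ₐ[ℂ] B') (T : Submodule ℂ (N × N'))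
    (h : ∀ i v, v ∈ T → (ev (MvPolynomial.X i) • v.1, ev' (MvPolynomial.X i) • v.2) ∈ T)
    (f : P3) : ∀ v, v ∈ T → (ev f • v.1, ev' f • v.2) ∈ T := by
  induction f using MvPolynomial.induction_on with
  | C r =>
    intro v hv
    have h1 := ev.commutes r
    have h2 := ev'.commutes r
    rw [MvPolynomial.algebraMap_eq] at h1 h2
    rw [h1, h2, algebraMap_smul, algebraMap_smul]
    exact T.smul_mem r hv
  | add p q hp hq =>
    intro v hv
    simpa [add_smul] using T.add_mem (hp v hv) (hq v hv)
  | mul_X p i hp =>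
    intro v hv
    simpa [mul_smul] using hp _ (h i v hv)

theorem evγ_X {L : Type*} [Field L] [Algebra ℂ L] (p q g : L) (h : p * (p - q) * (p + g) ≠ 0)
    (i : Fin 3) : ((evγ p q g h).comp (Algebra.algHom ℂ P3 Aγ)) (MvPolynomial.X i) =
      ![p, q, g] i := by
  change evγ p q g h (algebraMap P3 Aγ _) = _
  simp [evγ]

/-- A vector-valued linear map intertwining the variables intertwines polynomials. -/
theorem P3.map_evLift {B B' N N' : Type*} [CommRing B] [Algebra ℂ B] [CommRing B'] [Algebra ℂ B']
    [AddCommGroup N] [Module ℂ N] [Module B N] [IsScalarTower ℂ B N]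
    [AddCommGroup N'] [Module ℂ N'] [Module B' N'] [IsScalarTower ℂ B' N']
    (ev : P3 →ₐ[ℂ] B) (ev' : P3 →ₐ[ℂ] B') (T : Submodule ℂ (N × N'))
    (h : ∀ i v, v ∈ T → (ev (MvPolynomial.X i) • v.1, ev' (MvPolynomial.X i) • v.2) ∈ T)
    (Φ : W →ₗ[ℂ] N) (Φ' : W →ₗ[ℂ] N') (hΦ : ∀ w, (Φ w, Φ' w) ∈ T) (s : P3 ⊗[ℂ] W) :
    (evLift ev Φ s, evLift ev' Φ' s) ∈ T :=
  evLift_mem T.toAddSubgroup (fun f v hv => P3.smul_mem ev ev' T h f v hv) Φ Φ' hΦ s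

end TranslationAlgebra

/-! ### Restriction to z₂ = 0, and exchange of the regions of z₁ and γ. -/

section

variable {V : Type*} [AddCommGroup V] [Module ℂ V]

/-- Restriction to `z₂ = 0` of regular series in `V((z₁))((z₂))((γ))`. -/
def regRel : Submodule ℂ (V3 V × V2 V) where
  carrier := {v | (∀ n, (v.1.coeff n).IsReg) ∧ LSer.map (LSer.coeffL 0) v.1 = v.2}
  zero_mem' := ⟨fun n m _ => by simp, by simp⟩
  add_mem' := by
    rintro ⟨f, g⟩ ⟨f', g'⟩ ⟨h1, h2⟩ ⟨h1', h2'⟩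
    refine ⟨fun n m hm => ?_, ?_⟩
    · rw [Prod.fst_add, LSer.coeff_add, LSer.coeff_add, h1 n m hm, h1' n m hm, add_zero]
    · rw [Prod.fst_add, map_add, h2, h2']; rfl
  smul_mem' := by
    rintro r ⟨f, g⟩ ⟨h1, h2⟩
    refine ⟨fun n m hm => ?_, ?_⟩
    · rw [Prod.smul_fst, LSer.coeff_smul, LSer.coeff_smul, h1 n m hm, smul_zero]
    · rw [Prod.smul_fst, map_smul, h2]; rfl

theorem regRel_z₁ {v : V3 V × V2 V} (h : v ∈ regRel) : (z₁ • v.1, x • v.2) ∈ regRel := by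
  obtain ⟨f, g⟩ := v
  obtain ⟨h1, h2⟩ := h
  change ∀ n, (f.coeff n).IsReg at h1
  change LSer.map (LSer.coeffL 0) f = g at h2
  subst h2
  refine ⟨fun n m hm => ?_, LSer.ext fun n => ?_⟩
  · rw [z₁, LSer.coeff_C_smul, x, LSer.coeff_C_smul, h1 n m hm, smul_zero]
  · rw [z₁, LSer.coeff_map, LSer.coeff_C_smul, x, LSer.coeff_C_smul]
    exact LSer.coeff_C_smul _ _ _

/-- Regularity in z₂ is essential: multiplying by z₂ can only then leave no constant term, which is
the rule that z₂ is evaluated at 0. -/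
theorem regRel_z₂ {v : V3 V × V2 V} (h : v ∈ regRel) : (z₂ • v.1, (0 : L2) • v.2) ∈ regRel := by
  obtain ⟨f, g⟩ := v
  obtain ⟨h1, h2⟩ := h
  change ∀ n, (f.coeff n).IsReg at h1
  change LSer.map (LSer.coeffL 0) f = g at h2
  subst h2
  refine ⟨fun n m hm => ?_, LSer.ext fun n => ?_⟩
  · rw [z₂, LSer.coeff_C_smul, y, LSer.coeff_var_smul, h1 n _ (by omega)]
  · rw [z₂, LSer.coeff_map, LSer.coeff_C_smul, zero_smul, LSer.coeff_zero]
    change (y • f.coeff n).coeff 0 = 0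
    rw [y, LSer.coeff_var_smul, h1 n _ (by omega)]

theorem regRel_z₃ {v : V3 V × V2 V} (h : v ∈ regRel) : (z₃ • v.1, y • v.2) ∈ regRel := by
  obtain ⟨f, g⟩ := v
  obtain ⟨h1, h2⟩ := h
  change ∀ n, (f.coeff n).IsReg at h1
  change LSer.map (LSer.coeffL 0) f = g at h2
  subst h2
  refine ⟨fun n m hm => ?_, LSer.map_var_smul _ _⟩
  rw [z₃, LSer.coeff_var_smul, h1 _ m hm]

/-- The polynomials at `(z₁, z₂, γ) = (x, 0, y)`. -/
def pe₀ : P3 →ₐ[ℂ] L2 := MvPolynomial.aeval ![x, 0, y]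

@[simp] theorem pe₀_X (i : Fin 3) : pe₀ (MvPolynomial.X i) = ![x, 0, y] i := by simp [pe₀]

theorem pe₀_den : pe₀ den = x ^ 2 * (x + y) := by
  simp [den, pe₀, sq]

/-- Substitution of `x` for `γ` in polynomials in `γ` with coefficients in `V((z₁))`, after
application of a linear map to the coefficients. -/
def polyRel (φ : V →ₗ[ℂ] V →ₗ[ℂ] V1 V) : Submodule ℂ (V2 V × (V → V2 V)) where
  carrier := {v | ∃ s : Finset ℤ, (∀ m ∉ s, v.1.coeff m = 0) ∧
    ∀ c, v.2 c = ∑ m ∈ s, x ^ m • LSer.map (φ.flip c) (v.1.coeff m)}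
  zero_mem' := ⟨∅, fun m _ => by simp, fun c => by simp⟩
  add_mem' := by
    classical
    rintro ⟨f, g⟩ ⟨f', g'⟩ ⟨s, h1, h2⟩ ⟨s', h1', h2'⟩
    refine ⟨s ∪ s', fun m hm => ?_, fun c => ?_⟩
    · rw [Finset.mem_union, not_or] at hm
      rw [Prod.fst_add, LSer.coeff_add, h1 m hm.1, h1' m hm.2, add_zero]
    · rw [Prod.snd_add, Pi.add_apply, h2 c, h2' c]
      simp only [Prod.fst_add, LSer.coeff_add, map_add, smul_add, Finset.sum_add_distrib]
      congr 1
      · exact Finset.sum_subset Finset.subset_union_left fun m _ hm => by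
          rw [h1 m hm, map_zero, smul_zero]
      · exact Finset.sum_subset Finset.subset_union_right fun m _ hm => by
          rw [h1' m hm, map_zero, smul_zero]
  smul_mem' := by
    rintro r ⟨f, g⟩ ⟨s, h1, h2⟩
    refine ⟨s, fun m hm => ?_, fun c => ?_⟩
    · rw [Prod.smul_fst, LSer.coeff_smul, h1 m hm, smul_zero]
    · rw [Prod.smul_snd, Pi.smul_apply, h2 c, Finset.smul_sum]
      refine Finset.sum_congr rfl fun m _ => ?_
      rw [Prod.smul_fst, LSer.coeff_smul, map_smul, smul_comm]

/-- The first variable is named x on the left and y on the right, because γ is the small variable on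
the left and the large one on the right. Negative powers are admitted since the factor z₁ of the
denominator has to be divided out. -/
theorem polyRel_x_zpow (φ : V →ₗ[ℂ] V →ₗ[ℂ] V1 V) {v : V2 V × (V → V2 V)} (h : v ∈ polyRel φ)
    (k : ℤ) : (x ^ k • v.1, y ^ k • v.2) ∈ polyRel φ := by
  obtain ⟨f, g⟩ := v
  obtain ⟨s, h1, h2⟩ := h
  change ∀ m ∉ s, f.coeff m = 0 at h1
  change ∀ c, g c = ∑ m ∈ s, x ^ m • LSer.map (φ.flip c) (f.coeff m) at h2
  have hc : ∀ m, (x ^ k • f).coeff m = LF.var ℂ ^ k • f.coeff m := fun m => by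
    rw [x_zpow, LSer.coeff_C_smul]
  refine ⟨s, fun m hm => ?_, fun c => ?_⟩
  · exact (hc m).trans (by rw [h1 m hm, smul_zero])
  · change y ^ k • g c = _
    rw [h2 c, Finset.smul_sum]
    refine Finset.sum_congr rfl fun m _ => ?_
    rw [smul_comm]
    change _ = x ^ m • LSer.map (φ.flip c) ((x ^ k • f).coeff m)
    rw [hc]
    congr 1
    refine LSer.ext fun n => ?_
    rw [LSer.coeff_map, y, LSer.coeff_var_zpow_smul, LSer.coeff_var_zpow_smul, LSer.coeff_map]

theorem polyRel_y (φ : V →ₗ[ℂ] V →ₗ[ℂ] V1 V) {v : V2 V × (V → V2 V)} (h : v ∈ polyRel φ) :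
    (y • v.1, x • v.2) ∈ polyRel φ := by
  obtain ⟨f, g⟩ := v
  obtain ⟨s, h1, h2⟩ := h
  change ∀ m ∉ s, f.coeff m = 0 at h1
  change ∀ c, g c = ∑ m ∈ s, x ^ m • LSer.map (φ.flip c) (f.coeff m) at h2
  refine ⟨s.map (Equiv.addRight (1 : ℤ)).toEmbedding, fun m hm => ?_, fun c => ?_⟩
  · change (y • f).coeff m = 0
    rw [y, LSer.coeff_var_smul]
    refine h1 _ fun h' => hm (Finset.mem_map.2 ⟨m - 1, h', by simp⟩)
  · change x • g c = _
    rw [h2 c, Finset.smul_sum, Finset.sum_map]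
    refine Finset.sum_congr rfl fun m _ => ?_
    change _ = x ^ (m + 1) • LSer.map (φ.flip c) ((y • f).coeff (m + 1))
    rw [y, LSer.coeff_var_smul, add_sub_cancel_right, smul_smul, zpow_add_one₀ x_ne, mul_comm]

/-- The polynomials at `(z₁, z₂, γ) = (y, 0, x)`. -/
def pe₁ : P3 →ₐ[ℂ] L2 := MvPolynomial.aeval ![y, 0, x]

@[simp] theorem pe₁_X (i : Fin 3) : pe₁ (MvPolynomial.X i) = ![y, 0, x] i := by simp [pe₁]

theorem pe₁_den : pe₁ den = y ^ 2 * (x + y) := by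
  simp [den, pe₁, sq, add_comm]

theorem ιγ₀_comp : ιγ₀.comp (Algebra.algHom ℂ P3 Aγ) = pe₁ :=
  MvPolynomial.algHom_ext fun i => by rw [ιγ₀, evγ_X, pe₁_X]

end

/-! ### The iterate in terms of the translated multiplication at z₂ = 0. -/

section

variable {V : Type*} [AddCommGroup V] [Module ℂ V] (Q : QuantumVertexAlgebra V)

namespace QuantumVertexAlgebra

/-- `u ↦ X_{z,0}(u)`. -/
def XZero (k : ℕ) : V ⊗[ℂ] V →ₗ[ℂ] V1 V := LSer.coeffL 0 ∘ₗ Q.X k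

/-- `u ↦ e^{γ(∂₁ + ∂₂ - D)} X_{z₁,z₂}(u)` at `z₂ = 0`, in `V((z₁))((γ))`. -/
def G (k : ℕ) : V ⊗[ℂ] V →ₗ[ℂ] V2 V :=
  LSer.map (LSer.coeffL 0) ∘ₗ (LSer.exp (nab Q.D) : V2 V →ₗ[ℂ] V3 V) ∘ₗ Q.X k

/-- The coefficients of `(z₁ + γ)ᴹ e^{γ(∂₁ + ∂₂ - D)} X_{z₁,z₂}(u)` at `z₂ = 0`. -/
def e (M k : ℕ) (m : ℤ) : V ⊗[ℂ] V →ₗ[ℂ] V1 V where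
  toFun u := ((x + y) ^ M • Q.G k u).coeff m
  map_add' u v := by simp
  map_smul' r u := by
    rw [map_smul, smul_comm]; simp

theorem e_apply (M k : ℕ) (m : ℤ) (u : V ⊗[ℂ] V) :
    Q.e M k m u = ((x + y) ^ M • Q.G k u).coeff m := rfl

/-- The translation axiom after cancellation of `e^{γD}` and of denominators. -/
theorem translation_den (k : ℕ) (u : V ⊗[ℂ] V) (M : ℕ) (ρ : ℕ → P3 ⊗[ℂ] (V ⊗[ℂ] V))
    (hρ : ∀ j ≤ k, (algebraMap P3 Aγ den) ^ M • Q.Sγ j u =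
      (Algebra.algHom ℂ P3 Aγ).toLinearMap.rTensor _ (ρ j)) :
    (ιγ.comp (Algebra.algHom ℂ P3 Aγ)) den ^ M • (LSer.exp (nab Q.D) (Q.X k u) : V3 V) =
      ∑ ij ∈ antidiagonal k, evLift (ιγ.comp (Algebra.algHom ℂ P3 Aγ))
        (LSer.const ∘ₗ Q.X ij.1) (ρ ij.2) := by
  set pe := ιγ.comp (Algebra.algHom ℂ P3 Aγ) with hpe
  have htrans : comp (fun i => LSer.exp (map₂D Q.D) ∘ₗ Q.X i) ιγ Q.Sγ k u =
      (LSer.exp tot (Q.X k u) : V3 V) :=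
    LinearMap.congr_fun (f := comp (fun i => LSer.exp (map₂D Q.D) ∘ₗ Q.X i) ιγ Q.Sγ k)
      (g := (LSer.exp tot : V2 V →ₗ[ℂ] V3 V) ∘ₗ Q.X k)
      (TensorProduct.ext' fun a b => Q.translation k a b) u
  have hE : ∀ (f : P3) (v : V3 V), LSer.expExt (map₂D Q.D) (pe f • v) =
      pe f • LSer.expExt (map₂D Q.D) v := by
    intro f v
    refine (P3.smul_mem pe pe (LinearMap.graph (LSer.expExt (map₂D Q.D) : V3 V →ₗ[ℂ] V3 V))
      ?_ f (v, LSer.expExt (map₂D Q.D) v) rfl).symm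
    rintro i ⟨v, v'⟩ hv
    change v' = LSer.expExt (map₂D Q.D) v at hv
    subst hv
    rw [hpe, ιγ, evγ_X]
    change _ = LSer.expExt (map₂D Q.D) _
    fin_cases i
    · exact (LSer.expExt_C_smul (map₂D_x_smul Q.D) v).symm
    · exact (LSer.expExt_C_smul (map₂D_y_smul Q.D) v).symm
    · exact (LSer.expExt_var_smul _ v).symm
  -- Both sides are compared after applying the injective operator e^{γD}, which turns the claim
  -- into the translation axiom multiplied by a power of the denominator.
  refine LSer.expExt_injective (map₂D Q.D) ?_
  have h2 : map₂D Q.D + nab Q.D = tot := add_sub_cancel _ _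
  rw [← map_pow, hE, LSer.expExt_exp (commute_nab Q.D), h2, ← htrans, comp_apply, map_sum,
    Finset.smul_sum]
  refine Finset.sum_congr rfl fun ij hij => ?_
  have hd : pe (den ^ M) = ιγ ((algebraMap P3 Aγ den) ^ M) := by
    rw [← map_pow]; rfl
  rw [hd, ← evLift_smul, hρ ij.2 (by have := mem_antidiagonal.1 hij; omega), evLift_rTensor,
    map_evLift (ev' := pe) (LSer.expExt (map₂D Q.D)) hE]
  congr 2
  exact LinearMap.ext fun w => (LSer.expExt_const _ _).symm

/-- The cleared translation relation restricted to z₂ = 0, where the denominator z₁(z₁-z₂)(z₁+γ)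
becomes z₁²(z₁+γ). The restriction is legitimate because e^{γ(∂₁+∂₂-D)}X stays regular in z₂. -/
theorem G_den (k : ℕ) (u : V ⊗[ℂ] V) (M : ℕ) (ρ : ℕ → P3 ⊗[ℂ] (V ⊗[ℂ] V))
    (hρ : ∀ j ≤ k, (algebraMap P3 Aγ den) ^ M • Q.Sγ j u =
      (Algebra.algHom ℂ P3 Aγ).toLinearMap.rTensor _ (ρ j)) :
    (x ^ 2 * (x + y)) ^ M • Q.G k u =
      ∑ ij ∈ antidiagonal k, evLift pe₀ (LSer.const ∘ₗ Q.XZero ij.1) (ρ ij.2) := by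
  set pe := ιγ.comp (Algebra.algHom ℂ P3 Aγ) with hpe
  have hX : ∀ i v, v ∈ regRel (V := V) →
      (pe (MvPolynomial.X i) • v.1, pe₀ (MvPolynomial.X i) • v.2) ∈ regRel := by
    intro i v hv
    rw [hpe, ιγ, evγ_X, pe₀_X]
    fin_cases i
    · exact regRel_z₁ hv
    · exact regRel_z₂ hv
    · exact regRel_z₃ hv
  have h1 : (pe den ^ M • (LSer.exp (nab Q.D) (Q.X k u) : V3 V),
      (x ^ 2 * (x + y)) ^ M • Q.G k u) ∈ regRel := by
    rw [← pe₀_den, ← map_pow, ← map_pow]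
    refine P3.smul_mem pe pe₀ regRel hX (den ^ M) (LSer.exp (nab Q.D) (Q.X k u), Q.G k u) ⟨?_, rfl⟩
    intro n
    rw [LSer.coeff_exp_eq]
    exact LSer.IsReg.divPow (fun f => isReg_nab Q.D) (Q.isReg_X k u) n
  have h2 : (∑ ij ∈ antidiagonal k, evLift pe (LSer.const ∘ₗ Q.X ij.1) (ρ ij.2),
      ∑ ij ∈ antidiagonal k, evLift pe₀ (LSer.const ∘ₗ Q.XZero ij.1) (ρ ij.2)) ∈
      regRel (V := V) := by
    rw [prod_mk_sum]
    refine Submodule.sum_mem _ fun ij _ => ?_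
    refine P3.map_evLift pe pe₀ regRel hX _ _ (fun w => ⟨fun n m hm => ?_, ?_⟩) _
    · simp only [LinearMap.comp_apply, LSer.coeff_const]
      split_ifs
      · exact Q.isReg_X _ _ m hm
      · simp
    · refine LSer.ext fun n => ?_
      simp only [LinearMap.comp_apply, LSer.coeff_const, LSer.coeff_map]
      split_ifs
      · rfl
      · simp
  rw [← Q.translation_den k u M ρ hρ] at h2
  exact h1.2.symm.trans h2.2

/-- The consequences of broken translation covariance for the iterates. -/
theorem polyRel_G (p k : ℕ) (u : V ⊗[ℂ] V) (M : ℕ) (ρ : ℕ → P3 ⊗[ℂ] (V ⊗[ℂ] V))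
    (hρ : ∀ j ≤ k, (algebraMap P3 Aγ den) ^ M • Q.Sγ j u =
      (Algebra.algHom ℂ P3 Aγ).toLinearMap.rTensor _ (ρ j)) :
    ((x + y) ^ M • Q.G k u, fun c => y ^ (-(2 * M : ℤ)) • ∑ ij ∈ antidiagonal k,
      evLift pe₁ (LSer.map ((vertexOp Q.X p).flip c) ∘ₗ Q.XZero ij.1) (ρ ij.2)) ∈
      polyRel (vertexOp Q.X p) := by
  let F : ℕ → V ⊗[ℂ] V →ₗ[ℂ] (V → V2 V) := fun i =>
    LinearMap.pi fun c => LSer.map ((vertexOp Q.X p).flip c) ∘ₗ Q.XZero i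
  have hF : ∀ i (s : P3 ⊗[ℂ] (V ⊗[ℂ] V)) c, evLift pe₁ (F i) s c =
      evLift pe₁ (LSer.map ((vertexOp Q.X p).flip c) ∘ₗ Q.XZero i) s := by
    intro i s c
    induction s with
    | zero => simp
    | tmul f u => rw [evLift_tmul, evLift_tmul, Pi.smul_apply]; rfl
    | add s t hs ht => rw [map_add, map_add, Pi.add_apply, hs, ht]
  have h1 : (∑ ij ∈ antidiagonal k, evLift pe₀ (LSer.const ∘ₗ Q.XZero ij.1) (ρ ij.2),
      ∑ ij ∈ antidiagonal k, evLift pe₁ (F ij.1) (ρ ij.2)) ∈ polyRel (vertexOp Q.X p) := by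
    rw [prod_mk_sum]
    refine Submodule.sum_mem _ fun ij _ => ?_
    refine P3.map_evLift pe₀ pe₁ (polyRel (vertexOp Q.X p)) ?_ _ _ (fun w => ⟨{0}, fun m hm => ?_, fun c => ?_⟩) _
    · intro i v hv
      rw [pe₀_X, pe₁_X]
      fin_cases i
      · have := polyRel_x_zpow _ hv 1
        simpa using this
      · change ((0 : L2) • v.1, (0 : L2) • v.2) ∈ _
        rw [zero_smul, zero_smul]
        exact Submodule.zero_mem _
      · exact polyRel_y _ hv
    · simp only [LinearMap.comp_apply, LSer.coeff_const]
      exact if_neg (by simpa using hm)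
    · simp only [LinearMap.comp_apply, Finset.sum_singleton, LSer.coeff_const]
      simp [F]
  rw [← Q.G_den k u M ρ hρ] at h1
  -- Division by z₁^{2M} leaves exactly the factor (z₁+γ)^M, the only one whose expansion depends on
  -- the region.
  have h2 := polyRel_x_zpow _ h1 (-(2 * M : ℤ))
  convert h2 using 1
  refine Prod.ext ?_ (funext fun c => ?_)
  · change _ = x ^ (-(2 * M : ℤ)) • (x ^ 2 * (x + y)) ^ M • Q.G k u
    rw [smul_smul, mul_pow, ← pow_mul, ← mul_assoc, ← zpow_natCast x, ← zpow_add₀ x_ne]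
    simp
  · change _ = y ^ (-(2 * M : ℤ)) • (∑ ij ∈ antidiagonal k, evLift pe₁ (F ij.1) (ρ ij.2)) c
    rw [Finset.sum_apply]
    simp only [hF]

theorem exists_clear_Sγ (k : ℕ) (u : V ⊗[ℂ] V) : ∀ᶠ M in atTop,
    ∃ ρ : ℕ → P3 ⊗[ℂ] (V ⊗[ℂ] V), ∀ j ≤ k, (algebraMap P3 Aγ den) ^ M • Q.Sγ j u =
      (Algebra.algHom ℂ P3 Aγ).toLinearMap.rTensor _ (ρ j) := by
  have h : ∀ᶠ M in atTop, ∀ j ∈ Finset.range (k + 1), ∃ ρ : P3 ⊗[ℂ] (V ⊗[ℂ] V),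
      (algebraMap P3 Aγ den) ^ M • Q.Sγ j u =
        (Algebra.algHom ℂ P3 Aγ).toLinearMap.rTensor _ ρ := by
    refine (Finset.eventually_all _).2 fun j _ => ?_
    exact eventually_atTop.2 (exists_clear_den (Q.Sγ j u))
  filter_upwards [h] with M hM
  choose! ρ hρ using hM
  exact ⟨ρ, fun j hj => hρ j (Finset.mem_range.2 (by omega))⟩

/-- Once the denominators are cleared the right side of `G_den` is polynomial in γ, and division by
powers of z₁ does not affect this. Thus only finitely many powers of γ occur. -/
theorem e_eventually_zero (k : ℕ) (u : V ⊗[ℂ] V) : ∀ᶠ M in atTop, ∀ᶠ s : Finset ℤ in atTop,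
    ∀ m ∉ s, Q.e M k m u = 0 := by
  filter_upwards [Q.exists_clear_Sγ k u] with M ⟨ρ, hρ⟩
  obtain ⟨s, h1, -⟩ := Q.polyRel_G 0 k u M ρ hρ
  exact eventually_atTop.2 ⟨s, fun s' hs' m hm => h1 m fun h => hm (hs' h)⟩

theorem iterOp_apply (c : V) (k : ℕ) (u : V ⊗[ℂ] V) :
    iterOp Q.X c k u = ∑ ij ∈ antidiagonal k,
      LSer.map ((vertexOp Q.X ij.1).flip c) (Q.XZero ij.2 u) := by
  rw [iterOp, LinearMap.sum_apply]
  refine Finset.sum_congr rfl fun ij _ => ?_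
  rw [LinearMap.comp_apply]
  congr 1
  exact LinearMap.congr_fun (f := TensorProduct.lift (vertexOp Q.X ij.2)) (g := Q.XZero ij.2)
    (TensorProduct.ext' fun a b => rfl) u

/-- The finitely many coefficients of (z₁+γ)^M G may be re-expanded with γ as the large variable.
The iterate with its translation map then becomes a finite sum of ordinary iterates Y(eₘ,x)c
weighted by xᵐ, for all c with the same M and the same exponents. -/
theorem iterate_eq (k : ℕ) (u : V ⊗[ℂ] V) : ∀ᶠ M in atTop, ∀ᶠ s : Finset ℤ in atTop,
    ∀ c, (x + y) ^ M • comp (iterOp Q.X c) ιγ₀ Q.Sγ k u =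
      ∑ m ∈ s, x ^ m • ∑ ij ∈ antidiagonal k,
        LSer.map ((vertexOp Q.X ij.1).flip c) (Q.e M ij.2 m u) := by
  filter_upwards [Q.exists_clear_Sγ k u] with M ⟨ρ, hρ⟩
  have h := fun pq : ℕ × ℕ => fun h : pq ∈ antidiagonal k =>
    Q.polyRel_G pq.1 pq.2 u M ρ fun j hj => hρ j (by have := mem_antidiagonal.1 h; omega)
  have h' : ∀ᶠ s : Finset ℤ in atTop, ∀ pq ∈ antidiagonal k, ∀ c,
      y ^ (-(2 * M : ℤ)) • ∑ ij ∈ antidiagonal pq.2, evLift pe₁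
        (LSer.map ((vertexOp Q.X pq.1).flip c) ∘ₗ Q.XZero ij.1) (ρ ij.2) =
      ∑ m ∈ s, x ^ m • (LSer.map ((vertexOp Q.X pq.1).flip c) (Q.e M pq.2 m u) : V2 V) := by
    refine (Finset.eventually_all _).2 fun pq hpq => ?_
    obtain ⟨s, h1, h2⟩ := h pq hpq
    refine eventually_atTop.2 ⟨s, fun s' hs' c => (h2 c).trans ?_⟩
    refine Finset.sum_subset hs' fun m _ hm => ?_
    rw [h1 m hm, map_zero, smul_zero]
  filter_upwards [h'] with s hs c
  have h3 : comp (iterOp Q.X c) ιγ₀ Q.Sγ k u =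
      (y ^ 2 * (x + y)) ^ (-(M : ℤ)) • ∑ ij ∈ antidiagonal k,
        evLift pe₁ (iterOp Q.X c ij.1) (ρ ij.2) := by
    have hne : y ^ 2 * (x + y) ≠ 0 := mul_ne_zero (pow_ne_zero _ y_ne) x_add_y_ne
    rw [eq_comm, zpow_neg, inv_smul_eq_iff₀ (zpow_ne_zero _ hne), zpow_natCast, comp_apply,
      Finset.smul_sum]
    refine Finset.sum_congr rfl fun ij hij => ?_
    have hd : (y ^ 2 * (x + y)) ^ M = ιγ₀ ((algebraMap P3 Aγ den) ^ M) := by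
      rw [← pe₁_den, ← ιγ₀_comp, ← map_pow, ← map_pow]; rfl
    rw [hd, ← evLift_smul, hρ ij.2 (by have := mem_antidiagonal.1 hij; omega), evLift_rTensor,
      ιγ₀_comp]
  have h4 : ∑ ij ∈ antidiagonal k, evLift pe₁ (iterOp Q.X c ij.1) (ρ ij.2) =
      ∑ pq ∈ antidiagonal k, ∑ ij ∈ antidiagonal pq.2, evLift pe₁
        (LSer.map ((vertexOp Q.X pq.1).flip c) ∘ₗ Q.XZero ij.1) (ρ ij.2) := by
    rw [← sum_antidiagonal_assoc fun p i j => evLift pe₁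
        (LSer.map ((vertexOp Q.X p).flip c) ∘ₗ Q.XZero i) (ρ j)]
    refine Finset.sum_congr rfl fun ij _ => ?_
    rw [← evLift_sum]
    congr 2
    refine LinearMap.ext fun w => ?_
    rw [iterOp_apply, LinearMap.sum_apply]
    rfl
  -- At (z₁,z₂,γ) = (y,0,x) the denominator is y²(x+y); the prefactor cancels its (x+y)-part.
  have h5 : (x + y) ^ M * (y ^ 2 * (x + y)) ^ (-(M : ℤ)) = y ^ (-(2 * M : ℤ)) := by
    rw [mul_zpow, mul_left_comm, ← zpow_natCast (x + y), ← zpow_add₀ x_add_y_ne, ← zpow_natCast y,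
      ← zpow_mul]
    simp
  rw [h3, smul_smul, h5, h4, Finset.smul_sum]
  simp only [Finset.smul_sum (s := antidiagonal k)]
  rw [Finset.sum_comm]
  exact Finset.sum_congr rfl fun pq hpq => hs pq hpq c

end QuantumVertexAlgebra

end

/-! ## Translation at the origin -/

section

variable {L : Type*} [Field L] [Algebra ℂ L]
variable {M : Type*} [AddCommGroup M] [Module ℂ M] [Module L M] [IsScalarTower ℂ L M]

theorem LSer.coeff_divPow_deriv (i : ℕ) (f : LSer L M) (q : ℤ) :
    (divPow LSer.deriv i f).coeff q = Ring.choose (q + i) i • f.coeff (q + i) := by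
  have h : ∀ i : ℕ, (LSer.deriv ^ i) f =
      LSer.mk ((LaurentSeries.derivative ℂ)^[i] ((HahnModule.of L).symm f)) := by
    intro i
    induction i with
    | zero => rfl
    | succ i ih => rw [pow_succ', Module.End.mul_apply, ih, Function.iterate_succ_apply']; rfl
  have h1 : (i.factorial : ℂ) ≠ 0 := by exact_mod_cast i.factorial_ne_zero
  rw [divPow_natCast, LinearMap.smul_apply, LSer.coeff_smul, h, LSer.coeff_mk,
    LaurentSeries.derivative_iterate, ← Nat.cast_smul_eq_nsmul ℂ, HahnSeries.coeff_smul, smul_smul,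
    inv_mul_cancel₀ h1, one_smul, LaurentSeries.hasseDeriv_coeff]
  rfl

theorem LSer.coeff_divPow_map (T : M →ₗ[ℂ] M) (i : ℤ) (f : LSer L M) (q : ℤ) :
    (divPow (LSer.map T) i f : LSer L M).coeff q = divPow T i (f.coeff q) :=
  divPow_comp (T := T) (fun f : LSer L M => f.coeff q) (fun _ _ => LSer.coeff_smul _ _ _)
    (LSer.coeff_zero _) (fun _ => rfl) i f

end

section

variable {W : Type*} [AddCommGroup W] [Module ℂ W]

theorem commute_derivs : Commute (LSer.map LSer.deriv : V2 W →ₗ[ℂ] V2 W) LSer.deriv := by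
  refine LinearMap.ext fun f => V2.ext fun p q => ?_
  simp only [Module.End.mul_apply, cf, LSer.coeff_map, LSer.coeff_deriv, LSer.coeff_smul]
  rw [smul_comm]

theorem isReg_tot {f : V2 W} (h : f.IsReg) : (tot f).IsReg := by
  have := isReg_nab 0 h
  rwa [show nab (0 : W →ₗ[ℂ] W) = tot by simp [nab, map₂D]] at this

theorem tot_x_smul (f : V2 W) : tot (x • f) = x • tot f + f := by
  refine V2.ext fun p q => ?_
  rw [cf_add, cf_x_smul, cf_tot, cf_tot, cf_x_smul, cf_x_smul]
  push_cast
  simp only [add_sub_cancel_right, sub_add_cancel]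
  module

theorem tot_y_smul (f : V2 W) : tot (y • f) = y • tot f + f := by
  refine V2.ext fun p q => ?_
  rw [cf_add, cf_y_smul, cf_tot, cf_tot, cf_y_smul, cf_y_smul]
  push_cast
  simp only [add_sub_cancel_right, sub_add_cancel]
  module

/-- `f(z₁ + γ, γ)` for `f(z₁, z₂)` regular in `z₂`. -/
def diag : V2 W →ₗ[ℂ] V2 W :=
  LSer.map (LSer.coeffL 0) ∘ₗ (LSer.exp tot : V2 W →ₗ[ℂ] V3 W)

theorem coeff_diag (f : V2 W) (m : ℤ) : (diag f).coeff m = (divPow tot m f).coeff 0 := by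
  rw [← LSer.coeff_exp_eq (L := L2)]; rfl

theorem diag_x_smul (f : V2 W) : diag (x • f) = (x + y) • diag f := by
  refine LSer.ext fun m => ?_
  rw [add_smul, LSer.coeff_add, x, y, LSer.coeff_C_smul, LSer.coeff_var_smul, coeff_diag,
    coeff_diag, coeff_diag, ← x, divPow_leibniz (fun f : V2 W => x • f)
      (fun r v => smul_comm _ _ _) tot_x_smul, LSer.coeff_add, x, LSer.coeff_C_smul]

/-- z₁ - z₂ is invariant under simultaneous translation and equals z₁ at z₂ = 0; regularity of f
lets the z₂-part drop out. -/
theorem diag_sub_smul {f : V2 W} (hf : f.IsReg) : diag ((x - y) • f) = x • diag f := by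
  refine LSer.ext fun m => ?_
  have h : divPow tot m ((x - y) • f) = (x - y) • divPow tot m f :=
    (divPow_comp (T := tot) (fun f : V2 W => (x - y) • f) (fun r v => smul_comm _ _ _)
      (smul_zero _) (fun v => by
        rw [sub_smul, sub_smul, map_sub, tot_x_smul, tot_y_smul]; abel) m f).symm
  rw [coeff_diag, h, sub_smul, LSer.coeff_sub, x, LSer.coeff_C_smul, LSer.coeff_C_smul, y,
    LSer.coeff_var_smul, (LSer.IsReg.divPow (fun f => isReg_tot) hf m) (0 - 1) (by norm_num), sub_zero,
    coeff_diag]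

/-- Series which are regular in both variables. -/
def IsReg₂ (f : V2 W) : Prop := ∀ p q, p < 0 ∨ q < 0 → cf f p q = 0

theorem IsReg₂.add {f g : V2 W} (hf : IsReg₂ f) (hg : IsReg₂ g) : IsReg₂ (f + g) :=
  fun p q h => by rw [cf_add, hf p q h, hg p q h, add_zero]

theorem IsReg₂.mul_sub {f : V2 W} (hf : IsReg₂ f) : IsReg₂ ((x * (x - y)) • f) := fun p q h => by
  rw [mul_smul, cf_x_smul, sub_smul, cf_sub, cf_x_smul, cf_y_smul, hf _ _ (by omega),
    hf _ _ (by omega), sub_zero]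

/-- Both sides are f(z₃+z₂, z₂), the left one with z₃ as the large variable and the right one with
z₂. For f without negative powers each coefficient is a finite sum of ordinary binomials, and the
two readings agree by the symmetry of binomial coefficients. -/
theorem cf_diag {f : V2 W} (hf : IsReg₂ f) (n m : ℤ) :
    cf (diag f) n m = subst (cf f) m n := by
  have hz : ∀ p q, p < 0 ∨ q < 0 → cf f p q = 0 := hf
  rw [cf, coeff_diag]
  by_cases hm : 0 ≤ m
  · obtain ⟨m, rfl⟩ := Int.eq_ofNat_of_zero_le hm
    have h1 : ((divPow tot m f).coeff 0).coeff n =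
        ∑ j ∈ Finset.range (m + 1), Ring.choose (n + j) j • cf f (n + j) (m - j) := by
      rw [divPow_add commute_derivs, LinearMap.sum_apply, LSer.coeff_sum, LSer.coeff_sum]
      refine Finset.sum_congr rfl fun j hj => ?_
      have hj' : j ≤ m := Nat.lt_succ_iff.1 (Finset.mem_range.1 hj)
      rw [Module.End.mul_apply, LSer.coeff_divPow_map, LSer.coeff_divPow_deriv,
        LSer.coeff_divPow_deriv]
      simp only [zero_add, Ring.choose_natCast, Nat.choose_self, Nat.cast_one, one_smul]
      rw [Nat.cast_sub hj', cf]
    rw [h1]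
    by_cases hn : 0 ≤ n
    · obtain ⟨n, rfl⟩ := Int.eq_ofNat_of_zero_le hn
      rw [subst_eq_sum hz m hn (s := Finset.Icc 0 (m + n : ℤ))
        (fun p h h' => Finset.mem_Icc.2 ⟨h, by simpa using h'⟩)]
      rw [← Finset.sum_subset (s₁ := (Finset.range (m + 1)).map
        (Nat.castEmbedding.trans (Equiv.addLeft (n : ℤ)).toEmbedding))]
      · rw [Finset.sum_map]
        refine Finset.sum_congr rfl fun j _ => ?_
        simp only [Function.Embedding.trans_apply, Nat.castEmbedding_apply, Equiv.coe_toEmbedding,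
          Equiv.coe_addLeft, Int.toNat_natCast]
        rw [← Nat.cast_add, Ring.choose_natCast, Ring.choose_natCast, Nat.choose_symm_add]
        congr 2
        push_cast
        ring
      · intro p hp
        obtain ⟨j, hj, rfl⟩ := Finset.mem_map.1 hp
        have := Finset.mem_range.1 hj
        simp only [Function.Embedding.trans_apply, Nat.castEmbedding_apply, Equiv.coe_toEmbedding,
          Equiv.coe_addLeft, Finset.mem_Icc]
        omega
      · intro p hp hp'
        obtain ⟨h0, h1⟩ := Finset.mem_Icc.1 hp
        -- The remaining indices lie below n, where the ordinary binomial coefficient vanishes;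
        -- nonnegativity of p is what makes it ordinary.
        have hlt : p < n := by
          by_contra hle
          exact hp' (Finset.mem_map.2 ⟨(p - n).toNat, Finset.mem_range.2 (by omega), by
            simp only [Function.Embedding.trans_apply, Nat.castEmbedding_apply, Equiv.coe_toEmbedding,
          Equiv.coe_addLeft]; omega⟩)
        obtain ⟨p, rfl⟩ := Int.eq_ofNat_of_zero_le h0
        rw [Int.toNat_natCast, Ring.choose_natCast, Nat.choose_eq_zero_of_lt (by omega)]
        simp
    · rw [subst_of_neg _ _ (not_le.1 hn)]
      refine Finset.sum_eq_zero fun j _ => ?_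
      by_cases h : n + j < 0
      · rw [hf _ _ (Or.inl h), smul_zero]
      · obtain ⟨p, hp⟩ := Int.eq_ofNat_of_zero_le (not_lt.1 h)
        rw [hp, Ring.choose_natCast, Nat.choose_eq_zero_of_lt (by omega)]
        simp
  · rw [divPow_of_neg _ (not_le.1 hm)]
    simp only [LinearMap.zero_apply, LSer.coeff_zero]
    by_cases hn : 0 ≤ n
    · rw [subst_eq_sum hz m hn (s := Finset.Icc 0 (m + n : ℤ))
        (fun p h h' => Finset.mem_Icc.2 ⟨h, by simpa using h'⟩)]
      refine (Finset.sum_eq_zero fun p hp => ?_).symm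
      obtain ⟨h0, h1⟩ := Finset.mem_Icc.1 hp
      obtain ⟨p, rfl⟩ := Int.eq_ofNat_of_zero_le h0
      rw [Ring.choose_natCast, Nat.choose_eq_zero_of_lt (by omega)]
      simp
    · rw [subst_of_neg _ _ (not_le.1 hn)]

end

section

variable {V : Type*} [AddCommGroup V] [Module ℂ V] (Q : QuantumVertexAlgebra V)

namespace QuantumVertexAlgebra

theorem isReg₂_X (k : ℕ) (u : V ⊗[ℂ] V) :
    ∀ᶠ M in atTop, IsReg₂ ((x * (x - y)) ^ M • Q.X k u) := by
  induction u with
  | zero => exact Eventually.of_forall fun M p q _ => by simp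
  | add u v hu hv =>
    filter_upwards [hu, hv] with M h h'
    rw [map_add, smul_add]
    exact h.add h'
  | tmul a b =>
    obtain ⟨N, hN⟩ := Q.singular k a b
    refine eventually_atTop.2 ⟨N, fun M hM => ?_⟩
    obtain ⟨d, rfl⟩ := Nat.exists_eq_add_of_le hM
    clear hM
    induction d with
    | zero => exact hN
    | succ d ih => rw [← add_assoc, pow_succ', mul_smul]; exact ih.mul_sub

/-- Splitting e^{γ(∂₁+∂₂)} as e^{γD}e^{γ(∂₁+∂₂-D)} gives `diag` of X as e^{γD}G, while the pole
factor z₁(z₁-z₂) is carried to (z₁+γ)z₁. The factor z₁+γ commutes with e^{γD} and is absorbed into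
G. -/
theorem diag_X (k : ℕ) (u : V ⊗[ℂ] V) (M : ℕ) :
    diag ((x * (x - y)) ^ M • Q.X k u) =
      x ^ M • LSer.expExt (LSer.map Q.D) ((x + y) ^ M • Q.G k u) := by
  have h1 : ∀ (N : ℕ) (f : V2 V), diag (x ^ N • f) = (x + y) ^ N • diag f :=
    fun N f => map_pow_smul (diag : V2 V →ₗ[ℂ] V2 V) diag_x_smul N f
  have h2 : ∀ N : ℕ, ((x - y) ^ N • Q.X k u).IsReg ∧
      diag ((x - y) ^ N • Q.X k u) = x ^ N • diag (Q.X k u) := by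
    intro N
    induction N with
    | zero => simpa using Q.isReg_X k u
    | succ N ih =>
      rw [pow_succ', mul_smul, diag_sub_smul ih.1, ih.2, pow_succ', mul_smul]
      exact ⟨LSer.IsReg.smul (fun n hn => by simp [x, y, hn.ne, show n ≠ 1 by omega]) ih.1, rfl⟩
  have h3 : LSer.expExt (LSer.map Q.D) (Q.G k u) = diag (Q.X k u) := by
    have := LSer.map_expExt (L := L2) (L' := L1) (S := map₂D Q.D)
      (T := (LSer.map Q.D : V1 V →ₗ[ℂ] V1 V)) (LSer.coeffL 0) (fun v => rfl)
      (LSer.exp (nab Q.D) (Q.X k u))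
    rw [LSer.expExt_exp (commute_nab Q.D),
      show map₂D Q.D + nab Q.D = tot from add_sub_cancel _ _] at this
    exact this.symm
  have h4 : ∀ v : V2 V, LSer.expExt (LSer.map Q.D) ((x + y) • v) =
      (x + y) • LSer.expExt (LSer.map Q.D) v := fun v => by
    rw [add_smul, add_smul, map_add, y, LSer.expExt_var_smul, x,
      LSer.expExt_C_smul (fun v => LSer.map_var_smul _ v)]
  rw [map_pow_smul (LSer.expExt (LSer.map Q.D) : V2 V →ₗ[ℂ] V2 V) h4, h3, mul_pow, mul_smul, h1,
    (h2 M).2, smul_comm]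

/-- `Σₘ z₂ᵐ e^{z₂D} eₘ(z₃)` is the result of the substitution `z₁ = z₂ + z₃`. -/
theorem sum_divPow_e (k : ℕ) (u : V ⊗[ℂ] V) : ∀ᶠ M in atTop, ∀ᶠ s : Finset ℤ in atTop,
    ∀ m n, ∑ i ∈ s, divPow Q.D (m - i) ((Q.e M k i u).coeff (n - M)) =
      subst (cf ((x * (x - y)) ^ M • Q.X k u)) m n := by
  filter_upwards [Q.isReg₂_X k u, Q.e_eventually_zero k u] with M hM hM'
  filter_upwards [hM'] with s hs m n
  rw [← cf_diag hM, diag_X, cf_x_pow_smul, cf, LSer.coeff_expExt]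
  have h : ∀ j : ℤ, ((divPow (LSer.map Q.D) j (((x + y) ^ M • Q.G k u).coeff (m - j)) :
      V1 V)).coeff (n - M) = divPow Q.D j ((Q.e M k (m - j) u).coeff (n - M)) :=
    fun j => LSer.coeff_divPow_map _ _ _ _
  have h' := map_finsum (LSer.coeffL (n - M) : V1 V →ₗ[ℂ] V)
    (LSer.finite_expExt (LSer.map Q.D : V1 V →ₗ[ℂ] V1 V) ((x + y) ^ M • Q.G k u) m)
  simp only [LSer.coeffL_apply, h] at h'
  rw [h']
  have hsub : ∑ i ∈ s, divPow Q.D (m - i) ((Q.e M k i u).coeff (n - M)) =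
      ∑ᶠ i : ℤ, divPow Q.D (m - i) ((Q.e M k i u).coeff (n - M)) := by
    refine (finsum_eq_sum_of_support_subset _ fun i hi => ?_).symm
    by_contra hni
    exact hi (by
      change divPow Q.D (m - i) ((Q.e M k i u).coeff (n - M)) = 0
      rw [hs i hni, LSer.coeff_zero, map_zero])
  -- The exponent of γ is reindexed as m minus the order of the divided power of D, to match the
  -- coefficients of e^{γD}.
  rw [hsub, ← finsum_comp_equiv (Equiv.subLeft m)]
  simp only [Equiv.subLeft_apply, sub_sub_cancel]
  have hr : Function.support (fun j : ℤ => divPow Q.D j ((Q.e M k (m - j) u).coeff (n - M))) ⊆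
      Set.range (Nat.cast : ℕ → ℤ) := fun j hj => by
    by_contra hneg
    refine hj ?_
    change divPow Q.D j _ = 0
    rw [divPow_of_neg _ (by
      by_contra hle
      exact hneg ⟨j.toNat, by omega⟩)]
    rfl
  rw [← finsum_mem_univ (fun j : ℤ => divPow Q.D j ((Q.e M k (m - j) u).coeff (n - M))),
    finsum_mem_inter_support_eq _ Set.univ (Set.range (Nat.cast : ℕ → ℤ))
      (by rw [Set.univ_inter, Set.inter_eq_right.2 hr]), finsum_mem_range Nat.cast_injective]

end QuantumVertexAlgebra

end

/-! ### The substitution in Y(c, w)X_{z₁,z₂}. -/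

section

variable {V : Type*} [AddCommGroup V] [Module ℂ V] (Q : QuantumVertexAlgebra V)

/-- z₁ - z₂ becomes z₃, which is invertible in Laurent series in z₃. -/
theorem r₁_sub_r₂_mem : r₁ - r₂ ∈ S3 := by
  rw [mem_S3, map_sub, substR_r₁, substR_r₂, shiftVar, add_sub_cancel_left]
  exact var_ne

theorem substR_r₁_sub_r₂ : substR (r₁ - r₂) = LF.var K2 := by
  rw [map_sub, substR_r₁, substR_r₂, shiftVar, add_sub_cancel_left]

theorem kz_zpow_smul_emb₂ (m : ℤ) (f : Dist (ℤ × ℤ) V) :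
    kz ^ m • emb₂ f = emb₂ fun a => f (a.1 - m, a.2) := by
  have h := emb₂_smul (mono (m, 0)) f
  rw [mono_kz_kw, zpow_zero, mul_one] at h
  rw [← h]
  refine congrArg emb₂ (Dist.ext fun a => ?_)
  rw [Dist.mono_smul_apply]
  exact congrArg f (Prod.ext rfl (sub_zero _))

namespace QuantumVertexAlgebra

theorem XY_apply (i : ℕ) (c v : V) :
    Q.XY i (c ⊗ₜ v) = emb₂ fun a => (vertexOp Q.X i c (divPow Q.D a.1 v)).coeff a.2 :=
  congrArg emb₂ (Dist.ext fun a => by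
    rw [LinearMap.comp_apply, distY_apply, cf_X])

/-- The substitution `z₁ = z₂ + z₃` in `Y(c, w) X_{z₁,z₂}(u)`. -/
theorem YX_rel (k : ℕ) (c : V) (u : V ⊗[ℂ] V) : ∀ᶠ M in atTop, ∀ᶠ s : Finset ℤ in atTop,
    (algebraMap R3 A3 (r₁ ^ M) • Q.YX k (c ⊗ₜ u), ∑ m ∈ s, LF.C kz ^ m • ∑ ij ∈ antidiagonal k,
      LSer.map (Q.XY ij.1 ∘ₗ TensorProduct.mk ℂ V V c) (Q.e M ij.2 m u)) ∈ substRel := by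
  have hreg : ∀ᶠ M in atTop, ∀ ij ∈ antidiagonal k,
      IsReg₂ ((x * (x - y)) ^ M • Q.X ij.2 u) :=
    (Finset.eventually_all _).2 fun ij _ => Q.isReg₂_X ij.2 u
  have hsum : ∀ᶠ M in atTop, ∀ ij ∈ antidiagonal k, ∀ᶠ s : Finset ℤ in atTop,
      ∀ m n, ∑ i ∈ s, divPow Q.D (m - i) ((Q.e M ij.2 i u).coeff (n - M)) =
        subst (cf ((x * (x - y)) ^ M • Q.X ij.2 u)) m n :=
    (Finset.eventually_all _).2 fun ij _ => Q.sum_divPow_e ij.2 u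
  filter_upwards [hreg, hsum] with M hM hM'
  filter_upwards [(Finset.eventually_all _).2 hM'] with s hs
  have hx : ∀ i f, Q.prodW i c ((x * (x - y)) • f) = (r₁ * (r₁ - r₂)) • Q.prodW i c f := by
    intro i f
    rw [mul_smul, mul_smul, sub_smul, sub_smul]
    ext ⟨l, m, r⟩
    rw [r₁_smul_apply, Pi.sub_apply, r₁_smul_apply, r₂_smul_apply]
    simp only [prodW_apply, cf_x_smul, cf_sub, cf_y_smul, map_sub, LSer.coeff_sub]
  set g : Dist (ℤ × ℤ × ℤ) V :=
    ∑ ij ∈ antidiagonal k, Q.prodW ij.1 c ((x * (x - y)) ^ M • Q.X ij.2 u) with hg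
  have hgb : ∀ ij ∈ antidiagonal k,
      Q.prodW ij.1 c ((x * (x - y)) ^ M • Q.X ij.2 u) ∈ bddDist := fun ij hij r =>
    ⟨0, fun p q h => by
      change (vertexOp Q.X ij.1 c (cf _ p q)).coeff r = 0
      rw [hM ij hij p q h]; simp⟩
  have hgm : g ∈ bddDist := Submodule.sum_mem _ hgb
  -- Together with the factor z₁^M already present, (z₁-z₂)^M removes all poles of X, so that a
  -- bounded distribution g represents the left side. On the right this factor is z₃^M.
  refine substRel_of_smul (S3.pow_mem r₁_sub_r₂_mem M) ?_
  have h1 : algebraMap R3 A3 ((r₁ - r₂) ^ M) • algebraMap R3 A3 (r₁ ^ M) • Q.YX k (c ⊗ₜ u) =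
      emb₃ g := by
    rw [smul_smul, ← map_mul, ← mul_pow, mul_comm (r₁ - r₂), YX_tmul, Finset.smul_sum, hg, map_sum]
    refine Finset.sum_congr rfl fun ij _ => ?_
    rw [← emb₃_smul, map_pow_smul (Q.prodW ij.1 c) (hx ij.1)]
  rw [h1]
  have hmk := substRel_mk hgm
  suffices h : substR ((r₁ - r₂) ^ M) • ∑ m ∈ s, LF.C kz ^ m • ∑ ij ∈ antidiagonal k,
      (LSer.map (Q.XY ij.1 ∘ₗ TensorProduct.mk ℂ V V c) (Q.e M ij.2 m u) : LSer K2 (D2K V)) =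
      substD g by
    rw [h]; exact hmk
  rw [map_pow, substR_r₁_sub_r₂]
  refine LSer.ext fun n => ?_
  rw [LSer.coeff_var_pow_smul, coeff_substD, LSer.coeff_sum]
  have h2 : ∀ m, (LF.C kz ^ m • ∑ ij ∈ antidiagonal k, (LSer.map
      (Q.XY ij.1 ∘ₗ TensorProduct.mk ℂ V V c) (Q.e M ij.2 m u) : LSer K2 (D2K V))).coeff (n - M) =
      emb₂ fun a => ∑ ij ∈ antidiagonal k, (vertexOp Q.X ij.1 c (divPow Q.D (a.1 - m)
        ((Q.e M ij.2 m u).coeff (n - M)))).coeff a.2 := by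
    intro m
    rw [← map_zpow₀, LSer.coeff_C_smul, LSer.coeff_sum, Finset.smul_sum]
    have : (fun a : ℤ × ℤ => ∑ ij ∈ antidiagonal k, (vertexOp Q.X ij.1 c (divPow Q.D (a.1 - m)
        ((Q.e M ij.2 m u).coeff (n - M)))).coeff a.2) = ∑ ij ∈ antidiagonal k,
        fun a : ℤ × ℤ => (vertexOp Q.X ij.1 c (divPow Q.D (a.1 - m)
        ((Q.e M ij.2 m u).coeff (n - M)))).coeff a.2 := by
      funext a; rw [Finset.sum_apply]
    rw [this, map_sum]
    refine Finset.sum_congr rfl fun ij _ => ?_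
    rw [LSer.coeff_map, LinearMap.comp_apply, TensorProduct.mk_apply, XY_apply, kz_zpow_smul_emb₂]
  rw [Finset.sum_congr rfl fun m _ => h2 m, ← map_sum]
  refine congrArg emb₂ (Dist.ext fun a => ?_)
  rw [Finset.sum_apply, Finset.sum_comm]
  have h3 : ∀ ij ∈ antidiagonal k, ∑ m ∈ s, (vertexOp Q.X ij.1 c (divPow Q.D (a.1 - m)
        ((Q.e M ij.2 m u).coeff (n - M)))).coeff a.2 = subst (fun p q =>
          Q.prodW ij.1 c ((x * (x - y)) ^ M • Q.X ij.2 u) (p, q, a.2)) a.1 n := by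
    intro ij hij
    rw [← LSer.coeff_sum, ← map_sum, hs ij hij]
    exact (subst_map ⟨0, fun p q h => hM ij hij p q h⟩
      ((LSer.coeffL a.2 : V1 V →ₗ[ℂ] V) ∘ₗ vertexOp Q.X ij.1 c) a.1 n).symm
  rw [Finset.sum_congr rfl h3]
  have h4 : ∀ t ⊆ antidiagonal k, ∑ ij ∈ t, subst (fun p q =>
      Q.prodW ij.1 c ((x * (x - y)) ^ M • Q.X ij.2 u) (p, q, a.2)) a.1 n = subst (fun p q =>
      (∑ ij ∈ t, Q.prodW ij.1 c ((x * (x - y)) ^ M • Q.X ij.2 u)) (p, q, a.2)) a.1 n := by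
    classical
    intro t
    induction t using Finset.induction_on with
    | empty =>
      intro _
      rw [Finset.sum_empty, Finset.sum_empty]
      exact (subst_map (V := V) (g := fun _ _ => 0) ⟨0, fun _ _ _ => rfl⟩ 0 a.1 n).symm
    | insert ij t hij ih =>
      intro ht
      rw [Finset.sum_insert hij, Finset.sum_insert hij,
        ih ((Finset.subset_insert _ _).trans ht)]
      exact (subst_add (hgb ij (ht (Finset.mem_insert_self _ _)) a.2)
        ((Submodule.sum_mem bddDist fun ij' h => hgb ij' (ht (Finset.mem_insert_of_mem h))) a.2)
        a.1 n).symm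
  exact h4 _ subset_rfl

end QuantumVertexAlgebra

end

/-! ## Consequences of the hexagon relation -/

section Nest

variable {V : Type*} [AddCommGroup V] [Module ℂ V]
variable {A : Type*} [CommRing A] [Algebra ℂ A]
variable {B : Type*} [CommRing B] [Algebra ℂ B]
variable {N : Type*} [AddCommGroup N] [Module ℂ N] [Module B N] [IsScalarTower ℂ B N]
variable {B' : Type*} [CommRing B'] [Algebra ℂ B']
variable {N' : Type*} [AddCommGroup N'] [Module ℂ N'] [Module B' N'] [IsScalarTower ℂ B' N']
variable (S : ℕ → V ⊗[ℂ] V →ₗ[ℂ] A ⊗[ℂ] (V ⊗[ℂ] V))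

theorem map_nest {ev₁ ev₂ : A →ₐ[ℂ] B} {ev₁' ev₂' : A →ₐ[ℂ] B'} (j : N →ₗ[ℂ] N')
    (h₁ : ∀ f v, j (ev₁ f • v) = ev₁' f • j v) (h₂ : ∀ f v, j (ev₂ f • v) = ev₂' f • j v)
    (Φ : ℕ → V ⊗[ℂ] (V ⊗[ℂ] V) →ₗ[ℂ] N) (k : ℕ) (u : V ⊗[ℂ] (V ⊗[ℂ] V)) :
    j (nest S ev₁ ev₂ Φ k u) = nest S ev₁' ev₂' (fun i => j ∘ₗ Φ i) k u := by
  simp only [nest_apply, map_sum]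
  refine Finset.sum_congr rfl fun ij _ => Finset.sum_congr rfl fun pq _ => ?_
  rw [map_evLift j h₂]
  congr 2
  exact LinearMap.ext fun w => map_evLift j h₁ _ _

theorem nest_sum {ι : Type*} (t : Finset ι) (ev₁ ev₂ : A →ₐ[ℂ] B)
    (Φ : ι → ℕ → V ⊗[ℂ] (V ⊗[ℂ] V) →ₗ[ℂ] N) (k : ℕ) (u : V ⊗[ℂ] (V ⊗[ℂ] V)) :
    nest S ev₁ ev₂ (fun i => ∑ m ∈ t, Φ m i) k u = ∑ m ∈ t, nest S ev₁ ev₂ (Φ m) k u := by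
  simp only [nest_apply]
  rw [Finset.sum_comm]
  refine Finset.sum_congr rfl fun ij _ => ?_
  rw [Finset.sum_comm]
  refine Finset.sum_congr rfl fun pq _ => ?_
  rw [← evLift_sum]
  congr 2
  refine LinearMap.ext fun w => ?_
  rw [LinearMap.sum_apply, LinearMap.comp_apply, evLift_sum]
  rfl

theorem nest_add (ev₁ ev₂ : A →ₐ[ℂ] B) (Φ Ψ : ℕ → V ⊗[ℂ] (V ⊗[ℂ] V) →ₗ[ℂ] N) (k : ℕ)
    (u : V ⊗[ℂ] (V ⊗[ℂ] V)) :
    nest S ev₁ ev₂ (fun i => Φ i + Ψ i) k u = nest S ev₁ ev₂ Φ k u + nest S ev₁ ev₂ Ψ k u := by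
  have h := nest_sum S Finset.univ ev₁ ev₂ ![Φ, Ψ] k u
  simpa [Fin.sum_univ_two] using h

/-- A further t-dependent map composed on the outside can be absorbed into the inner family, by
associativity of the Cauchy product. -/
theorem sum_nest (ev₁ ev₂ : A →ₐ[ℂ] B) (F : ℕ → ℕ → V ⊗[ℂ] (V ⊗[ℂ] V) →ₗ[ℂ] N) (k : ℕ)
    (u : V ⊗[ℂ] (V ⊗[ℂ] V)) :
    ∑ pr ∈ antidiagonal k, nest S ev₁ ev₂ (F pr.1) pr.2 u =
      nest S ev₁ ev₂ (fun n => ∑ pi ∈ antidiagonal n, F pi.1 pi.2) k u := by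
  have h : ∀ ij : ℕ × ℕ, ∑ pq ∈ antidiagonal ij.2, evLift ev₂
      (evLift ev₁ (∑ pi ∈ antidiagonal ij.1, F pi.1 pi.2) ∘ₗ braid₁₂ (S pq.1))
        (braid₁₃ (S pq.2) u) = ∑ pi ∈ antidiagonal ij.1, ∑ pq ∈ antidiagonal ij.2,
      evLift ev₂ (evLift ev₁ (F pi.1 pi.2) ∘ₗ braid₁₂ (S pq.1)) (braid₁₃ (S pq.2) u) := by
    intro ij
    rw [Finset.sum_comm]
    refine Finset.sum_congr rfl fun pq _ => ?_
    rw [← evLift_sum]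
    congr 2
    refine LinearMap.ext fun w => ?_
    rw [LinearMap.sum_apply, LinearMap.comp_apply, evLift_sum]
    rfl
  simp only [nest_apply, h]
  exact (sum_antidiagonal_assoc (fun p i r => ∑ pq ∈ antidiagonal r,
    evLift ev₂ (evLift ev₁ (F p i) ∘ₗ braid₁₂ (S pq.1)) (braid₁₃ (S pq.2) u)) k).symm

theorem evLift_mem_eventually {W X : Type*} [AddCommGroup W]
    [Module ℂ W] {l : Filter X} {ev : A →ₐ[ℂ] B} {ev' : A →ₐ[ℂ] B'} (T : AddSubgroup (N × N'))
    (h : ∀ f v, v ∈ T → (ev f • v.1, ev' f • v.2) ∈ T) (Φ : X → W →ₗ[ℂ] N) (Φ' : X → W →ₗ[ℂ] N')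
    (hΦ : ∀ w, ∀ᶠ x in l, (Φ x w, Φ' x w) ∈ T) (s : A ⊗[ℂ] W) :
    ∀ᶠ x in l, (evLift ev (Φ x) s, evLift ev' (Φ' x) s) ∈ T := by
  induction s with
  | zero => exact Eventually.of_forall fun x => by simp only [map_zero]; exact T.zero_mem
  | tmul g w =>
    filter_upwards [hΦ w] with x hx
    simpa using h g _ hx
  | add s t hs ht =>
    filter_upwards [hs, ht] with x hx hx'
    simpa using T.add_mem hx hx'

/-- The hypothesis holds for each vector only from some parameter on. A braided tensor is a finite
sum and finitely many t-degrees contribute, so finitely many eventual conditions are combined. -/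
theorem nest_mem_eventually {X : Type*} {l : Filter X} {ev₁ ev₂ : A →ₐ[ℂ] B}
    {ev₁' ev₂' : A →ₐ[ℂ] B'} (T : AddSubgroup (N × N'))
    (h₁ : ∀ f v, v ∈ T → (ev₁ f • v.1, ev₁' f • v.2) ∈ T)
    (h₂ : ∀ f v, v ∈ T → (ev₂ f • v.1, ev₂' f • v.2) ∈ T)
    (Φ : X → ℕ → V ⊗[ℂ] (V ⊗[ℂ] V) →ₗ[ℂ] N) (Φ' : X → ℕ → V ⊗[ℂ] (V ⊗[ℂ] V) →ₗ[ℂ] N')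
    (hΦ : ∀ i w, ∀ᶠ x in l, (Φ x i w, Φ' x i w) ∈ T) (k : ℕ) (u : V ⊗[ℂ] (V ⊗[ℂ] V)) :
    ∀ᶠ x in l, (nest S ev₁ ev₂ (Φ x) k u, nest S ev₁' ev₂' (Φ' x) k u) ∈ T := by
  have h : ∀ᶠ x in l, ∀ ij ∈ antidiagonal k, ∀ pq ∈ antidiagonal ij.2,
      (evLift ev₂ (evLift ev₁ (Φ x ij.1) ∘ₗ braid₁₂ (S pq.1)) (braid₁₃ (S pq.2) u),
        evLift ev₂' (evLift ev₁' (Φ' x ij.1) ∘ₗ braid₁₂ (S pq.1)) (braid₁₃ (S pq.2) u)) ∈ T := by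
    refine (Finset.eventually_all _).2 fun ij _ => (Finset.eventually_all _).2 fun pq _ => ?_
    have hin : ∀ w, ∀ᶠ x in l, ((evLift ev₁ (Φ x ij.1) ∘ₗ braid₁₂ (S pq.1)) w,
        (evLift ev₁' (Φ' x ij.1) ∘ₗ braid₁₂ (S pq.1)) w) ∈ T := fun w =>
      evLift_mem_eventually T h₁ (fun x => Φ x ij.1) (fun x => Φ' x ij.1) (hΦ ij.1)
        (braid₁₂ (S pq.1) w)
    exact evLift_mem_eventually T h₂ (fun x => evLift ev₁ (Φ x ij.1) ∘ₗ braid₁₂ (S pq.1))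
      (fun x => evLift ev₁' (Φ' x ij.1) ∘ₗ braid₁₂ (S pq.1)) hin _
  filter_upwards [h] with x hx
  rw [nest_apply, nest_apply, prod_mk_sum]
  refine T.sum_mem fun ij hij => ?_
  rw [prod_mk_sum]
  exact T.sum_mem fun pq hpq => hx ij hij pq hpq

end Nest

/-! ### Derivations whose commutator with a scalar is constant. -/

section Derivations

variable {L : Type*} [Field L] [Algebra ℂ L]
variable {M : Type*} [AddCommGroup M] [Module ℂ M] [Module L M] [IsScalarTower ℂ L M]

/-- The commutator of `T` with the scalar `a` is the complex number `r`. -/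
def HasComm (T : M →ₗ[ℂ] M) (a : L) (r : ℂ) : Prop := ∀ v, T (a • v) = a • T v + r • v

theorem HasComm.congr {T : M →ₗ[ℂ] M} {a : L} {r r' : ℂ} (h : HasComm T a r) (hr : r = r') :
    HasComm T a r' := hr ▸ h

theorem HasComm.add {T T' : M →ₗ[ℂ] M} {a : L} {r r' : ℂ} (h : HasComm T a r)
    (h' : HasComm T' a r') : HasComm (T + T') a (r + r') := fun v => by
  rw [LinearMap.add_apply, LinearMap.add_apply, h, h', smul_add, add_smul]; abel

theorem HasComm.sub {T T' : M →ₗ[ℂ] M} {a : L} {r r' : ℂ} (h : HasComm T a r)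
    (h' : HasComm T' a r') : HasComm (T - T') a (r - r') := fun v => by
  rw [LinearMap.sub_apply, LinearMap.sub_apply, h, h', smul_sub, sub_smul]; abel

theorem HasComm.add_scalar {T : M →ₗ[ℂ] M} {a a' : L} {r r' : ℂ} (h : HasComm T a r)
    (h' : HasComm T a' r') : HasComm T (a + a') (r + r') := fun v => by
  rw [add_smul, map_add, h, h', add_smul, add_smul]; abel

theorem hasComm_deriv_C (a : L) : HasComm (LSer.deriv : LSer L M →ₗ[ℂ] _) (LF.C a) 0 := fun f =>
  LSer.ext fun n => by
    simp only [LSer.coeff_deriv, LSer.coeff_C_smul, zero_smul, add_zero]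
    rw [smul_comm]

theorem hasComm_deriv_var : HasComm (LSer.deriv : LSer L M →ₗ[ℂ] _) (LF.var L) 1 := fun f =>
  LSer.ext fun n => by
    simp only [LSer.coeff_add, LSer.coeff_deriv, LSer.coeff_var_smul, one_smul]
    push_cast
    simp only [add_sub_cancel_right, sub_add_cancel]
    module

theorem HasComm.map {T : M →ₗ[ℂ] M} {a : L} {r : ℂ} (h : HasComm T a r) :
    HasComm (LSer.map T : LSer L M →ₗ[ℂ] LSer L M) (LF.C a) r := fun f =>
  LSer.ext fun n => by
    simp only [LSer.coeff_add, LSer.coeff_map, LSer.coeff_C_smul, LSer.coeff_smul]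
    rw [h]

theorem hasComm_map_var (T : M →ₗ[ℂ] M) :
    HasComm (LSer.map T : LSer L M →ₗ[ℂ] LSer L M) (LF.var L) 0 := fun f => by
  rw [LSer.map_var_smul, zero_smul, add_zero]

theorem HasComm.smul_comm {T : M →ₗ[ℂ] M} {a : L} (h : HasComm T a 0) (v : M) :
    T (a • v) = a • T v := by
  rw [h, zero_smul, add_zero]

theorem LSer.exp_smul {T : M →ₗ[ℂ] M} {a : L} (h : HasComm T a 0) (v : M) :
    (LSer.exp T (a • v) : LSer L M) = LF.C a • LSer.exp T v := LSer.ext fun n => by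
  rw [LSer.coeff_C_smul, LSer.coeff_exp_eq, LSer.coeff_exp_eq]
  exact (divPow_comp (S := T) (T := T) (fun v => a • v) (fun r v => smul_comm _ _ _)
    (smul_zero a) (fun v => (h.smul_comm v).symm) _ _).symm

theorem LSer.exp_smul_add {T : M →ₗ[ℂ] M} {a : L} (h : HasComm T a 1) (v : M) :
    (LSer.exp T (a • v) : LSer L M) = (LF.C a + LF.var L) • LSer.exp T v := LSer.ext fun n => by
  rw [add_smul, LSer.coeff_add, LSer.coeff_C_smul, LSer.coeff_var_smul, LSer.coeff_exp_eq,
    LSer.coeff_exp_eq, LSer.coeff_exp_eq]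
  exact divPow_leibniz (fun v => a • v) (fun r v => smul_comm _ _ _)
    (fun v => by rw [h, one_smul]) n v

end Derivations

/-! ### Evaluation of the braiding at w₂ = 0. -/

section Regularity

variable {L : Type*} [Field L] [Algebra ℂ L]

theorem LF.algebraMap_eq (r : ℂ) : algebraMap ℂ (LF L) r = LF.C (algebraMap ℂ L r) :=
  HahnSeries.algebraMap_apply

/-- A Laurent series with scalar coefficients as a vector. -/
def LF.toLSer (a : LF L) : LSer L L := LSer.mk a

theorem LF.coeff_mul_eq (a b : LF L) (n : ℤ) :
    (a * b).coeff n = (a • b.toLSer : LSer L L).coeff n := rfl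

/-- The value at zero of a Laurent series without negative powers. -/
def LF.HasValue (a : LF L) (v : L) : Prop := (∀ n < 0, a.coeff n = 0) ∧ a.coeff 0 = v

theorem LF.HasValue.add {a b : LF L} {v w : L} (ha : a.HasValue v) (hb : b.HasValue w) :
    (a + b).HasValue (v + w) :=
  ⟨fun n hn => by rw [LF.coeff_add, ha.1 n hn, hb.1 n hn, add_zero],
    by rw [LF.coeff_add, ha.2, hb.2]⟩

theorem LF.HasValue.mul {a b : LF L} {v w : L} (ha : a.HasValue v) (hb : b.HasValue w) :
    (a * b).HasValue (v * w) := by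
  have h := LSer.coeff_smul_of_nonneg (f := b.toLSer) ha.1 hb.1
  exact ⟨h.1, h.2.trans (congrArg₂ (· * ·) ha.2 hb.2)⟩

theorem LF.HasValue.inv {a b : LF L} {v w : L} (ha : a.HasValue v) (hab : a * b = 1)
    (hvw : v * w = 1) : b.HasValue w := by
  have h1 : (a • b.toLSer).IsReg := fun n hn => by
    rw [← LF.coeff_mul_eq, hab, ← map_one LF.C, LF.coeff_C, if_neg hn.ne]
  have hv : v ≠ 0 := left_ne_zero_of_mul_eq_one hvw
  have h2 : ∀ n < 0, b.coeff n = 0 := LSer.IsReg.of_smul ha.1 (by rw [ha.2]; exact hv) h1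
  refine ⟨h2, ?_⟩
  have h3 := (ha.mul ⟨h2, rfl⟩).2
  rw [hab, ← map_one LF.C, LF.coeff_C, if_pos rfl] at h3
  exact mul_left_cancel₀ hv (h3.symm.trans hvw.symm)

theorem hasValue_C (v : L) : (LF.C v).HasValue v :=
  ⟨fun n hn => by rw [LF.coeff_C, if_neg hn.ne], by rw [LF.coeff_C, if_pos rfl]⟩

theorem hasValue_var : (LF.var L).HasValue 0 :=
  ⟨fun n hn => by rw [LF.coeff_var, if_neg (by omega)], by rw [LF.coeff_var, if_neg (by omega)]⟩

/-- S_{u₁,u₂+w₂} is regular in w₂ and specializes to S_{u₁,u₂} at w₂ = 0. The case of inverses is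
harmless because the value of a unit is again a unit. -/
theorem ιr₂_hasValue (f : Aτ) : (ιr₂ f).HasValue (ι₁₂ f) := by
  induction f using Aτ.induction with
  | hC r =>
    rw [AlgHom.commutes, AlgHom.commutes, LF.algebraMap_eq]
    exact hasValue_C _
  | h₁ => rw [ιr₂, ι₁₂, evτ_τ₁, evτ_τ₁]; exact hasValue_C _
  | h₂ =>
    rw [ιr₂, ι₁₂, evτ_τ₂, evτ_τ₂]
    have h := (hasValue_C z₂).add (hasValue_var (L := L3))
    rwa [add_zero] at h
  | hadd f g hf hg => rw [map_add, map_add]; exact hf.add hg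
  | hmul f g hf hg => rw [map_mul, map_mul]; exact hf.mul hg
  | hunit f g hf hfg =>
    exact hf.inv (by rw [← map_mul, hfg, map_one]) (by rw [← map_mul, hfg, map_one])

/-- Substitution of `(z₁, z₂ + z₃)`, expanded in the region `|z₁| > |z₂| > |z₃|`. -/
def ιs : Aτ →ₐ[ℂ] L3 := evτ z₁ (z₂ + z₃) (by
  refine mul_ne_zero (mul_ne_zero z₁_ne (C_add_var_ne _)) ?_
  have h := C_sub_var_ne (x - y)
  rw [map_sub] at h
  rwa [← sub_sub])

/-- S_{u₁,u₂+w₁} does not involve w₂, so restriction to w₂ = 0 leaves it unchanged. -/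
theorem ιr₁_eq (f : Aτ) : ιr₁ f = LF.C (ιs f) := by
  induction f using Aτ.induction with
  | hC r => rw [AlgHom.commutes, AlgHom.commutes, LF.algebraMap_eq]
  | h₁ => rw [ιr₁, ιs, evτ_τ₁, evτ_τ₁]; rfl
  | h₂ => rw [ιr₁, ιs, evτ_τ₂, evτ_τ₂, map_add]; rfl
  | hadd f g hf hg => rw [map_add, map_add, map_add, hf, hg]
  | hmul f g hf hg => rw [map_mul, map_mul, map_mul, hf, hg]
  | hunit f g hf hfg =>
    have h1 : ιr₁ f * ιr₁ g = 1 := by rw [← map_mul, hfg, map_one]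
    have h2 : ιr₁ f * LF.C (ιs g) = 1 := by rw [hf, ← map_mul, ← map_mul, hfg, map_one, map_one]
    exact mul_left_cancel₀ (left_ne_zero_of_mul_eq_one h1) (h1.trans h2.symm)

end Regularity

/-! ### The differential operator attached to the hexagon relation. -/

section

variable {V : Type*} [AddCommGroup V] [Module ℂ V]

/-- The operator `∂_{u₂} + 1 ⊗ D` on `(V ⊗ V)((u₁))((u₂))`. -/
def dlt (D : V →ₗ[ℂ] V) : V2 (V ⊗[ℂ] V) →ₗ[ℂ] V2 (V ⊗[ℂ] V) :=
  LSer.deriv + map₂D (D.lTensor V)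

/-- The operator `∂_{w₁} + ∂_{w₂} - ∂_{u₂} - 1 ⊗ D` on
`(V ⊗ V)((u₁))((u₂))((w₁))((w₂))`. -/
def hexD (D : V →ₗ[ℂ] V) : V4 (V ⊗[ℂ] V) →ₗ[ℂ] V4 (V ⊗[ℂ] V) :=
  (LSer.map LSer.deriv + LSer.deriv) - LSer.map (LSer.map (dlt D))

theorem hasComm_dlt_x (D : V →ₗ[ℂ] V) : HasComm (dlt D) x 0 := by
  have h := (hasComm_deriv_C (M := V1 (V ⊗[ℂ] V)) (LF.var ℂ)).add
    ((hasComm_map_var (L := ℂ) (D.lTensor V)).map (L := L1))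
  rwa [add_zero] at h

theorem hasComm_dlt_y (D : V →ₗ[ℂ] V) : HasComm (dlt D) y 1 := by
  have h := (hasComm_deriv_var (L := L1) (M := V1 (V ⊗[ℂ] V))).add
    (hasComm_map_var (L := L1) (LSer.map (D.lTensor V)))
  rwa [add_zero] at h

theorem hasComm_hexD_u₁ (D : V →ₗ[ℂ] V) : HasComm (hexD D) u₁ 0 :=
  (((hasComm_deriv_C (M := V2 (V ⊗[ℂ] V)) x).map.add
    (hasComm_deriv_C (M := V3 (V ⊗[ℂ] V)) z₁)).sub ((hasComm_dlt_x D).map.map)).congr (by norm_num)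

theorem hasComm_hexD_u₂ (D : V →ₗ[ℂ] V) : HasComm (hexD D) u₂ (-1) :=
  (((hasComm_deriv_C (M := V2 (V ⊗[ℂ] V)) y).map.add
    (hasComm_deriv_C (M := V3 (V ⊗[ℂ] V)) z₂)).sub ((hasComm_dlt_y D).map.map)).congr (by norm_num)

theorem hasComm_hexD_w₁ (D : V →ₗ[ℂ] V) : HasComm (hexD D) w₁ 1 :=
  (((hasComm_deriv_var (L := L2) (M := V2 (V ⊗[ℂ] V))).map.add
    (hasComm_deriv_C (M := V3 (V ⊗[ℂ] V)) z₃)).sub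
      ((hasComm_map_var (L := L2) (dlt D)).map)).congr (by norm_num)

theorem hasComm_hexD_w₂ (D : V →ₗ[ℂ] V) : HasComm (hexD D) w₂ 1 :=
  (((hasComm_map_var (L := L3) (LSer.deriv : V3 (V ⊗[ℂ] V) →ₗ[ℂ] _)).add
    (hasComm_deriv_var (L := L3) (M := V3 (V ⊗[ℂ] V)))).sub
      (hasComm_map_var (L := L3) (LSer.map (dlt D)))).congr (by norm_num)

/-- The derivative in w₁ cancels that in u₂ on functions of u₂ + w₁, and u₁ is not differentiated at
all. -/
theorem hexD_ιr₁ (D : V →ₗ[ℂ] V) (f : Aτ) (v : V4 (V ⊗[ℂ] V)) :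
    hexD D (ιr₁ f • v) = ιr₁ f • hexD D v := by
  refine Aτ.map_smul (ev := ιr₁) (ev' := ιr₁) (hexD D) ?_ ?_ f v
  · rw [ιr₁, evτ_τ₁]; exact (hasComm_hexD_u₁ D).smul_comm
  · have h := (hasComm_hexD_u₂ D).add_scalar (hasComm_hexD_w₁ D)
    rw [neg_add_cancel] at h
    rw [ιr₁, evτ_τ₂]; exact h.smul_comm

theorem hexD_ιr₂ (D : V →ₗ[ℂ] V) (f : Aτ) (v : V4 (V ⊗[ℂ] V)) :
    hexD D (ιr₂ f • v) = ιr₂ f • hexD D v := by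
  refine Aτ.map_smul (ev := ιr₂) (ev' := ιr₂) (hexD D) ?_ ?_ f v
  · rw [ιr₂, evτ_τ₁]; exact (hasComm_hexD_u₁ D).smul_comm
  · have h := (hasComm_hexD_u₂ D).add_scalar (hasComm_hexD_w₂ D)
    rw [neg_add_cancel] at h
    rw [ιr₂, evτ_τ₂]; exact h.smul_comm

/-- ∂_{w₁} and ∂_{w₂} act on the argument, while ∂_{u₂} + 1⊗D passes through φ as D; what is left on
the argument is ∂₁+∂₂-D. -/
theorem hexD_map₂ {D : V →ₗ[ℂ] V} (φ : V →ₗ[ℂ] V2 (V ⊗[ℂ] V))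
    (h : ∀ v, dlt D (φ v) = φ (D v)) (f : V2 V) :
    hexD D (map₂ φ f) = map₂ φ (nab D f) := by
  refine LSer.ext fun q => LSer.ext fun p => ?_
  have hc : ∀ (g : V2 V) (p q : ℤ), ((map₂ φ g).coeff q).coeff p = φ (cf g p q) :=
    fun _ _ _ => rfl
  rw [hc, LinearMap.sub_apply, cf_sub, cf_tot, cf_map₂D, map_sub, map_add, map_smul, map_smul]
  simp only [hexD, LinearMap.sub_apply, LinearMap.add_apply, LSer.coeff_sub, LSer.coeff_add,
    LSer.coeff_map, LSer.coeff_deriv, LSer.coeff_smul, hc, h]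

theorem dlt_const₂ (D : V →ₗ[ℂ] V) (w : V ⊗[ℂ] V) :
    dlt D (const₂ w) = const₂ (D.lTensor V w) := by
  refine V2.ext fun p q => ?_
  have h1 : cf (LSer.deriv (const₂ w)) p q = 0 := by
    change ((LSer.deriv (const₂ w)).coeff q).coeff p = 0
    rw [LSer.coeff_deriv, LSer.coeff_smul]
    change _ • cf (const₂ w) p (q + 1) = 0
    rw [cf_const₂]
    by_cases hq : q = -1
    · subst hq; simp
    · rw [if_neg (by omega), smul_zero]
  rw [dlt, LinearMap.add_apply, cf_add, h1, zero_add, cf_map₂D, cf_const₂, cf_const₂]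
  split_ifs
  · rfl
  · rw [map_zero]

theorem dlt_const₂_tmul (D : V →ₗ[ℂ] V) (c v : V) :
    dlt D ((const₂ ∘ₗ TensorProduct.mk ℂ V V c) v) =
      (const₂ ∘ₗ TensorProduct.mk ℂ V V c) (D v) := by
  rw [LinearMap.comp_apply, dlt_const₂]
  rfl

theorem divPow_hexD_map₂ {D : V →ₗ[ℂ] V} (φ : V →ₗ[ℂ] V2 (V ⊗[ℂ] V))
    (h : ∀ v, dlt D (φ v) = φ (D v)) (m : ℤ) (f : V2 V) :
    divPow (hexD D) m (map₂ φ f) = map₂ φ (divPow (nab D) m f) :=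
  (divPow_comp (map₂ φ) (map_smul _) (map_zero _) (fun f => (hexD_map₂ φ h f).symm) m f).symm

theorem divPow_hexD_smul {D : V →ₗ[ℂ] V} {a : L4} (h : ∀ v, hexD D (a • v) = a • hexD D v)
    (m : ℤ) (v : V4 (V ⊗[ℂ] V)) : divPow (hexD D) m (a • v) = a • divPow (hexD D) m v :=
  (divPow_comp (S := hexD D) (T := hexD D) (fun v => a • v) (fun _ _ => smul_comm _ _ _)
    (smul_zero a) (fun v => (h v).symm) m v).symm

/-- Restriction to `w₂ = 0`. -/
def regRel₄ (W : Type*) [AddCommGroup W] [Module ℂ W] : AddSubgroup (V4 W × V3 W) where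
  carrier := {v | v.1.IsReg ∧ v.1.coeff 0 = v.2}
  zero_mem' := ⟨fun n _ => by simp, by simp⟩
  add_mem' := by
    rintro v w ⟨h1, h2⟩ ⟨h1', h2'⟩
    exact ⟨fun n hn => by rw [Prod.fst_add, LSer.coeff_add, h1 n hn, h1' n hn, add_zero],
      by rw [Prod.fst_add, LSer.coeff_add, h2, h2']; rfl⟩
  neg_mem' := by
    rintro v ⟨h1, h2⟩
    exact ⟨fun n hn => by rw [Prod.fst_neg, LSer.coeff_neg, h1 n hn, neg_zero],
      by rw [Prod.fst_neg, LSer.coeff_neg, h2]; rfl⟩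

theorem regRel₄_smul {W : Type*} [AddCommGroup W] [Module ℂ W] {a : L4} {b : L3}
    (h : a.HasValue b) (v : V4 W × V3 W) (hv : v ∈ regRel₄ W) :
    (a • v.1, b • v.2) ∈ regRel₄ W := by
  have h1 := LSer.coeff_smul_of_nonneg h.1 hv.1
  exact ⟨h1.1, by rw [h1.2, h.2, hv.2]⟩

end

/-! ### The hexagon relation for the translated multiplication. -/

section

variable {V : Type*} [AddCommGroup V] [Module ℂ V] (Q : QuantumVertexAlgebra V)

namespace QuantumVertexAlgebra

theorem oneX_tmul (i : ℕ) (c : V) (u : V ⊗[ℂ] V) :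
    oneX Q.X i (c ⊗ₜ u) = map₂ (const₂ ∘ₗ TensorProduct.mk ℂ V V c) (Q.X i u) := rfl

theorem braid_eq (k : ℕ) (c v : V) : braid Q.Sτ k c v = evLift ι const₂ (Q.Sτ k (c ⊗ₜ v)) := rfl

theorem hexagon_nest (k : ℕ) (a b c : V) :
    ∑ ij ∈ antidiagonal k, map₂ (braid Q.Sτ ij.1 a) (Q.X ij.2 (b ⊗ₜ c)) =
      nest Q.Sτ ιr₁ ιr₂ (oneX Q.X) k (a ⊗ₜ (b ⊗ₜ c)) :=
  (Q.hexagon_right k a b c).trans (sum_op_mul_op _ _ _ _ _ _)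

/-- The hexagon relation at `z₂ = 0`. -/
theorem hexagon_zero {Ψ : ℕ → V ⊗[ℂ] (V ⊗[ℂ] V) →ₗ[ℂ] V4 (V ⊗[ℂ] V)}
    {Ψ₀ : ℕ → V ⊗[ℂ] (V ⊗[ℂ] V) →ₗ[ℂ] V3 (V ⊗[ℂ] V)}
    (h : ∀ i w, (Ψ i w, Ψ₀ i w) ∈ regRel₄ (V ⊗[ℂ] V)) (k : ℕ) (u : V ⊗[ℂ] (V ⊗[ℂ] V)) :
    (nest Q.Sτ ιr₁ ιr₂ Ψ k u).coeff 0 = nest Q.Sτ ιs ι₁₂ Ψ₀ k u := by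
  have h1 := nest_mem_eventually (X := Unit) (l := ⊤) Q.Sτ (ev₁ := ιr₁) (ev₂ := ιr₂) (ev₁' := ιs)
    (ev₂' := ι₁₂) (regRel₄ (V ⊗[ℂ] V))
    (fun f => regRel₄_smul (by rw [ιr₁_eq]; exact hasValue_C _))
    (fun f => regRel₄_smul (ιr₂_hasValue f)) (fun _ => Ψ) (fun _ => Ψ₀)
    (fun i w => Eventually.of_forall fun _ => h i w) k u
  exact (eventually_top.1 h1 ()).2

/-- e^{w₁(∂_{u₂}+1⊗D)} translates u₂ to u₂ + w₁ in scalar functions. -/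
theorem expDlt_smul (D : V →ₗ[ℂ] V) (f : Aτ) (v : V2 (V ⊗[ℂ] V)) :
    (LSer.exp (dlt D) (ι f • v) : V3 (V ⊗[ℂ] V)) = ιs f • LSer.exp (dlt D) v := by
  refine Aτ.map_smul (ev := ι) (ev' := ιs)
    (LSer.exp (dlt D) : V2 (V ⊗[ℂ] V) →ₗ[ℂ] V3 (V ⊗[ℂ] V)) ?_ ?_ f v
  · rw [ι, ιs, evτ_τ₁, evτ_τ₁]; exact LSer.exp_smul (hasComm_dlt_x D)
  · rw [ι, ιs, evτ_τ₂, evτ_τ₂]; exact LSer.exp_smul_add (hasComm_dlt_y D)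

theorem map_exp_eq {D : V →ₗ[ℂ] V} (φ : V →ₗ[ℂ] V2 (V ⊗[ℂ] V))
    (h : ∀ v, dlt D (φ v) = φ (D v)) (v : V) :
    LSer.map φ (LSer.exp D v : V1 V) = (LSer.exp (dlt D) (φ v) : V3 (V ⊗[ℂ] V)) :=
  LSer.ext fun n => by
    rw [LSer.coeff_map, LSer.coeff_exp_eq, LSer.coeff_exp_eq]
    exact divPow_comp φ (map_smul φ) (map_zero φ) (fun v => (h v).symm) n v

theorem divPow_one {M : Type*} [AddCommGroup M] [Module ℂ M] (T : M →ₗ[ℂ] M) :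
    divPow T 1 = T := by
  have h := divPow_natCast T 1
  simpa using h

theorem X_one (k : ℕ) (v : V) :
    Q.X k (v ⊗ₜ Q.one) = if k = 0 then LSer.const (LSer.exp Q.D v) else 0 := Q.vacuum_right k v

theorem oneX_one (i : ℕ) (c v : V) : oneX Q.X i (c ⊗ₜ (v ⊗ₜ Q.one)) =
    if i = 0 then map₂ (const₂ ∘ₗ TensorProduct.mk ℂ V V c) (LSer.const (LSer.exp Q.D v)) else 0 := by
  rw [oneX_tmul, X_one]
  split_ifs
  · rfl
  · rw [map_zero]

/-- The hexagon relation for a vacuum factor. -/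
theorem hexagon_one (k : ℕ) (c v : V) :
    map₂ (braid Q.Sτ k c) (LSer.const (LSer.exp Q.D v)) =
      evLift ιr₁ (oneX Q.X 0 ∘ₗ ins₁₂ Q.one) (Q.Sτ k (c ⊗ₜ v)) := by
  have h := Q.hexagon_nest k c v Q.one
  have h1 : ∑ ij ∈ antidiagonal k, map₂ (braid Q.Sτ ij.1 c) (Q.X ij.2 (v ⊗ₜ Q.one)) =
      map₂ (braid Q.Sτ k c) (LSer.const (LSer.exp Q.D v)) := by
    rw [Finset.sum_eq_single (k, 0)]
    · rw [X_one, if_pos rfl]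
    · intro ij hij hne
      rw [X_one, if_neg, map_zero]
      intro h0
      have := mem_antidiagonal.1 hij
      exact hne (Prod.ext (by simp; omega) h0)
    · intro hn
      exact absurd (mem_antidiagonal.2 (add_zero k)) hn
  -- Only one t-degree distribution survives: X with a vacuum factor lives in degree 0, and so does
  -- S¹³ with the vacuum in the third position.
  rw [← h1, h, nest_apply, Finset.sum_eq_single (0, k)]
  · rw [Finset.sum_eq_single (k, 0)]
    · rw [braid₁₃_tmul, Q.braid_vacuum_right, if_pos rfl, LinearMap.lTensor_tmul, evLift_tmul,
        map_one, one_smul, ins₁₃_tmul, LinearMap.comp_apply, braid₁₂_tmul, evLift_lTensor]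
    · intro pq hpq hne
      rw [braid₁₃_tmul, Q.braid_vacuum_right, if_neg, map_zero, map_zero]
      intro h0
      have := mem_antidiagonal.1 hpq
      exact hne (Prod.ext (by simp at this ⊢; omega) h0)
    · intro hn
      exact absurd (mem_antidiagonal.2 (add_zero k)) hn
  · intro ij hij hne
    refine Finset.sum_eq_zero fun pq _ => ?_
    have hi : ij.1 ≠ 0 := fun h0 => by
      have := mem_antidiagonal.1 hij
      exact hne (Prod.ext h0 (by simp; omega))
    have hz : oneX Q.X ij.1 ∘ₗ ins₁₂ Q.one = 0 := TensorProduct.ext' fun c' v' => by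
      rw [LinearMap.comp_apply, ins₁₂_tmul, oneX_one, if_neg hi]
      rfl
    rw [braid₁₃_tmul, Q.braid_vacuum_right]
    split_ifs
    · rw [LinearMap.lTensor_tmul, evLift_tmul, ins₁₃_tmul, LinearMap.comp_apply, braid₁₂_tmul,
        evLift_lTensor, hz]
      have h0 := evLift_sum ∅ ιr₁ (fun _ : Unit => (0 : V ⊗[ℂ] V →ₗ[ℂ] V4 (V ⊗[ℂ] V)))
        (Q.Sτ pq.1 (c ⊗ₜ v))
      rw [Finset.sum_empty, Finset.sum_empty] at h0
      rw [h0, smul_zero]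
    · rw [map_zero, map_zero]
  · intro hn
    exact absurd (mem_antidiagonal.2 (zero_add k)) hn

/-- The braiding intertwines `D` with `∂_{u₂} + 1 ⊗ D`. -/
theorem dlt_braid (k : ℕ) (c v : V) :
    dlt Q.D (braid Q.Sτ k c v) = braid Q.Sτ k c (Q.D v) := by
  have h := congrArg (fun F => LSer.coeff F 0) (Q.hexagon_one k c v)
  have h1 : (map₂ (braid Q.Sτ k c) (LSer.const (LSer.exp Q.D v))).coeff 0 =
      (LSer.map (braid Q.Sτ k c) (LSer.exp Q.D v : V1 V) : V3 (V ⊗[ℂ] V)) := by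
    change LSer.map (braid Q.Sτ k c) ((LSer.const (LSer.exp Q.D v) : V2 V).coeff 0) = _
    rw [LSer.coeff_const, if_pos rfl]
  have h2 : (evLift ιr₁ (oneX Q.X 0 ∘ₗ ins₁₂ Q.one) (Q.Sτ k (c ⊗ₜ v))).coeff 0 =
      (LSer.exp (dlt Q.D) (braid Q.Sτ k c v) : V3 (V ⊗[ℂ] V)) := by
    have h3 := map_evLift (ev := ιr₁) (ev' := ιs) (LSer.coeffL 0 : V4 (V ⊗[ℂ] V) →ₗ[ℂ] _)
      (fun f v => by rw [ιr₁_eq]; exact LSer.coeff_C_smul _ _ _)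
      (oneX Q.X 0 ∘ₗ ins₁₂ Q.one) (Q.Sτ k (c ⊗ₜ v))
    rw [LSer.coeffL_apply] at h3
    rw [h3, braid_eq, map_evLift (ev := ι) (ev' := ιs) _ (expDlt_smul Q.D)]
    congr 2
    refine TensorProduct.ext' fun c' v' => ?_
    rw [LinearMap.comp_apply, LinearMap.comp_apply, ins₁₂_tmul, oneX_one, if_pos rfl,
      LSer.coeffL_apply]
    change LSer.map (const₂ ∘ₗ TensorProduct.mk ℂ V V c')
      ((LSer.const (LSer.exp Q.D v') : V2 V).coeff 0) = _
    rw [LSer.coeff_const, if_pos rfl]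
    exact map_exp_eq _ (dlt_const₂_tmul Q.D c') v'
  rw [h1, h2] at h
  -- The relation now reads S(c ⊗ e^{w₁D}v) = e^{w₁(∂_{u₂}+1⊗D)}S(c ⊗ v); the terms linear in w₁
  -- give the claim.
  have h4 := congrArg (fun F => LSer.coeff F 1) h
  simp only [LSer.coeff_map, LSer.coeff_exp_eq, divPow_one] at h4
  exact h4.symm

/-- `c ⊗ u ↦ 1 ⊗ c ⊗ h(u)` for `h : V ⊗ V → V((z₃))`. -/
def insert (h : V ⊗[ℂ] V →ₗ[ℂ] V1 V) : V ⊗[ℂ] (V ⊗[ℂ] V) →ₗ[ℂ] V3 (V ⊗[ℂ] V) :=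
  TensorProduct.lift ((LSer.map ∘ₗ LinearMap.llcomp ℂ V (V ⊗[ℂ] V) (V2 (V ⊗[ℂ] V)) const₂ ∘ₗ
    TensorProduct.mk ℂ V V).compl₂ h)

theorem insert_tmul (h : V ⊗[ℂ] V →ₗ[ℂ] V1 V) (c : V) (u : V ⊗[ℂ] V) :
    insert h (c ⊗ₜ u) = LSer.map (const₂ ∘ₗ TensorProduct.mk ℂ V V c) (h u) := rfl

/-- Apply the m-th divided power of `hexD` to the hexagon relation. By `dlt_braid` it becomes that
of ∂₁+∂₂-D on X on the left, and on the right it moves past both braidings. Setting w₂ = 0 then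
produces the coefficient of γᵐ in G. -/
theorem hexagon_G (k : ℕ) (m : ℤ) (a b c : V) :
    ∑ ij ∈ antidiagonal k,
      (LSer.map (braid Q.Sτ ij.1 c) ((Q.G ij.2 (a ⊗ₜ b)).coeff m) : V3 (V ⊗[ℂ] V)) =
      nest Q.Sτ ιs ι₁₂ (fun i => insert (LSer.coeffL m ∘ₗ Q.G i)) k (c ⊗ₜ (a ⊗ₜ b)) := by
  have h := congrArg (fun F => (divPow (hexD Q.D) m F).coeff 0) (Q.hexagon_nest k c a b)
  have hG : ∀ i u, (Q.G i u).coeff m = (divPow (nab Q.D) m (Q.X i u)).coeff 0 := fun i u => by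
    rw [← LSer.coeff_exp_eq (L := L2)]; rfl
  simp only [map_sum, divPow_hexD_map₂ _ (Q.dlt_braid _ c)] at h
  rw [map_nest Q.Sτ (divPow (hexD Q.D) m) (fun f => divPow_hexD_smul (hexD_ιr₁ Q.D f) m)
    (fun f => divPow_hexD_smul (hexD_ιr₂ Q.D f) m), LSer.coeff_sum] at h
  simp only [hG]
  refine h.trans (Q.hexagon_zero (fun i w => ?_) k _)
  induction w with
  | zero => rw [map_zero, map_zero]; exact (regRel₄ _).zero_mem
  | add w w' hw hw' => rw [map_add, map_add]; exact (regRel₄ _).add_mem hw hw'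
  | tmul c' u =>
    rw [LinearMap.comp_apply, oneX_tmul, divPow_hexD_map₂ _ (dlt_const₂_tmul Q.D c'), insert_tmul]
    refine ⟨fun n hn => ?_, ?_⟩
    · change LSer.map _ ((divPow (nab Q.D) m (Q.X i u)).coeff n) = 0
      rw [LSer.IsReg.divPow (fun f => isReg_nab Q.D) (Q.isReg_X i u) m n hn, map_zero]
    · rw [LinearMap.comp_apply, LSer.coeffL_apply, hG]
      rfl

theorem e_zero (k : ℕ) (m : ℤ) : Q.e 0 k m = LSer.coeffL m ∘ₗ Q.G k :=
  LinearMap.ext fun u => by rw [e_apply, pow_zero, one_smul]; rfl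

theorem e_succ (M k : ℕ) (m : ℤ) (u : V ⊗[ℂ] V) :
    Q.e (M + 1) k m u = LF.var ℂ • Q.e M k m u + Q.e M k (m - 1) u := by
  rw [e_apply, e_apply, e_apply, pow_succ', mul_smul, add_smul, LSer.coeff_add]
  rw [y, LSer.coeff_var_smul]
  nth_rewrite 1 [x]
  rw [LSer.coeff_C_smul]

/-- The hexagon relation for the coefficients of `(z₁ + γ)ᴹ e^{γ(∂₁ + ∂₂ - D)} X_{z₁,z₂}`. -/
theorem hexagon_e (M k : ℕ) (m : ℤ) (a b c : V) :
    ∑ ij ∈ antidiagonal k,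
      (LSer.map (braid Q.Sτ ij.1 c) (Q.e M ij.2 m (a ⊗ₜ b)) : V3 (V ⊗[ℂ] V)) =
      nest Q.Sτ ιs ι₁₂ (fun i => insert (Q.e M i m)) k (c ⊗ₜ (a ⊗ₜ b)) := by
  induction M generalizing m with
  | zero => simp only [e_zero]; exact Q.hexagon_G k m a b c
  | succ M ih =>
    -- Raising M by one multiplies by z₁ + γ: the first summand multiplies the coefficient by the
    -- series variable, which is z₃ here, and the second shifts the exponent of γ.
    let Z : V3 (V ⊗[ℂ] V) →ₗ[ℂ] V3 (V ⊗[ℂ] V) := DistribSMul.toLinearMap ℂ _ z₃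
    have hZ : ∀ v, Z v = z₃ • v := fun _ => rfl
    have h1 : ∀ φ : V →ₗ[ℂ] V2 (V ⊗[ℂ] V), ∀ i u, (LSer.map φ (Q.e (M + 1) i m u) :
        V3 (V ⊗[ℂ] V)) = Z (LSer.map φ (Q.e M i m u)) + LSer.map φ (Q.e M i (m - 1) u) := by
      intro φ i u
      rw [e_succ, map_add, LSer.map_var_smul]
      rfl
    have h2 : ∀ i, insert (Q.e (M + 1) i m) =
        Z ∘ₗ insert (Q.e M i m) + insert (Q.e M i (m - 1)) := fun i =>
      TensorProduct.ext' fun c u => h1 _ i u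
    simp only [h1, h2, Finset.sum_add_distrib]
    rw [nest_add, ← map_nest Q.Sτ Z (fun f v => smul_comm _ _ _) (fun f v => smul_comm _ _ _),
      ← map_sum, ih, ih]

end QuantumVertexAlgebra

end

/-! ## The hexagon relation over the field of rational functions -/

section

variable {W : Type*} [AddCommGroup W] [Module ℂ W]
variable {W' : Type*} [AddCommGroup W'] [Module ℂ W']

/-- Laurent polynomials commute with coefficientwise maps by inspection; fractions follow, since the
denominator acts injectively on the target. -/
theorem map₂_expK_smul (φ : W →ₗ[ℂ] W') (f : K2) (v : V2 W) :
    (LSer.map (LSer.map φ) (expK f • v) : V2 W') = expK f • (LSer.map (LSer.map φ) v : V2 W') := by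
  let j : V2 W →ₗ[ℂ] V2 W' := LSer.map (LSer.map φ)
  have hj : ∀ v p q, cf (j v) p q = φ (cf v p q) := fun _ _ _ => rfl
  have h1 : ∀ (r : R2) (v : V2 W), j (expK (algebraMap R2 K2 r) • v) =
      expK (algebraMap R2 K2 r) • j v := by
    have he : ∀ r : R2, expK (algebraMap R2 K2 r) = evR2 y x y_ne x_ne r := fun r => by
      simp [expK]
    intro r v
    rw [he]
    refine map_laurent_smul (evR2 y x y_ne x_ne) (evR2 y x y_ne x_ne) j (fun g v => ?_) r v
    refine V2.ext fun p q => ?_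
    rw [evR2_mono, mul_smul, mul_smul, hj]
    simp only [cf_y_zpow_smul, cf_x_zpow_smul, hj]
  obtain ⟨r, s, hs, rfl⟩ := IsFractionRing.div_surjective (A := R2) f
  have hs0 : expK (algebraMap R2 K2 s) ≠ 0 := by
    refine (map_ne_zero expK).2 ((map_ne_zero_iff _ (IsFractionRing.injective R2 K2)).2 ?_)
    exact nonZeroDivisors.ne_zero hs
  have h2 := h1 s (expK (algebraMap R2 K2 r / algebraMap R2 K2 s) • v)
  have hs1 : algebraMap R2 K2 s ≠ 0 := fun h => hs0 (by rw [h, map_zero])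
  have h3 : expK (algebraMap R2 K2 r) =
      expK (algebraMap R2 K2 s) * expK (algebraMap R2 K2 r / algebraMap R2 K2 s) := by
    rw [← map_mul, mul_div_cancel₀ _ hs1]
  rw [smul_smul, ← h3, h1, h3, mul_smul] at h2
  exact ((smul_right_injective _ hs0) h2).symm

/-- The expansion of rational functions with coefficients in `W` in the region `|w| > |z₂|`. -/
def expKW : K2 ⊗[ℂ] W →ₗ[ℂ] V2 W := evLift expK const₂

theorem expKW_smul (f : K2) (s : K2 ⊗[ℂ] W) : expKW (f • s) = expK f • expKW s :=
  evLift_smul _ _ _ _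

/-- In a basis of W the coordinates of the expansion are the expansions of the coordinates, and a
homomorphism out of a field is injective. -/
theorem expKW_injective : Function.Injective (expKW (W := W)) := by
  refine (injective_iff_map_eq_zero _).2 fun s hs => ?_
  let b := Module.Basis.ofVectorSpace ℂ W
  let B := Algebra.TensorProduct.basis K2 b
  have h : ∀ (s : K2 ⊗[ℂ] W) i, (LSer.map (LSer.map (b.coord i)) (expKW s) : V2 ℂ) =
      expK (B.repr s i) • const₂ 1 := by
    intro s i
    induction s with
    | zero => simp
    | add s t hs ht =>
      simp only [map_add, hs, ht, Finsupp.add_apply, add_smul]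
    | tmul f w =>
      have h1 : B.repr (f ⊗ₜ w) i = f * algebraMap ℂ K2 (b.repr w i) := by
        simp [B, Algebra.TensorProduct.basis_repr_tmul]
      have h2 : (LSer.map (LSer.map (b.coord i)) (const₂ w) : V2 ℂ) =
          b.repr w i • (const₂ 1 : V2 ℂ) := by
        refine V2.ext fun p q => ?_
        change b.coord i (cf (const₂ w) p q) = cf (b.repr w i • (const₂ 1 : V2 ℂ)) p q
        rw [cf_smul, cf_const₂, cf_const₂]
        split_ifs <;> simp
      rw [h1, expKW, evLift_tmul, map₂_expK_smul, map_mul, mul_smul, AlgHom.commutes,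
        algebraMap_smul, h2]
  refine B.repr.injective (Finsupp.ext fun i => ?_)
  rw [map_zero, Finsupp.zero_apply]
  have h1 := h s i
  rw [hs, map_zero] at h1
  have h2 : (const₂ (1 : ℂ)) ≠ 0 := fun h0 => by
    have := congrArg (fun f => cf f 0 0) h0
    simp at this
  exact (map_eq_zero expK).1 ((smul_eq_zero.1 h1.symm).resolve_right h2)

theorem mapExpKW_injective :
    Function.Injective (LSer.map (expKW (W := W)) : LSer K2 (K2 ⊗[ℂ] W) →ₗ[ℂ] V3 W) := by
  intro f g h
  refine LSer.ext fun n => expKW_injective ?_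
  exact congrArg (fun F => LSer.coeff F n) h

/-- The evaluation `(τ₁, τ₂) = (w, z₂ + z₃)`. -/
def evN₁ : Aτ →ₐ[ℂ] LF K2 := evτ (LF.C kw) shiftVar (by
  refine mul_ne_zero (mul_ne_zero (C_ne kw_ne) shiftVar_ne) ?_
  rw [shiftVar, ← sub_sub, ← map_sub]
  exact C_sub_var_ne _)

/-- The evaluation `(τ₁, τ₂) = (w, z₂)`. -/
def evN₂ : Aτ →ₐ[ℂ] LF K2 := evτ (LF.C kw) (LF.C kz) (by
  refine mul_ne_zero (mul_ne_zero (C_ne kw_ne) (C_ne kz_ne)) ?_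
  rw [← map_sub]
  exact C_ne kw_sub_kz_ne)

section

variable {L' : Type*} [Field L'] [Algebra ℂ L'] {M M' : Type*} [AddCommGroup M] [Module ℂ M]
  [Module K2 M] [IsScalarTower ℂ K2 M] [AddCommGroup M'] [Module ℂ M'] [Module L' M']
  [IsScalarTower ℂ L' M']

theorem map_evN₁_smul {ev : Aτ →ₐ[ℂ] LF L'} (j : M →ₗ[ℂ] M') {p q : L'}
    (hw : ∀ v, j (kw • v) = p • j v) (hz : ∀ v, j (kz • v) = q • j v)
    (h₁ : ev τ₁ = LF.C p) (h₂ : ev τ₂ = LF.C q + LF.var L') (f : Aτ) (v : LSer K2 M) :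
    (LSer.map j (evN₁ f • v) : LSer L' M') = ev f • LSer.map j v := by
  refine Aτ.map_smul (ev := evN₁) (ev' := ev) (LSer.map j : LSer K2 M →ₗ[ℂ] LSer L' M')
    (fun v => ?_) (fun v => ?_) f v
  · rw [evN₁, evτ_τ₁, h₁, LSer.map_C_smul _ _ _ hw]
  · rw [evN₁, evτ_τ₂, h₂, shiftVar, add_smul, add_smul, map_add, LSer.map_C_smul _ _ _ hz,
      LSer.map_var_smul]

theorem map_evN₂_smul {ev : Aτ →ₐ[ℂ] LF L'} (j : M →ₗ[ℂ] M') {p q : L'}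
    (hw : ∀ v, j (kw • v) = p • j v) (hz : ∀ v, j (kz • v) = q • j v)
    (h₁ : ev τ₁ = LF.C p) (h₂ : ev τ₂ = LF.C q) (f : Aτ) (v : LSer K2 M) :
    (LSer.map j (evN₂ f • v) : LSer L' M') = ev f • LSer.map j v := by
  refine Aτ.map_smul (ev := evN₂) (ev' := ev) (LSer.map j : LSer K2 M →ₗ[ℂ] LSer L' M')
    (fun v => ?_) (fun v => ?_) f v
  · rw [evN₂, evτ_τ₁, h₁, LSer.map_C_smul _ _ _ hw]
  · rw [evN₂, evτ_τ₂, h₂, LSer.map_C_smul _ _ _ hz]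

end

theorem expK_evK (f : Aτ) : expK (evK f) = ι f := by
  have h := Aτ.map_smul (ev := evK) (ev' := ι) (N := K2) (N' := L2) expK.toLinearMap
    (fun v => by
      change expK (evK τ₁ * v) = ι τ₁ * expK v
      rw [map_mul, evK, ι, evτ_τ₁, evτ_τ₁, expK_kw])
    (fun v => by
      change expK (evK τ₂ * v) = ι τ₂ * expK v
      rw [map_mul, evK, ι, evτ_τ₂, evτ_τ₂, expK_kz]) f 1
  change expK (evK f * 1) = ι f * expK 1 at h
  rwa [mul_one, map_one, mul_one] at h

end

section

variable {V : Type*} [AddCommGroup V] [Module ℂ V] (Q : QuantumVertexAlgebra V)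

namespace QuantumVertexAlgebra

/-- `v ↦ S_{w,z₂}(c ⊗ v)` over the field of rational functions. -/
def braidK (k : ℕ) (c : V) : V →ₗ[ℂ] K2 ⊗[ℂ] (V ⊗[ℂ] V) :=
  evK.toLinearMap.rTensor _ ∘ₗ Q.Sτ k ∘ₗ TensorProduct.mk ℂ V V c

theorem expKW_braidK (k : ℕ) (c v : V) :
    expKW (Q.braidK k c v) = braid Q.Sτ k c v := by
  have h : expK.comp evK = ι := AlgHom.ext expK_evK
  rw [braid_eq, ← h, ← evLift_rTensor]
  rfl

/-- `c ⊗ u ↦ 1 ⊗ c ⊗ h(u)` over the field of rational functions. -/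
def insertK (h : V ⊗[ℂ] V →ₗ[ℂ] V1 V) : V ⊗[ℂ] (V ⊗[ℂ] V) →ₗ[ℂ] LSer K2 (K2 ⊗[ℂ] (V ⊗[ℂ] V)) :=
  TensorProduct.lift ((LSer.map ∘ₗ LinearMap.llcomp ℂ V (V ⊗[ℂ] V) (K2 ⊗[ℂ] (V ⊗[ℂ] V))
    (TensorProduct.mk ℂ K2 (V ⊗[ℂ] V) 1) ∘ₗ TensorProduct.mk ℂ V V).compl₂ h)

theorem insertK_tmul (h : V ⊗[ℂ] V →ₗ[ℂ] V1 V) (c : V) (u : V ⊗[ℂ] V) :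
    insertK h (c ⊗ₜ u) =
      LSer.map (TensorProduct.mk ℂ K2 (V ⊗[ℂ] V) 1 ∘ₗ TensorProduct.mk ℂ V V c) (h u) := rfl

/-- An identity between series in z₃ with rational coefficients in (z₂,w) may be verified after
expansion in |w| > |z₂|, where it is `hexagon_e`. The rational form is required because braided
commutativity modulo torsion is linear over `K2`. -/
theorem hexagon_K (M k : ℕ) (m : ℤ) (a b c : V) :
    ∑ ij ∈ antidiagonal k,
      (LSer.map (Q.braidK ij.1 c) (Q.e M ij.2 m (a ⊗ₜ b)) : LSer K2 (K2 ⊗[ℂ] (V ⊗[ℂ] V))) =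
      nest Q.Sτ evN₁ evN₂ (fun i => insertK (Q.e M i m)) k (c ⊗ₜ (a ⊗ₜ b)) := by
  have hw : ∀ s : K2 ⊗[ℂ] (V ⊗[ℂ] V), expKW (kw • s) = x • expKW s := fun s => by
    rw [expKW_smul, expK_kw]
  have hz : ∀ s : K2 ⊗[ℂ] (V ⊗[ℂ] V), expKW (kz • s) = y • expKW s := fun s => by
    rw [expKW_smul, expK_kz]
  refine mapExpKW_injective ?_
  rw [map_nest (B' := L3) Q.Sτ (ev₁' := ιs) (ev₂' := ι₁₂) (LSer.map expKW)
    (map_evN₁_smul expKW hw hz (by rw [ιs, evτ_τ₁]; rfl) (by rw [ιs, evτ_τ₂]; rfl))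
    (map_evN₂_smul expKW hw hz (by rw [ι₁₂, evτ_τ₁]; rfl) (by rw [ι₁₂, evτ_τ₂]; rfl)), map_sum]
  have h1 : ∀ i, LSer.map expKW ∘ₗ insertK (Q.e M i m) = insert (Q.e M i m) := by
    intro i
    refine TensorProduct.ext' fun c u => ?_
    rw [LinearMap.comp_apply, insertK_tmul, insert_tmul, LSer.map_map]
    congr 2
    refine LinearMap.ext fun v => ?_
    change evLift expK const₂ (1 ⊗ₜ (c ⊗ₜ v)) = _
    rw [evLift_tmul, map_one, one_smul]
    rfl
  have h2 : ∀ i, expKW ∘ₗ Q.braidK i c = braid Q.Sτ i c := fun i =>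
    LinearMap.ext fun v => Q.expKW_braidK i c v
  simp only [h1, LSer.map_map, h2]
  exact Q.hexagon_e M k m a b c

/-- The `K2`-linear extension of `XY`. -/
def XYK (k : ℕ) : K2 ⊗[ℂ] (V ⊗[ℂ] V) →ₗ[ℂ] D2K V := evLift (AlgHom.id ℂ K2) (Q.XY k)

theorem XYK_smul (k : ℕ) (f : K2) (s : K2 ⊗[ℂ] (V ⊗[ℂ] V)) :
    Q.XYK k (f • s) = f • Q.XYK k s := evLift_smul _ _ _ _

theorem XX_eq_XYK (k : ℕ) (c : V) : Q.XX k ∘ₗ (TensorProduct.mk ℂ V V).flip c =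
    ∑ pq ∈ antidiagonal k, Q.XYK pq.1 ∘ₗ Q.braidK pq.2 c := by
  refine LinearMap.ext fun v => ?_
  rw [LinearMap.sum_apply]
  refine (Q.XX_eq k v c).trans (Finset.sum_congr rfl fun pq _ => ?_)
  exact (evLift_rTensor (AlgHom.id ℂ K2) evK _ _).symm

/-- `c ⊗ u ↦ X_{w,z₂}(c ⊗ h(u))`. -/
def insertD (p : ℕ) (h : V ⊗[ℂ] V →ₗ[ℂ] V1 V) :
    V ⊗[ℂ] (V ⊗[ℂ] V) →ₗ[ℂ] LSer K2 (D2K V) :=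
  TensorProduct.lift ((LSer.map ∘ₗ LinearMap.llcomp ℂ V (V ⊗[ℂ] V) (D2K V) (Q.XY p) ∘ₗ
    TensorProduct.mk ℂ V V).compl₂ h)

theorem insertD_tmul (p : ℕ) (h : V ⊗[ℂ] V →ₗ[ℂ] V1 V) (c : V) (u : V ⊗[ℂ] V) :
    Q.insertD p h (c ⊗ₜ u) = LSer.map (Q.XY p ∘ₗ TensorProduct.mk ℂ V V c) (h u) := rfl

/-- `X_{z₂,w}(e ⊗ c)` for the coefficients `e` of `(z₁ + γ)ᴹ e^{γ(∂₁ + ∂₂ - D)} X_{z₁,z₂}`. -/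
theorem sum_XX_e (M k : ℕ) (m : ℤ) (a b c : V) :
    ∑ ij ∈ antidiagonal k, (LSer.map (Q.XX ij.1 ∘ₗ (TensorProduct.mk ℂ V V).flip c)
      (Q.e M ij.2 m (a ⊗ₜ b)) : LSer K2 (D2K V)) =
    nest Q.Sτ evN₁ evN₂ (fun i => ∑ pj ∈ antidiagonal i, Q.insertD pj.1 (Q.e M pj.2 m)) k
      (c ⊗ₜ (a ⊗ₜ b)) := by
  have h1 : ∀ p i, LSer.map (Q.XYK p) ∘ₗ insertK (Q.e M i m) = Q.insertD p (Q.e M i m) := by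
    intro p i
    refine TensorProduct.ext' fun c u => ?_
    rw [LinearMap.comp_apply, insertK_tmul, insertD_tmul, LSer.map_map]
    congr 2
    refine LinearMap.ext fun v => ?_
    change evLift (AlgHom.id ℂ K2) (Q.XY p) (1 ⊗ₜ (c ⊗ₜ v)) = _
    rw [evLift_tmul, map_one, one_smul]
    rfl
  have h2 : ∀ p r, (LSer.map (Q.XYK p) (nest Q.Sτ evN₁ evN₂ (fun i => insertK (Q.e M i m)) r
      (c ⊗ₜ (a ⊗ₜ b))) : LSer K2 (D2K V)) =
      nest Q.Sτ evN₁ evN₂ (fun i => Q.insertD p (Q.e M i m)) r (c ⊗ₜ (a ⊗ₜ b)) := by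
    intro p r
    rw [map_nest (B' := LF K2) Q.Sτ (ev₁' := evN₁) (ev₂' := evN₂) (LSer.map (Q.XYK p))
      (map_evN₁_smul (Q.XYK p) (Q.XYK_smul p kw) (Q.XYK_smul p kz) (by rw [evN₁, evτ_τ₁])
        (by rw [evN₁, evτ_τ₂]; rfl))
      (map_evN₂_smul (Q.XYK p) (Q.XYK_smul p kw) (Q.XYK_smul p kz) (by rw [evN₂, evτ_τ₁])
        (by rw [evN₂, evτ_τ₂]))]
    simp only [h1]
  rw [← sum_nest Q.Sτ evN₁ evN₂ (fun p i => Q.insertD p (Q.e M i m))]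
  simp only [← h2, ← Q.hexagon_K, map_sum, XX_eq_XYK, LinearMap.sum_apply]
  exact sum_antidiagonal_assoc (fun p i j => (LSer.map (Q.XYK p) (LSer.map (Q.braidK i c)
    (Q.e M j m (a ⊗ₜ b)) : LSer K2 (K2 ⊗[ℂ] (V ⊗[ℂ] V))) : LSer K2 (D2K V))) k

end QuantumVertexAlgebra

end

/-! ## Associativity -/

section

theorem Aτ.algHom_ext {B : Type*} [CommRing B] [Algebra ℂ B] {f g : Aτ →ₐ[ℂ] B}
    (h₁ : f τ₁ = g τ₁) (h₂ : f τ₂ = g τ₂) : f = g := by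
  refine IsLocalization.algHom_ext (Submonoid.powers
    (MvPolynomial.X 0 * MvPolynomial.X 1 * (MvPolynomial.X 0 - MvPolynomial.X 1) :
      MvPolynomial (Fin 2) ℂ)) (MvPolynomial.algHom_ext fun i => ?_)
  fin_cases i
  · exact h₁
  · exact h₂

/-- The substitution `z₁ = z₂ + z₃` on the localization at `S3`. -/
def substA : A3 →ₐ[ℂ] LF K2 :=
  IsLocalization.liftAlgHom (M := S3) (f := substR) fun s => IsUnit.mk0 _ (mem_S3.1 s.2)

theorem substA_algebraMap (r : R3) : substA (algebraMap R3 A3 r) = substR r := by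
  simp [substA]

theorem substA_comp_evA₁ : substA.comp evA₁ = evN₁ := by
  refine Aτ.algHom_ext ?_ ?_
  · rw [AlgHom.comp_apply, evA₁, evN₁, evτ'_τ₁, evτ_τ₁, substA_algebraMap, substR_rw]
  · rw [AlgHom.comp_apply, evA₁, evN₁, evτ'_τ₂, evτ_τ₂, substA_algebraMap, substR_r₁]

theorem substA_comp_evA₂ : substA.comp evA₂ = evN₂ := by
  refine Aτ.algHom_ext ?_ ?_
  · rw [AlgHom.comp_apply, evA₂, evN₂, evτ'_τ₁, evτ_τ₁, substA_algebraMap, substR_rw]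
  · rw [AlgHom.comp_apply, evA₂, evN₂, evτ'_τ₂, evτ_τ₂, substA_algebraMap, substR_r₂]

variable {V : Type*} [AddCommGroup V] [Module ℂ V]

/-- Write the scalar as a fraction: the numerator acts by `substRel_smul`, and the denominator is
cancelled because it survives the substitution. -/
theorem substRel_smul_A3 (f : A3) (v : D3K V × LSer K2 (D2K V)) (h : v ∈ substRel) :
    (f • v.1, substA f • v.2) ∈ substRel := by
  obtain ⟨⟨r, s⟩, hs⟩ := IsLocalization.surj S3 f
  refine substRel_of_smul s.2 ?_
  have h1 : algebraMap R3 A3 s * f = algebraMap R3 A3 r := by rw [mul_comm]; exact hs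
  have h2 : substR s * substA f = substR r := by
    rw [← substA_algebraMap, ← substA_algebraMap, ← map_mul, h1]
  rw [smul_smul, smul_smul, h1, h2]
  exact substRel_smul h r

/-- A series in `z₃` with values in distributions in `(z₂, w)` modulo torsion, given by a
sequence of elements of `V((z₂))((z₃))` indexed by the exponent of `w`. -/
def repRel : AddSubgroup (LSer K2 (D2K V) × (ℤ → V2 V)) where
  carrier := {v | ∀ n, v.1.coeff n = emb₂ fun a => cf (v.2 a.2) a.1 n}
  zero_mem' := fun n => (map_zero emb₂).symm
  add_mem' := fun {v w} hv hw n => by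
    rw [Prod.fst_add, LSer.coeff_add, hv n, hw n, ← map_add]
    rfl
  neg_mem' := fun {v} hv n => by
    rw [Prod.fst_neg, LSer.coeff_neg, hv n, ← map_neg]
    rfl

theorem repRel_kz_zpow {Λ : LSer K2 (D2K V)} {F : ℤ → V2 V} (h : (Λ, F) ∈ repRel) (m : ℤ) :
    (LF.C kz ^ m • Λ, x ^ m • F) ∈ repRel := fun n => by
  change (LF.C kz ^ m • Λ).coeff n = emb₂ fun a => cf (x ^ m • F a.2) a.1 n
  rw [← map_zpow₀, LSer.coeff_C_smul, h n, kz_zpow_smul_emb₂]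
  simp only [cf_x_zpow_smul]

theorem repRel_var {Λ : LSer K2 (D2K V)} {F : ℤ → V2 V} (h : (Λ, F) ∈ repRel) :
    (LF.var K2 • Λ, y • F) ∈ repRel := fun n => by
  change (LF.var K2 • Λ).coeff n = emb₂ fun a => cf (y • F a.2) a.1 n
  rw [LSer.coeff_var_smul, h (n - 1)]
  simp only [cf_y_smul]

theorem repRel_var_pow {Λ : LSer K2 (D2K V)} {F : ℤ → V2 V} (h : (Λ, F) ∈ repRel) (N : ℕ) :
    (LF.var K2 ^ N • Λ, y ^ N • F) ∈ repRel := by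
  induction N with
  | zero => simpa using h
  | succ N ih =>
    rw [pow_succ', pow_succ', mul_smul, mul_smul]
    exact repRel_var ih

theorem repRel_shiftVar_pow {Λ : LSer K2 (D2K V)} {F : ℤ → V2 V} (h : (Λ, F) ∈ repRel) (M : ℕ) :
    (shiftVar ^ M • Λ, (x + y) ^ M • F) ∈ repRel := by
  induction M with
  | zero => simpa using h
  | succ M ih =>
    rw [pow_succ', pow_succ', mul_smul, mul_smul, shiftVar, add_smul, add_smul (x : L2)]
    have h1 := repRel_kz_zpow ih 1
    rw [zpow_one, zpow_one] at h1
    exact repRel.add_mem h1 (repRel_var ih)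

/-- For each exponent of z₃, the absence of negative powers of w places the family in V((z₂))((w)),
on which the passage to distributions modulo torsion is injective. -/
theorem repRel_unique {Λ : LSer K2 (D2K V)} {F F' : ℤ → V2 V} (h : (Λ, F) ∈ repRel)
    (h' : (Λ, F') ∈ repRel) (hF : ∀ r < 0, F r = 0) (hF' : ∀ r < 0, F' r = 0) : F = F' := by
  funext r
  refine LSer.ext fun n => ?_
  have h1 : ∀ r < 0, (F r).coeff n = 0 := fun r hr => by rw [hF r hr]; rfl
  have h1' : ∀ r < 0, (F' r).coeff n = 0 := fun r hr => by rw [hF' r hr]; rfl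
  have h2 : (LSer.ofFun (fun r => (F r).coeff n) 0 h1 : V2 V) = LSer.ofFun _ 0 h1' :=
    emb₂_distX_injective ((h n).symm.trans (h' n))
  exact congrArg (fun f => LSer.coeff f r) h2

/-- The expansion of `g(x + y, x)`. -/
def substV (g : ℤ → ℤ → V) (hg : IsBdd g) : V2 V :=
  LSer.ofFun (fun n => LSer.ofFun (fun m => subst g m n) (2 * hg.choose - n) fun m hm => by
    rw [subst]
    split_ifs
    · refine finsum_eq_zero_of_forall_eq_zero fun p => ?_
      rw [hg.choose_spec p _ (by omega), smul_zero]
    · rfl) 0 fun n hn => LSer.ext fun m => subst_of_neg g m hn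

@[simp] theorem cf_substV (g : ℤ → ℤ → V) (hg : IsBdd g) (m n : ℤ) :
    cf (substV g hg) m n = subst g m n := rfl

theorem repRel_substD {g : Dist (ℤ × ℤ × ℤ) V} (hg : g ∈ bddDist) :
    (substD g, fun r => substV (fun p q => g (p, q, r)) (hg r)) ∈ repRel := fun _ => rfl

end

section

variable {V : Type*} [AddCommGroup V] [Module ℂ V] (Q : QuantumVertexAlgebra V)

namespace QuantumVertexAlgebra

theorem repRel_XX (i : ℕ) (c : V) (e : V1 V) :
    ((LSer.map (Q.XX i ∘ₗ (TensorProduct.mk ℂ V V).flip c) e : LSer K2 (D2K V)),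
      fun r => (LSer.map ((vertexOp Q.X i).flip (divPow Q.D r c)) e : V2 V)) ∈ repRel := fun n => by
  change emb₂ (distX (Q.X i (e.coeff n ⊗ₜ c))) = _
  refine congrArg emb₂ (Dist.ext fun a => ?_)
  rw [distX_apply, cf_X]
  rfl

/-- The iterate `(z₂ + z₃)ᴹ X_{z₂,w}(Y(·, z₃) · ⊗ c)`. -/
def iterD (k : ℕ) (u : V ⊗[ℂ] V) (c : V) (t : ℕ × Finset ℤ) : LSer K2 (D2K V) :=
  ∑ m ∈ t.2, LF.C kz ^ m • ∑ ij ∈ antidiagonal k,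
    LSer.map (Q.XX ij.1 ∘ₗ (TensorProduct.mk ℂ V V).flip c) (Q.e t.1 ij.2 m u)

/-- The iterate `(x + y)ᴹ Y(Y(·, y) ·, x) c`. -/
def iterV (k : ℕ) (u : V ⊗[ℂ] V) (t : ℕ × Finset ℤ) (c : V) : V2 V :=
  ∑ m ∈ t.2, x ^ m • ∑ ij ∈ antidiagonal k,
    LSer.map ((vertexOp Q.X ij.1).flip c) (Q.e t.1 ij.2 m u)

theorem iterV_zero (k : ℕ) (u : V ⊗[ℂ] V) (t : ℕ × Finset ℤ) : Q.iterV k u t 0 = 0 := by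
  simp [iterV]

theorem repRel_iter (k : ℕ) (u : V ⊗[ℂ] V) (c : V) (t : ℕ × Finset ℤ) :
    (Q.iterD k u c t, fun r => Q.iterV k u t (divPow Q.D r c)) ∈ repRel := by
  have h : (fun r => Q.iterV k u t (divPow Q.D r c)) = ∑ m ∈ t.2, x ^ m • ∑ ij ∈ antidiagonal k,
      fun r => (LSer.map ((vertexOp Q.X ij.1).flip (divPow Q.D r c)) (Q.e t.1 ij.2 m u) : V2 V) := by
    funext r
    simp only [Finset.sum_apply, Pi.smul_apply]
    rfl
  rw [h, iterD, prod_mk_sum]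
  refine repRel.sum_mem fun m _ => repRel_kz_zpow ?_ m
  rw [prod_mk_sum]
  exact repRel.sum_mem fun ij _ => Q.repRel_XX _ _ _

/-- `c ⊗ u ↦ z₁ᴹ Y(c, w) X_{z₁,z₂}(u)`. -/
def smulYX (i : ℕ) (t : ℕ × Finset ℤ) : V ⊗[ℂ] (V ⊗[ℂ] V) →ₗ[ℂ] D3K V :=
  DistribSMul.toLinearMap ℂ (D3K V) (algebraMap R3 A3 (r₁ ^ t.1)) ∘ₗ Q.YX i

/-- `c ⊗ u ↦ ∑ₘ z₂ᵐ X_{w,z₂}(c ⊗ eₘ(u))`. -/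
def insertSum (i : ℕ) (t : ℕ × Finset ℤ) : V ⊗[ℂ] (V ⊗[ℂ] V) →ₗ[ℂ] LSer K2 (D2K V) :=
  ∑ m ∈ t.2, DistribSMul.toLinearMap ℂ (LSer K2 (D2K V)) (LF.C kz ^ m : LF K2) ∘ₗ
    ∑ pj ∈ antidiagonal i, Q.insertD pj.1 (Q.e t.1 pj.2 m)

/-- The iterated filter is needed because the finite set of exponents of γ may be chosen only after
the power M. -/
theorem eventually_insertSum (i : ℕ) (w : V ⊗[ℂ] (V ⊗[ℂ] V)) :
    ∀ᶠ t in (atTop : Filter ℕ).curry (atTop : Filter (Finset ℤ)),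
      (Q.smulYX i t w, Q.insertSum i t w) ∈ substRel := by
  induction w with
  | zero => exact Eventually.of_forall fun t => by simp only [map_zero]; exact substRel.zero_mem
  | add w w' hw hw' =>
    filter_upwards [hw, hw'] with t h h'
    rw [map_add, map_add]
    exact substRel.add_mem h h'
  | tmul c u =>
    rw [eventually_curry_iff]
    filter_upwards [Q.YX_rel i c u] with M hM
    filter_upwards [hM] with s hs
    have h : Q.insertSum i (M, s) (c ⊗ₜ u) = ∑ m ∈ s, LF.C kz ^ m • ∑ ij ∈ antidiagonal i,
        LSer.map (Q.XY ij.1 ∘ₗ TensorProduct.mk ℂ V V c) (Q.e M ij.2 m u) := by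
      rw [insertSum, LinearMap.sum_apply]
      refine Finset.sum_congr rfl fun m _ => ?_
      rw [LinearMap.comp_apply, LinearMap.sum_apply]
      rfl
    rw [h]
    exact hs

/-- The return of c to the right: `sum_XX_e` replaces the two braidings and X_{w,z₂}(c ⊗ ·) by
X_{z₂,w}(· ⊗ c), one power of γ = z₂ at a time. -/
theorem nest_insertSum (k : ℕ) (a b c : V) (t : ℕ × Finset ℤ) :
    nest Q.Sτ evN₁ evN₂ (fun i => Q.insertSum i t) k (c ⊗ₜ (a ⊗ₜ b)) =
      Q.iterD k (a ⊗ₜ b) c t := by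
  have h := nest_sum Q.Sτ t.2 evN₁ evN₂ (fun m i =>
    DistribSMul.toLinearMap ℂ (LSer K2 (D2K V)) (LF.C kz ^ m : LF K2) ∘ₗ
      ∑ pj ∈ antidiagonal i, Q.insertD pj.1 (Q.e t.1 pj.2 m)) k (c ⊗ₜ (a ⊗ₜ b))
  refine h.trans (Finset.sum_congr rfl fun m _ => ?_)
  rw [sum_XX_e]
  exact (map_nest Q.Sτ (DistribSMul.toLinearMap ℂ (LSer K2 (D2K V)) (LF.C kz ^ m : LF K2))
    (fun f v => smul_comm _ _ _) (fun f v => smul_comm _ _ _) _ k _).symm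

/-- The product `Y(a, z₁) X_{z₂,w}(b ⊗ c)`. -/
def prodD (k : ℕ) (a b c : V) : Dist (ℤ × ℤ × ℤ) V :=
  ∑ ij ∈ antidiagonal k, Q.prodX ij.1 a (Q.X ij.2 (b ⊗ₜ c))

theorem prodD_apply (k : ℕ) (a b c : V) (l m r : ℤ) :
    Q.prodD k a b c (l, m, r) = cf (prodOp Q.X (divPow Q.D r c) k (a ⊗ₜ b)) l m := by
  rw [prodOp_apply, prodD, Finset.sum_apply]
  refine Finset.sum_congr rfl fun ij _ => ?_
  rw [prodX_apply, cf_X]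

/-- Combines the two journeys of c. To the left of the substitution, c has been moved past b and a;
to the right it is moved back by the hexagon. The braidings on both sides correspond because
substituting z₁ = z₂ + z₃ in `evA₁`, `evA₂` gives `evN₁`, `evN₂`. -/
theorem eventually_prodD (k : ℕ) (a b c : V) :
    ∀ᶠ t in (atTop : Filter ℕ).curry (atTop : Filter (Finset ℤ)),
      (algebraMap R3 A3 (r₁ ^ t.1) • emb₃ (Q.prodD k a b c), Q.iterD k (a ⊗ₜ b) c t) ∈
        substRel := by
  have h := nest_mem_eventually Q.Sτ (ev₁ := evA₁) (ev₂ := evA₂) (ev₁' := evN₁) (ev₂' := evN₂)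
    (substRel (V := V))
    (fun f v hv => by rw [← substA_comp_evA₁]; exact substRel_smul_A3 _ v hv)
    (fun f v hv => by rw [← substA_comp_evA₂]; exact substRel_smul_A3 _ v hv)
    (fun t i => Q.smulYX i t) (fun t i => Q.insertSum i t)
    (fun i w => Q.eventually_insertSum i w) k (c ⊗ₜ (a ⊗ₜ b))
  filter_upwards [h] with t ht
  have h1 := map_nest Q.Sτ (ev₁ := evA₁) (ev₂ := evA₂) (ev₁' := evA₁) (ev₂' := evA₂)
    (DistribSMul.toLinearMap ℂ (D3K V) (algebraMap R3 A3 (r₁ ^ t.1)))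
    (fun f v => smul_comm (algebraMap R3 A3 (r₁ ^ t.1)) (evA₁ f) v)
    (fun f v => smul_comm (algebraMap R3 A3 (r₁ ^ t.1)) (evA₂ f) v) Q.YX k (c ⊗ₜ (a ⊗ₜ b))
  have h2 : nest Q.Sτ evA₁ evA₂ (fun i => Q.smulYX i t) k (c ⊗ₜ (a ⊗ₜ b)) = _ := h1.symm
  rw [nest_insertSum, h2, ← sum_prodX_X, ← map_sum] at ht
  exact ht

theorem smul_prodD_apply (N k : ℕ) (a b c : V) (l m r : ℤ) :
    ((r₁ - r₂) ^ N • Q.prodD k a b c) (l, m, r) =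
      cf ((x - y) ^ N • prodOp Q.X (divPow Q.D r c) k (a ⊗ₜ b)) l m := by
  induction N generalizing l m with
  | zero => rw [pow_zero, pow_zero, one_smul, one_smul, prodD_apply]
  | succ N ih =>
    rw [pow_succ', pow_succ', mul_smul, mul_smul, sub_smul, sub_smul, Pi.sub_apply, r₁_smul_apply,
      r₂_smul_apply, ih, ih, cf_sub, cf_x_smul, cf_y_smul]

/-- Associativity. -/
theorem associativity (N k : ℕ) (a b c : V)
    (h : ∀ r, IsBdd (cf ((x - y) ^ N • prodOp Q.X (divPow Q.D r c) k (a ⊗ₜ b)))) (m n : ℤ) :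
    cf (y ^ N • comp (iterOp Q.X c) ιγ₀ Q.Sγ k (a ⊗ₜ b)) m n =
      subst (cf ((x - y) ^ N • prodOp Q.X c k (a ⊗ₜ b))) m n := by
  obtain ⟨M, hM1, hM2⟩ := ((eventually_curry_iff.1 (Q.eventually_prodD k a b c)).and
    (Q.iterate_eq k (a ⊗ₜ b))).exists
  obtain ⟨s, hs1, hs2⟩ := (hM1.and hM2).exists
  set g := (r₁ - r₂) ^ N • Q.prodD k a b c with hg
  have hgb : g ∈ bddDist := fun r => by
    obtain ⟨B, hB⟩ := h r
    exact ⟨B, fun p q hpq => (Q.smul_prodD_apply N k a b c p q r).trans (hB p q hpq)⟩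
  have h1 := substRel_smul hs1 ((r₁ - r₂) ^ N)
  rw [map_pow substR, substR_r₁_sub_r₂, smul_smul, ← map_mul, mul_comm, map_mul, mul_smul,
    ← emb₃_smul, ← hg] at h1
  have h2 := substRel_smul (substRel_mk hgb) (r₁ ^ M)
  rw [map_pow substR, substR_r₁] at h2
  -- The same distribution z₁^M(z₁-z₂)^N times the product has been substituted in two ways: through
  -- the iterate, and directly as a bounded distribution.
  have h3 := substRel_functional h1 h2
  have h4 := repRel_var_pow (Q.repRel_iter k (a ⊗ₜ b) c (M, s)) N
  rw [h3] at h4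
  have h5 := repRel_shiftVar_pow (repRel_substD hgb) M
  -- Both families come from e^{wD}c and so have no negative powers of w; equality modulo torsion is
  -- therefore genuine equality.
  have h6 := repRel_unique h4 h5 (fun r hr => by
    change y ^ N • Q.iterV k (a ⊗ₜ b) (M, s) (divPow Q.D r c) = 0
    rw [divPow_of_neg _ hr, LinearMap.zero_apply, iterV_zero, smul_zero]) (fun r hr => by
    change (x + y) ^ M • substV (fun p q => g (p, q, r)) (hgb r) = 0
    have : substV (fun p q => g (p, q, r)) (hgb r) = 0 := by
      refine V2.ext fun m n => ?_
      rw [cf_substV]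
      have h0 : (fun p q => g (p, q, r)) = fun _ _ => 0 := by
        funext p q
        rw [hg, smul_prodD_apply, divPow_of_neg _ hr, LinearMap.zero_apply]
        have : prodOp Q.X 0 k (a ⊗ₜ[ℂ] b) = 0 := by
          refine V2.ext fun p q => ?_
          rw [prodOp_apply]
          simp
        rw [this, smul_zero, cf_zero]
      rw [h0, subst]
      simp
    rw [this, smul_zero])
  -- The auxiliary variable has done its work: at w⁰ the vector e^{wD}c is c itself.
  have h7 : y ^ N • Q.iterV k (a ⊗ₜ b) (M, s) (divPow Q.D 0 c) =
      (x + y) ^ M • substV (fun p q => g (p, q, 0)) (hgb 0) := congrFun h6 0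
  rw [divPow_zero, LinearMap.id_apply] at h7
  have h8 : Q.iterV k (a ⊗ₜ b) (M, s) c = (x + y) ^ M • comp (iterOp Q.X c) ιγ₀ Q.Sγ k (a ⊗ₜ b) :=
    (hs2 c).symm
  rw [h8, smul_comm] at h7
  -- x + y is a nonzero element of the field `L2`, so the auxiliary factor (x+y)^M can be cancelled.
  have h9 := smul_right_injective _ (pow_ne_zero M x_add_y_ne) h7
  have h10 := congrArg (fun f => cf f m n) h9
  refine h10.trans ?_
  rw [cf_substV]
  congr 1
  funext p q
  rw [hg, smul_prodD_apply, divPow_zero, LinearMap.id_apply]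

end QuantumVertexAlgebra

end

/-! ## The Jacobi identity -/

section

variable {V : Type*} [AddCommGroup V] [Module ℂ V]

theorem LSer.IsReg.zpow_smul {L M : Type*} [Field L] [Algebra ℂ L] [AddCommGroup M] [Module ℂ M]
    [Module L M] [IsScalarTower ℂ L M] {a : LF L} (ha : ∀ n < 0, a.coeff n = 0)
    (h0 : a.coeff 0 ≠ 0) {f : LSer L M} (hf : f.IsReg) (e : ℤ) : (a ^ e • f).IsReg := by
  have ha0 : a ≠ 0 := fun h => h0 (by rw [h]; rfl)
  induction e with
  | zero => simpa using hf
  | succ n ih => rw [zpow_add_one₀ ha0, mul_comm, mul_smul]; exact LSer.IsReg.smul ha ih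
  | pred n ih =>
    refine LSer.IsReg.of_smul ha h0 ?_
    rw [smul_smul, mul_comm, ← zpow_add_one₀ ha0, sub_add_cancel]
    exact ih

/-- A series with invertible constant term does not lower the order in the small variable, nor do
its negative powers. -/
theorem cf_zpow_smul_of_lt {a : L2} (ha : ∀ n < 0, a.coeff n = 0) (h0 : a.coeff 0 ≠ 0) {f : V2 V}
    {B : ℤ} (hf : ∀ p q, q < B → cf f p q = 0) (e p : ℤ) {q : ℤ} (hq : q < B) :
    cf (a ^ e • f) p q = 0 := by
  have h : (y ^ (-B) • f).IsReg := fun n hn => LSer.ext fun p =>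
    (cf_y_zpow_smul f (-B) p n).trans (hf _ _ (by omega))
  have h1 := congrArg (fun v => LSer.coeff v p)
    (h.zpow_smul ha h0 e (q - B) (by omega))
  rw [smul_comm] at h1
  have h2 := cf_y_zpow_smul (a ^ e • f) (-B) p (q - B)
  rw [sub_neg_eq_add, sub_add_cancel] at h2
  exact h2.symm.trans h1

theorem y_sub_x_ne : y - x ≠ 0 := sub_ne_zero.2 (sub_ne_zero.1 x_sub_y_ne).symm

theorem cf_x_sub_y_zpow_smul_of_lt {f : V2 V} {B : ℤ} (hf : ∀ p q, q < B → cf f p q = 0)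
    (e p : ℤ) {q : ℤ} (hq : q < B) : cf ((x - y) ^ e • f) p q = 0 :=
  cf_zpow_smul_of_lt (fun n hn => by simp [x, y, hn.ne, show n ≠ 1 by omega])
    (by simp [x, y, var_ne]) hf e p hq

theorem cf_y_sub_x_zpow_smul_of_lt {f : V2 V} {B : ℤ} (hf : ∀ p q, q < B → cf f p q = 0)
    (e p : ℤ) {q : ℤ} (hq : q < B) : cf ((y - x) ^ e • f) p q = 0 :=
  cf_zpow_smul_of_lt (fun n hn => by simp [x, y, hn.ne, show n ≠ 1 by omega])
    (by simp [x, y, var_ne]) hf e p hq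

theorem cf_x_add_y_zpow_smul_of_lt {f : V2 V} {B : ℤ} (hf : ∀ p q, q < B → cf f p q = 0)
    (e p : ℤ) {q : ℤ} (hq : q < B) : cf ((x + y) ^ e • f) p q = 0 :=
  cf_zpow_smul_of_lt (fun n hn => by simp [x, y, hn.ne, show n ≠ 1 by omega])
    (by simp [x, y, var_ne]) hf e p hq

theorem cf_x_sub_y_zpow_smul (f : V2 V) (e p q : ℤ) :
    cf ((x - y) ^ e • f) (p - 1) q - cf ((x - y) ^ e • f) p (q - 1) =
      cf ((x - y) ^ (e + 1) • f) p q := by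
  rw [zpow_add_one₀ x_sub_y_ne, mul_comm, mul_smul, sub_smul, cf_sub, cf_x_smul, cf_y_smul]

theorem cf_y_sub_x_zpow_smul (f : V2 V) (e p q : ℤ) :
    cf ((y - x) ^ e • f) q (p - 1) - cf ((y - x) ^ e • f) (q - 1) p =
      cf ((y - x) ^ (e + 1) • f) q p := by
  rw [zpow_add_one₀ y_sub_x_ne, mul_comm, mul_smul, sub_smul, cf_sub, cf_x_smul, cf_y_smul]

theorem cf_x_add_y_zpow_smul (f : V2 V) (e p q : ℤ) :
    cf ((x + y) ^ e • f) (p - 1) q + cf ((x + y) ^ e • f) p (q - 1) =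
      cf ((x + y) ^ (e + 1) • f) p q := by
  rw [zpow_add_one₀ x_add_y_ne, mul_comm, mul_smul, add_smul, cf_add, cf_x_smul, cf_y_smul]

theorem subst_indicator (G : ℤ → V) (m : ℤ) (n : ℕ) :
    subst (fun p q => if p = 0 then G q else 0) m n = if n = 0 then G m else 0 := by
  rw [subst, if_pos (Int.natCast_nonneg n), finsum_eq_single _ 0]
  · rw [if_pos rfl, Int.toNat_natCast, Ring.choose_zero_ite]
    split_ifs with h
    · simp [h]
    · simp
  · intro p hp
    rw [if_neg hp, smul_zero]

/-- The part of `g(p + 1 + ·, ·)` without negative powers of the first variable. -/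
def posPart (g : ℤ → ℤ → V) (p p' q' : ℤ) : V := if 0 ≤ p' then g (p + 1 + p') q' else 0

theorem isBdd_posPart {g : ℤ → ℤ → V} (hg : IsBdd g) (p : ℤ) : IsBdd (posPart g p) := by
  obtain ⟨B, hB⟩ := hg
  refine ⟨min 0 B, fun p' q' h => ?_⟩
  rw [posPart]
  split_ifs
  · exact hB _ _ (by omega)
  · rfl

/-- Passing from p to p + 1 shifts the truncated distribution by one and drops its term of exponent
0. The shift is Pascal's rule; the dropped term contributes only to z₃⁰. -/
theorem subst_posPart {g : ℤ → ℤ → V} (hg : IsBdd g) (p m : ℤ) (n : ℕ) :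
    subst (posPart g p) m n = subst (posPart g (p + 1)) (m - 1) n +
      subst (posPart g (p + 1)) m (n - 1) + if n = 0 then g (p + 1) m else 0 := by
  obtain ⟨B, hB⟩ := isBdd_posPart hg (p + 1)
  obtain ⟨B', hB'⟩ := hg
  rw [← subst_shift_left ⟨B, hB⟩, ← subst_indicator, ← subst_add]
  · congr 1
    funext p' q'
    simp only [posPart]
    rcases lt_trichotomy p' 0 with h | rfl | h
    · rw [if_neg (by omega), if_neg (by omega), if_neg (by omega), add_zero]
    · simp
    · rw [if_pos (by omega), if_pos (by omega), if_neg (by omega), add_zero]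
      congr 1
      ring
  · exact ⟨B, fun p' q' h => hB _ _ (by omega)⟩
  · refine ⟨min 0 B', fun p' q' h => ?_⟩
    change (if p' = 0 then g (p + 1) q' else 0) = 0
    split_ifs
    · exact hB' _ _ (by omega)
    · rfl

theorem subst_posPart_of_lt {g : ℤ → ℤ → V} {B : ℤ} (hB : ∀ p q, q < B → g p q = 0) (p : ℤ)
    {m : ℤ} (hm : m < B) (n : ℕ) : subst (posPart g p) m n = 0 := by
  rw [subst, if_pos (Int.natCast_nonneg n)]
  refine finsum_eq_zero_of_forall_eq_zero fun p' => ?_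
  rw [posPart]
  split_ifs with h
  · obtain ⟨p', rfl⟩ := Int.eq_ofNat_of_zero_le h
    rw [Int.toNat_natCast, Ring.choose_natCast]
    by_cases h' : p' < n
    · rw [Nat.choose_eq_zero_of_lt h', Nat.cast_zero, zero_smul]
    · rw [hB _ _ (by omega), smul_zero]
  · rw [smul_zero]

/-- The expansion of `(x - y)⁻ⁿ⁻¹ f` in the region `|x| > |y|`. -/
theorem cf_sub_zpow_smul {f : V2 V} (hf : IsBdd (cf f)) (n : ℕ) (p q : ℤ) :
    cf ((x - y) ^ (-n - 1 : ℤ) • f) p q = subst (posPart (cf f) p) q n := by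
  obtain ⟨B, hB⟩ := id hf
  have step : ∀ n : ℕ, (∀ p q, cf ((x - y) ^ (-n : ℤ) • f) p q =
      subst (posPart (cf f) p) q (n - 1) + if n = 0 then cf f p q else 0) →
      ∀ p q, cf ((x - y) ^ (-n - 1 : ℤ) • f) p q = subst (posPart (cf f) p) q n := by
    intro n hn
    -- Induction on the distance of q from the lower bound, using that multiplication by x - y
    -- lowers the order of the pole by one; below the bound both sides vanish.
    have key : ∀ (j : ℕ) p q, q < B + j →
        cf ((x - y) ^ (-n - 1 : ℤ) • f) p q = subst (posPart (cf f) p) q n := by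
      intro j
      induction j with
      | zero =>
        intro p q hq
        rw [subst_posPart_of_lt (fun p q h => hB p q (Or.inr h)) p (by simpa using hq),
          cf_x_sub_y_zpow_smul_of_lt (fun p q h => hB p q (Or.inr h)) _ _ (by simpa using hq)]
      | succ j ih =>
        intro p q hq
        have h := cf_x_sub_y_zpow_smul f (-n - 1) (p + 1) q
        rw [add_sub_cancel_right, sub_add_cancel, sub_eq_iff_eq_add,
          ih (p + 1) (q - 1) (by push_cast at hq; omega), hn] at h
        rw [h, subst_posPart hf p q n]
        abel
    exact fun p q => key (q - B + 1).toNat p q (by omega)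
  induction n generalizing p q with
  | zero =>
    refine step 0 (fun p q => ?_) p q
    rw [subst_of_neg _ _ (by norm_num)]
    simp
  | succ n ih =>
    refine step (n + 1) (fun p q => ?_) p q
    rw [if_neg (by omega), add_zero, Nat.cast_succ, neg_add', add_sub_cancel_right]
    exact ih p q

theorem cf_x_add_y_pow_smul_substV {g : ℤ → ℤ → V} (hg : IsBdd g) (j : ℕ) (m n : ℤ) :
    cf ((x + y) ^ j • substV g hg) m n = subst (fun p q => g (p - j) q) m n := by
  induction j generalizing m n with
  | zero => simp
  | succ j ih =>
    have hb : IsBdd fun p q => g (p - j) q := by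
      obtain ⟨B, hB⟩ := hg
      exact ⟨B, fun p q h => hB _ _ (by omega)⟩
    rw [pow_succ', mul_smul, add_smul, cf_add, cf_x_smul, cf_y_smul, ih, ih,
      ← subst_shift_left hb]
    congr 1
    funext p q
    congr 1
    push_cast
    ring

/-- The Jacobi identity for a pair of expansions of the same bounded distribution. -/
theorem jacobi_of_bdd {f f' : V2 V} (h : ∀ p q, cf f p q = cf f' q p) (hf : IsBdd (cf f))
    (n l m : ℤ) :
    cf ((x - y) ^ (-n - 1) • f) l m - cf ((y - x) ^ (-n - 1) • f') m l =
      cf ((x + y) ^ (-l - 1) • substV (cf f) hf) m n := by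
  have hreg : ∀ p q : ℤ, q < 0 → cf (substV (cf f) hf) p q = 0 := fun p q hq =>
    subst_of_neg (cf f) p hq
  have hE : ∀ n : ℤ, n < 0 → ∀ l m : ℤ,
      cf ((x + y) ^ (-l - 1) • substV (cf f) hf) m n = 0 := fun n hn l m =>
    cf_x_add_y_zpow_smul_of_lt hreg _ _ hn
  have hneg : ∀ (j : ℕ) l m, cf ((x - y) ^ j • f) l m = cf ((y - x) ^ j • f') m l := by
    intro j
    induction j with
    | zero => intro l m; simpa using h l m
    | succ j ih =>
      intro l m
      rw [pow_succ', pow_succ', mul_smul, mul_smul, sub_smul, sub_smul, cf_sub, cf_sub, cf_x_smul,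
        cf_y_smul, cf_x_smul, cf_y_smul, ih, ih]
  -- Without a pole at z₁ = z₂ the first two terms are the same distribution, and the substituted
  -- series has no negative powers of z₃.
  by_cases hn : n < 0
  · obtain ⟨j, hj⟩ := Int.eq_ofNat_of_zero_le (show 0 ≤ -n - 1 by omega)
    rw [hE n hn, hj, zpow_natCast, zpow_natCast, hneg, sub_self]
  obtain ⟨n, rfl⟩ := Int.eq_ofNat_of_zero_le (not_lt.1 hn)
  clear hn
  obtain ⟨B, hB⟩ := id hf
  -- For very negative exponents of z₁ the reversed term vanishes, and the power of x + y is
  -- nonnegative, so it is the substitution of a power of z₁; the remaining equality is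
  -- `cf_sub_zpow_smul`.
  have small : ∀ (n : ℕ) l m, l < min B 0 →
      cf ((x - y) ^ (-n - 1 : ℤ) • f) l m - cf ((y - x) ^ (-n - 1 : ℤ) • f') m l =
        cf ((x + y) ^ (-l - 1) • substV (cf f) hf) m n := by
    intro n l m hl
    obtain ⟨j, hj⟩ := Int.eq_ofNat_of_zero_le (show 0 ≤ -l - 1 by omega)
    rw [cf_sub_zpow_smul hf, cf_y_sub_x_zpow_smul_of_lt (B := B)
      (fun p q hq => (h q p).symm.trans (hB q p (Or.inl hq))) _ _ (by omega), sub_zero, hj,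
      zpow_natCast, cf_x_add_y_pow_smul_substV]
    congr 1
    funext p q
    rw [posPart]
    split_ifs with hp
    · congr 1
      omega
    · rw [hB _ _ (Or.inl (by omega))]
  -- On all three terms multiplication by z₁ - z₂ equals multiplication by z₃. This recursion
  -- determines the coefficient at (l, m, n) from those at (l-1, m+1, n) and (l, m+1, n-1).
  have step : ∀ (n : ℕ), (∀ l m, cf ((x - y) ^ (-n : ℤ) • f) l m -
      cf ((y - x) ^ (-n : ℤ) • f') m l =
        cf ((x + y) ^ (-l - 1) • substV (cf f) hf) m (n - 1)) →
      ∀ (j : ℕ) l m, l < min B 0 + j →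
      cf ((x - y) ^ (-n - 1 : ℤ) • f) l m - cf ((y - x) ^ (-n - 1 : ℤ) • f') m l =
        cf ((x + y) ^ (-l - 1) • substV (cf f) hf) m n := by
    intro n ih j
    induction j with
    | zero => exact fun l m hl => small n l m (by omega)
    | succ j ihj =>
      intro l m hl
      have h1 := cf_x_sub_y_zpow_smul f (-n - 1) l (m + 1)
      have h2 := cf_y_sub_x_zpow_smul f' (-n - 1) l (m + 1)
      have h3 := cf_x_add_y_zpow_smul (substV (cf f) hf) (-l - 1) (m + 1) n
      have h4 := ihj (l - 1) (m + 1) (by omega)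
      have h5 := ih l (m + 1)
      rw [add_sub_cancel_right, sub_add_cancel] at h1 h2
      rw [add_sub_cancel_right, sub_add_cancel] at h3
      rw [show -(l - 1) - 1 = -l by ring, ← h3, ← h5, ← h1, ← h2] at h4
      have h6 : ∀ a b c d e : V, a - b = c + (a - d - (b - e)) → d - e = c := by
        intro a b c d e h
        have : c = a - b - (a - d - (b - e)) := by rw [h]; abel
        rw [this]; abel
      exact h6 _ _ _ _ _ h4
  have main : ∀ (n : ℕ) l m,
      cf ((x - y) ^ (-n - 1 : ℤ) • f) l m - cf ((y - x) ^ (-n - 1 : ℤ) • f') m l =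
        cf ((x + y) ^ (-l - 1) • substV (cf f) hf) m n := by
    intro n
    induction n with
    | zero =>
      intro l m
      refine step 0 (fun l m => ?_) (l - min B 0 + 1).toNat l m (by omega)
      rw [hE _ (by norm_num)]
      simp [h l m]
    | succ n ih =>
      intro l m
      refine step (n + 1) (fun l m => ?_) (l - min B 0 + 1).toNat l m (by omega)
      have := ih l m
      rw [show (-((n + 1 : ℕ) : ℤ)) = -n - 1 by push_cast; ring,
        show ((n + 1 : ℕ) : ℤ) - 1 = n by push_cast; ring]
      exact this
  exact main n l m

/-- Each of the two iterated series bounds the exponents of its own outer variable. -/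
theorem isBdd_of_swap {f f' : V2 V} (h : ∀ p q, cf f p q = cf f' q p) : IsBdd (cf f) := by
  obtain ⟨B, hB⟩ := f.exists_bound
  obtain ⟨B', hB'⟩ := f'.exists_bound
  refine ⟨min B B', fun p q hpq => ?_⟩
  by_cases hq : q < B
  · rw [cf, hB q hq]; rfl
  · rw [h, cf, hB' p (by omega)]; rfl

end

section

variable {V : Type*} [AddCommGroup V] [Module ℂ V] (Q : QuantumVertexAlgebra V)

/-- The braided Jacobi identity. -/
theorem QuantumVertexAlgebra.jacobi (a b c : V) (k : ℕ) :
    Q.productTerm a b c k - Q.reversedTerm a b c k = Q.iterateTerm a b c k := by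
  obtain ⟨N, hN⟩ := Q.locality a b (k + 1)
  have hbdd : ∀ c, IsBdd (cf ((x - y) ^ N • prodOp Q.X c k (a ⊗ₜ b))) := fun c =>
    isBdd_of_swap (hN c k (Nat.lt_succ_self k))
  have hit : y ^ N • comp (iterOp Q.X c) ιγ₀ Q.Sγ k (a ⊗ₜ b) = substV _ (hbdd c) :=
    V2.ext fun m n => Q.associativity N k a b c (fun r => hbdd _) m n
  funext l m n
  -- The exponent of z₃ is raised by N: the factors (z₁-z₂)^N cleared by locality then restore the
  -- power -n-1 on the left, and on the right the factor z₃^N from associativity shifts n + N back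
  -- to n.
  have h := jacobi_of_bdd (hN c k (Nat.lt_succ_self k)) (hbdd c) (n + N) l m
  rw [← hit, smul_comm ((x + y) ^ (-l - 1)), cf_y_pow_smul, add_sub_cancel_right, smul_smul,
    smul_smul, ← zpow_natCast, ← zpow_natCast, ← zpow_add₀ x_sub_y_ne, ← zpow_add₀ y_sub_x_ne,
    show -(n + (N : ℤ)) - 1 + N = -n - 1 by ring] at h
  exact h

end

end HDQ

end

theorem mainTheorem1 {V : Type*} [AddCommGroup V] [Module ℂ V]
    (Q : HDQ.QuantumVertexAlgebra V) (a b c : V) (k : ℕ) :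
    Q.productTerm a b c k - Q.reversedTerm a b c k = Q.iterateTerm a b c k :=
  Q.jacobi a b c k
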